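/- **Setting.** Let $1/2<l<1$ and let $\Omega=\{x\in\mathbb R^3: x_3<h(x_1,x_2)\}$ be the fluid domain of infinite depth below the surface $x_3=h(x_1,x_2)$, where $h$ is a continuous function in $W_2^{l+3/2}(\mathbb R^2)$. For $0<T<\infty$ put $Q_T=(0,T)\times\Omega$. All derivatives are weak derivatives. For $s\ge 0$, with integer part $[s]$, and an open set $U\subset\mathbb R^n$, $$\|u\|^2_{W_2^s(U)}=\sum_{0\le|\alpha|<s}\|D^\alpha u\|^2_{L^2(U)}+\|u\|^2_{\dot W_2^s(U)},$$ where $$\|u\|^2_{\dot W_2^s(U)}=\sum_{|\alpha|=s}\|D^\alpha u\|^2_{L^2(U)}\quad\text{if } s\in\mathbb Z,$$ $$\|u\|^2_{\dot W_2^s(U)}=\sum_{|\alpha|=[s]}\int_U\int_U\frac{|D^\alpha u(x)-D^\alpha u(y)|^2}{|x-y|^{n+2(s-[s])}}\,dx\,dy\quad\text{if } s\notin\mathbb Z.$$ Further, put $$\|u\|^2_{W_2^{l,l/2}(Q_T)}=\int_0^T\|u(t,\cdot)\|^2_{W_2^l(\Omega)}\,dt+\int_\Omega\|u(\cdot,x)\|^2_{W_2^{l/2}(0,T)}\,dx,$$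 $$\big(\|u\|^{(l)}_{Q_T}\big)^2=\|u\|^2_{W_2^{l,l/2}(Q_T)}+T^{-l}\|u\|^2_{L^2(Q_T)},$$ $$\big(\|u\|^{(l+2)}_{Q_T}\big)^2=\big(\|\partial_tu\|^{(l)}_{Q_T}\big)^2+\sum_{|s|=2}\big(\|D_x^su\|^{(l)}_{Q_T}\big)^2+\sum_{|s|\le1}\|D_x^su\|^2_{L^2(Q_T)},$$ $$\|u\|^2_{H^{l+2,l/2+1}(Q_T)}=\big(\|u\|^{(l+2)}_{Q_T}\big)^2+\sup_{0<t<T}\|u(t)\|^2_{W_2^{l+1}(\Omega)},$$ where the supremum is the essential supremum. $H^{l+2,l/2+1}(Q_T)$ is the space of functions for which the derivatives in this last norm exist and the norm is finite. **Proposition 4.2.** There is a constant $C>0$, depending only on $l$ and $\Omega$ (and not on $T$, $F$, $G$), such that for every $0<T<\infty$ and all vector fields $F,G:Q_T\to\mathbb R^3$ in $H^{l+2,l/2+1}(Q_T)$, $$\|F\nabla G\|^{(l)}_{Q_T}\le C\left(T+T^{(1-l)/2}+T^{1/2}\right)\|F\|_{H^{l+2,l/2+1}(Q_T)}\,\|G\|_{H^{l+2,l/2+1}(Q_T)}.$$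 Here $F\nabla G$ stands for each of the products $F_a\,\partial_iG$ $(1\le a,i\le3)$ as well as for $(F\cdot\nabla)G=\sum_iF_i\,\partial_iG$. Moreover $T+T^{(1-l)/2}+T^{1/2}\to0$ as $T\to0^+$. -/

import Mathlib

open MeasureTheory Filter Topology
open scoped ENNReal ContDiff

noncomputable section

namespace MHD

/-- `ℝⁿ` with its Euclidean norm and Lebesgue measure. -/
abbrev E (n : ℕ) : Type := EuclideanSpace ℝ (Fin n)

section Weak

variable {X V : Type*} [NormedAddCommGroup X] [NormedSpace ℝ X] [MeasureSpace X]
  [NormedAddCommGroup V] [NormedSpace ℝ V]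

/-- `v` is the weak derivative of `u` in the direction `e` on the open set `U`:
`∫_U (∂_e φ) u = - ∫_U φ v` for all test functions `φ ∈ C_c^∞(U)`. -/
def HasWeakDeriv (U : Set X) (e : X) (u v : X → V) : Prop :=
  LocallyIntegrableOn u U volume ∧ LocallyIntegrableOn v U volume ∧
    ∀ φ : X → ℝ, ContDiff ℝ ∞ φ → HasCompactSupport φ → tsupport φ ⊆ U →
      ∫ x in U, (fderiv ℝ φ x e) • u x = - ∫ x in U, φ x • v x

/-- `D α`, for the multi-indices `|α| ≤ k`, are the weak derivatives `D^α u` of `u` on `U` with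
respect to the coordinate directions `b i`. (The values `D α` with `|α| > k` play no role.) -/
def IsWeakJet {n : ℕ} (b : Fin n → X) (k : ℕ) (U : Set X) (u : X → V)
    (D : (Fin n → ℕ) → X → V) : Prop :=
  D 0 = u ∧
    (∀ α, ∑ i, α i ≤ k → AEStronglyMeasurable (D α) (volume.restrict U)) ∧
    ∀ α i, ∑ j, α j < k → HasWeakDeriv U (b i) (D α) (D (α + Pi.single i 1))

/-- The multi-indices of length `n` and order exactly `k`. -/
def multiIdx (n k : ℕ) : Finset (Fin n → ℕ) := Finset.piAntidiag Finset.univ k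

/-- `‖u‖²_{L²(U)}`, with values in `[0, ∞]`. -/
def l2Sq (U : Set X) (u : X → V) : ℝ≥0∞ := ∫⁻ x in U, ‖u x‖ₑ ^ 2

/-- The double integral `∫_U ∫_U |v(x) - v(y)|² / |x - y|^(n + 2θ) dx dy`. -/
def slobodetskiiSq (n : ℕ) (θ : ℝ) (U : Set X) (v : X → V) : ℝ≥0∞ :=
  ∫⁻ x in U, ∫⁻ y in U, ‖v x - v y‖ₑ ^ 2 / ENNReal.ofReal (‖x - y‖ ^ ((n : ℝ) + 2 * θ))

/-- The square of the norm of `W_2^s(U)`, for `s ≥ 0` and `U` an open subset of an `n`-dimensional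
space with coordinate directions `b i`:
`∑_{|α| < s} ‖D^α u‖²_{L²(U)}` plus the top order part, which is `∑_{|α| = s} ‖D^α u‖²_{L²(U)}`
for integral `s`, and `∑_{|α| = [s]} ∬ |D^α u(x) - D^α u(y)|² / |x - y|^(n + 2(s - [s]))` otherwise.
The infimum runs over the versions of the weak derivatives, all of which give the same value; it
is `∞` if `u` does not have weak derivatives up to order `[s]`. -/
def sobolevSq {n : ℕ} (b : Fin n → X) (s : ℝ) (U : Set X) (u : X → V) : ℝ≥0∞ :=
  ⨅ (D : (Fin n → ℕ) → X → V) (_ : IsWeakJet b ⌊s⌋₊ U u D),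
    (∑ k ∈ Finset.range ⌈s⌉₊, ∑ α ∈ multiIdx n k, l2Sq U (D α)) +
      ∑ α ∈ multiIdx n ⌊s⌋₊,
        if Int.fract s = 0 then l2Sq U (D α) else slobodetskiiSq n (Int.fract s) U (D α)

end Weak

/-- The coordinate directions of `ℝⁿ`. -/
def dirE (n : ℕ) (i : Fin n) : E n := EuclideanSpace.single i 1

/-- The coordinate direction of the real line. -/
def dirR (_ : Fin 1) : ℝ := 1

/-- The spatial coordinate directions in space-time `ℝ × ℝ³`, whose points are the `(t, x)`. -/
def dirX (i : Fin 3) : ℝ × E 3 := (0, EuclideanSpace.single i 1)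

/-- The time direction in space-time `ℝ × ℝ³`. -/
def dirT : ℝ × E 3 := (1, 0)

/-- The fluid domain of infinite depth below the graph of `h`:
`{(x₁, x₂, x₃) | x₃ < h(x₁, x₂)}`. -/
def fluidDomain (h : E 2 → ℝ) : Set (E 3) := {x | x 2 < h !₂[x 0, x 1]}

/-- The surface `x₃ = h(x₁, x₂)` is of class `W_2^s`: `h` is a continuous function
in `W_2^s(ℝ²)`. -/
def IsSobolevSurface (s : ℝ) (h : E 2 → ℝ) : Prop :=
  Continuous h ∧ sobolevSq (dirE 2) s Set.univ h < ⊤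

section Norms

variable {V : Type*} [NormedAddCommGroup V] [NormedSpace ℝ V]

/-- The space-time cylinder, `(0, T) × Ω`. -/
def cyl (Ω : Set (E 3)) (T : ℝ) : Set (ℝ × E 3) := Set.Ioo 0 T ×ˢ Ω

/-- `‖u‖²` in `W_2^{l,l/2}(Q_T)`:
`∫_0^T ‖u(t,·)‖²_{W_2^l(Ω)} dt + ∫_Ω ‖u(·,x)‖²_{W_2^{l/2}(0,T)} dx`. -/
def anisoSq (l : ℝ) (Ω : Set (E 3)) (T : ℝ) (u : ℝ × E 3 → V) : ℝ≥0∞ :=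
  (∫⁻ t in Set.Ioo 0 T, sobolevSq (dirE 3) l Ω (fun x => u (t, x))) +
    ∫⁻ x in Ω, sobolevSq dirR (l / 2) (Set.Ioo 0 T) (fun t => u (t, x))

/-- The square of `‖u‖^{(l)}_{Q_T}`: `‖u‖²_{W_2^{l,l/2}(Q_T)} + T^{-l} ‖u‖²_{L²(Q_T)}`. -/
def lSq (l : ℝ) (Ω : Set (E 3)) (T : ℝ) (u : ℝ × E 3 → V) : ℝ≥0∞ :=
  anisoSq l Ω T u + ENNReal.ofReal (T ^ (-l)) * l2Sq (cyl Ω T) u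

/-- `‖u‖^{(l)}_{Q_T}`. -/
def lNorm (l : ℝ) (Ω : Set (E 3)) (T : ℝ) (u : ℝ × E 3 → V) : ℝ≥0∞ :=
  lSq l Ω T u ^ (1 / 2 : ℝ)

/-- The square of `‖u‖^{(l+2)}_{Q_T}`:
`(‖∂_t u‖^{(l)})² + ∑_{|s| = 2} (‖D_x^s u‖^{(l)})² + ∑_{|s| ≤ 1} ‖D_x^s u‖²_{L²(Q_T)}`,
with weak derivatives on `Q_T`; it is `∞` if these do not exist. -/
def l2plusSq (l : ℝ) (Ω : Set (E 3)) (T : ℝ) (u : ℝ × E 3 → V) : ℝ≥0∞ :=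
  ⨅ (ut : ℝ × E 3 → V) (_ : HasWeakDeriv (cyl Ω T) dirT u ut)
    (D : (Fin 3 → ℕ) → ℝ × E 3 → V) (_ : IsWeakJet dirX 2 (cyl Ω T) u D),
    lSq l Ω T ut + (∑ s ∈ multiIdx 3 2, lSq l Ω T (D s)) +
      ∑ k ∈ Finset.range 2, ∑ s ∈ multiIdx 3 k, l2Sq (cyl Ω T) (D s)

/-- The square of the norm of `H^{l+2,l/2+1}(Q_T)`:
`(‖u‖^{(l+2)}_{Q_T})² + sup_{t < T} ‖u(t)‖²_{W_2^{l+1}(Ω)}`; the supremum is the essential one,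
so that the norm depends only on the almost everywhere class of `u`. -/
def hSq (l : ℝ) (Ω : Set (E 3)) (T : ℝ) (u : ℝ × E 3 → V) : ℝ≥0∞ :=
  l2plusSq l Ω T u +
    essSup (fun t => sobolevSq (dirE 3) (l + 1) Ω (fun x => u (t, x)))
      (volume.restrict (Set.Ioo 0 T))

/-- The norm of `H^{l+2,l/2+1}(Q_T)`, with values in `[0, ∞]`. -/
def hNorm (l : ℝ) (Ω : Set (E 3)) (T : ℝ) (u : ℝ × E 3 → V) : ℝ≥0∞ :=
  hSq l Ω T u ^ (1 / 2 : ℝ)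

/-- `u ∈ H^{l+2,l/2+1}(Q_T)`: the weak derivatives exist and the norm is finite. -/
def MemH (l : ℝ) (Ω : Set (E 3)) (T : ℝ) (u : ℝ × E 3 → V) : Prop :=
  hNorm l Ω T u < ⊤

/-- `DG i`, `i = 1, 2, 3`, are the weak spatial derivatives `∂_i G` of `G` on `Q_T`. -/
def IsWeakGrad (Ω : Set (E 3)) (T : ℝ) (G : ℝ × E 3 → V) (DG : Fin 3 → ℝ × E 3 → V) : Prop :=
  ∀ i, HasWeakDeriv (cyl Ω T) (dirX i) G (DG i)

end Norms

end MHD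

end

open MeasureTheory Filter Topology
open scoped ENNReal ContDiff NNReal

noncomputable section

namespace MHD

/-! ### Cauchy–Schwarz inequalities with values in `ℝ≥0∞` -/

section Basic

/-! Geometry. The gradient of `h` has smoothness `l + 1/2 > 1` on the plane, hence is bounded, so
`h` is globally Lipschitz and `Ω` is stable under translation by a fixed open downward cone. This
property, `ConeDomain`, is all that is used of `Ω` afterwards. Mollifying with kernels supported in
the cone stays inside `Ω` and increases neither the `L²` norm nor the Slobodetskii seminorm.
Inequalities proved for smooth functions by integrating along the rays of the cone therefore pass to
weak derivatives without any extension operator. They are the embeddings of `W_2^{1+θ}`, `n/2 - 1 <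
θ < n/2`, into `L^∞` and into a Hölder space, and the interpolation `δ²‖∇u‖² ≤ C(‖u‖² + δ⁴‖∇²u‖²)`.

Information on one factor (`HData`). Let `‖F‖² < P`. For almost every `t`, `F(t)` is bounded and
locally Hölder of exponent `l - 1/2`, with squared constants of order `P`. It is also Lipschitz with
bounded gradient, with squared constants of order `b(t)`, where `b` is built from the gradient and
second derivatives of the slice and `∫ b ≤ CP`. The weak time derivative controls `F(s + r) - F(s)`
in `L²(Ω)`. Interpolation with `δ² = |r|` then controls the time increments of the gradient.

Product. An increment of `p = F∇G` splits into `F` times an increment of `∇G` plus an increment of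
`F` times `∇G`. In space, the first term is bounded by the sup of `F` and the seminorm of `∇G`. In
the second, a geometric mean of the Hölder and Lipschitz bounds gives `|F(x) - F(y)|²` the power `2l
+ (2l - 1)(1 - l)` of `|x - y|`. This beats `|x - y|^{-(3+2l)}` by a positive power, so the kernel
is integrable near 0; far away `|x - y|^{-(3+2l)}` is integrable by itself. In time, `∫∫ |p(s + r) -
p(s)|² dx ds` is at most `C|r|PQ`, where `Q > ‖G‖²`, and `∫_{|r|<T} |r|·|r|^{-1-l} dr` is of order
`T^{1-l}`. Altogether the square of the norm is at most `C(T + T^{1-l})PQ`. Letting `P` and `Q`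
decrease to the squared norms and taking roots gives the claim. -/

theorem sq_lintegral_le {α : Type*} [MeasurableSpace α] (μ : Measure α) {f : α → ℝ≥0∞}
    (hf : AEMeasurable f μ) : (∫⁻ a, f a ∂μ) ^ 2 ≤ μ Set.univ * ∫⁻ a, f a ^ 2 ∂μ := by
  have h := ENNReal.lintegral_mul_le_Lp_mul_Lq μ (p := 2) (q := 2)
    (by constructor <;> norm_num) hf (aemeasurable_const (b := (1 : ℝ≥0∞)))
  simp only [Pi.mul_apply, mul_one, ENNReal.one_rpow, lintegral_const, one_mul] at h
  calc (∫⁻ a, f a ∂μ) ^ 2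
      ≤ ((∫⁻ a, f a ^ (2 : ℝ) ∂μ) ^ (1 / 2 : ℝ) * μ Set.univ ^ (1 / 2 : ℝ)) ^ 2 := by gcongr
    _ = μ Set.univ * ∫⁻ a, f a ^ 2 ∂μ := by
      rw [mul_pow, ← ENNReal.rpow_natCast, ← ENNReal.rpow_natCast, ← ENNReal.rpow_mul,
        ← ENNReal.rpow_mul]
      norm_num [mul_comm]

theorem add_sq_le_two_mul (a b : ℝ≥0∞) : (a + b) ^ 2 ≤ 2 * (a ^ 2 + b ^ 2) := by
  have := ENNReal.rpow_add_le_mul_rpow_add_rpow a b (p := 2) (by norm_num)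
  norm_num at this
  exact_mod_cast this

theorem sum_sq_le_card_mul {ι : Type*} (s : Finset ι) (f : ι → ℝ≥0∞) :
    (∑ i ∈ s, f i) ^ 2 ≤ s.card * ∑ i ∈ s, f i ^ 2 := by
  have := ENNReal.inner_le_Lp_mul_Lq s (fun _ => 1) f (p := 2) (q := 2)
    (by constructor <;> norm_num)
  simp only [one_mul, ENNReal.one_rpow, Finset.sum_const, nsmul_eq_mul, mul_one] at this
  calc (∑ i ∈ s, f i) ^ 2
      ≤ ((s.card : ℝ≥0∞) ^ (1 / 2 : ℝ) * (∑ i ∈ s, f i ^ (2 : ℝ)) ^ (1 / 2 : ℝ)) ^ 2 := by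
        gcongr
    _ = s.card * ∑ i ∈ s, f i ^ 2 := by
      rw [mul_pow, ← ENNReal.rpow_natCast, ← ENNReal.rpow_natCast, ← ENNReal.rpow_mul,
        ← ENNReal.rpow_mul]
      norm_num

end Basic

/-- `Ω` is open and contains, with each point, the cone spanned by the ball `B(c, ρ)`. -/
structure ConeDomain {n : ℕ} (Ω : Set (E n)) (c : E n) (ρ : ℝ) : Prop where
  pos : 0 < ρ
  isOpen : IsOpen Ω
  add_mem : ∀ x ∈ Ω, ∀ σ : ℝ, 0 ≤ σ → ∀ z ∈ Metric.ball c ρ, x + σ • z ∈ Ω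

/-! ### Mollification with kernels supported in the cone -/

namespace ConeDomain

variable {n : ℕ} {Ω : Set (E n)} {c : E n} {ρ : ℝ} (hΩ : ConeDomain Ω c ρ)
  {V : Type*} [NormedAddCommGroup V] [NormedSpace ℝ V]

include hΩ in
theorem measurableSet : MeasurableSet Ω := hΩ.isOpen.measurableSet

/-- A bump function in the cone, at distance of order `1 / (k + 1)` from the vertex. -/
def bump (hΩ : ConeDomain Ω c ρ) (k : ℕ) : ContDiffBump ((1 / ((k : ℝ) + 1)) • c) where
  rIn := 1 / ((k : ℝ) + 1) * (ρ / 3)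
  rOut := 1 / ((k : ℝ) + 1) * (ρ / 2)
  rIn_pos := by have := hΩ.pos; positivity
  rIn_lt_rOut := by
    have := hΩ.pos
    have h : 0 < 1 / ((k : ℝ) + 1) := by positivity
    gcongr; norm_num

/-- The normalised mollifier with support in the cone. -/
def kern (hΩ : ConeDomain Ω c ρ) (k : ℕ) : E n → ℝ := (hΩ.bump k).normed volume

theorem kern_nonneg (k : ℕ) (z : E n) : 0 ≤ hΩ.kern k z := (hΩ.bump k).nonneg_normed z

theorem contDiff_kern (k : ℕ) : ContDiff ℝ ∞ (hΩ.kern k) := (hΩ.bump k).contDiff_normed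

theorem hasCompactSupport_kern (k : ℕ) : HasCompactSupport (hΩ.kern k) :=
  (hΩ.bump k).hasCompactSupport_normed

theorem integral_kern (k : ℕ) : ∫ z, hΩ.kern k z = 1 := (hΩ.bump k).integral_normed

theorem integrable_kern (k : ℕ) : Integrable (hΩ.kern k) := (hΩ.bump k).integrable_normed

theorem tsupport_kern (k : ℕ) : tsupport (hΩ.kern k) =
    Metric.closedBall ((1 / ((k : ℝ) + 1)) • c) (1 / ((k : ℝ) + 1) * (ρ / 2)) :=
  (hΩ.bump k).tsupport_normed_eq

/-- At scale `ε = 1 / (k + 1)` the support is the closed ball of radius `ερ/2` about `εc`, so `ε⁻¹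
z` lies in `B(c, ρ)` and the cone property applies with `σ = ε`. -/
theorem add_mem_of_mem_tsupport {k : ℕ} {x z : E n} (hx : x ∈ Ω) (hz : z ∈ tsupport (hΩ.kern k)) :
    x + z ∈ Ω := by
  rw [tsupport_kern] at hz
  have hρ := hΩ.pos
  set ε : ℝ := 1 / ((k : ℝ) + 1) with hε
  have hε0 : 0 < ε := by positivity
  have h := hΩ.add_mem x hx ε hε0.le (ε⁻¹ • z) (by
    rw [Metric.mem_closedBall, dist_eq_norm] at hz
    rw [Metric.mem_ball, dist_eq_norm]
    have h1 : ε⁻¹ • z - c = ε⁻¹ • (z - ε • c) := by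
      rw [smul_sub, smul_smul, inv_mul_cancel₀ hε0.ne', one_smul]
    rw [h1, norm_smul, Real.norm_of_nonneg (by positivity)]
    calc ε⁻¹ * ‖z - ε • c‖ ≤ ε⁻¹ * (ε * (ρ / 2)) := by gcongr
      _ = ρ / 2 := by field_simp
      _ < ρ := by linarith)
  rwa [smul_smul, mul_inv_cancel₀ hε0.ne', one_smul] at h

/-- The probability measure with density `kern k`. -/
def kernMeasure (hΩ : ConeDomain Ω c ρ) (k : ℕ) : Measure (E n) :=
  volume.withDensity fun z => ENNReal.ofReal (hΩ.kern k z)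

instance (k : ℕ) : IsProbabilityMeasure (hΩ.kernMeasure k) := by
  constructor
  rw [kernMeasure, withDensity_apply _ MeasurableSet.univ, Measure.restrict_univ,
    ← ofReal_integral_eq_lintegral_ofReal (hΩ.integrable_kern k)
      (ae_of_all _ (hΩ.kern_nonneg k)), integral_kern, ENNReal.ofReal_one]

theorem ae_kernMeasure_mem (k : ℕ) :
    ∀ᵐ z ∂hΩ.kernMeasure k, z ∈ tsupport (hΩ.kern k) := by
  rw [kernMeasure, ae_withDensity_iff (by
    exact (hΩ.contDiff_kern k).continuous.measurable.ennreal_ofReal)]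
  refine ae_of_all _ fun z hz => subset_tsupport _ ?_
  intro h
  simp [h] at hz

/-- Mollification, by averaging over points of the cone. -/
def moll (hΩ : ConeDomain Ω c ρ) (k : ℕ) (u : E n → V) (x : E n) : V :=
  ∫ y, hΩ.kern k (y - x) • u y

theorem moll_eq_integral_add (k : ℕ) (u : E n → V) (x : E n) :
    hΩ.moll k u x = ∫ z, hΩ.kern k z • u (x + z) := by
  rw [moll, ← integral_add_left_eq_self _ x]
  simp

theorem moll_eq_integral_kernMeasure (k : ℕ) (u : E n → V) (x : E n) :
    hΩ.moll k u x = ∫ z, u (x + z) ∂hΩ.kernMeasure k := by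
  rw [moll_eq_integral_add, kernMeasure]
  have hm : Measurable (hΩ.kern k) := (hΩ.contDiff_kern k).continuous.measurable
  have := integral_withDensity_eq_integral_toReal_smul (μ := (volume : Measure (E n)))
    (f := fun z => ENNReal.ofReal (hΩ.kern k z)) hm.ennreal_ofReal
    (ae_of_all _ fun z => ENNReal.ofReal_lt_top) (fun z => u (x + z))
  rw [this]
  simp [ENNReal.toReal_ofReal (hΩ.kern_nonneg k _)]

theorem enorm_moll_le (k : ℕ) (u : E n → V) (x : E n) :
    ‖hΩ.moll k u x‖ₑ ≤ ∫⁻ z, ‖u (x + z)‖ₑ ∂hΩ.kernMeasure k := by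
  rw [moll_eq_integral_kernMeasure]
  exact enorm_integral_le_lintegral_enorm _

theorem integrable_kernMeasure {u : E n → V} (hu : LocallyIntegrable u) (k : ℕ) (x : E n) :
    Integrable (fun z => u (x + z)) (hΩ.kernMeasure k) := by
  have hm : Measurable (hΩ.kern k) := (hΩ.contDiff_kern k).continuous.measurable
  rw [kernMeasure, integrable_withDensity_iff_integrable_smul' hm.ennreal_ofReal
    (ae_of_all _ fun z => ENNReal.ofReal_lt_top)]
  have h1 : LocallyIntegrable (fun z => u (x + z)) := by
    have := (measurePreserving_add_left (volume : Measure (E n)) x)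
    intro z
    obtain ⟨s, hs, hs'⟩ := hu (x + z)
    refine ⟨(fun z => x + z) ⁻¹' s, (continuous_const_add x).continuousAt.preimage_mem_nhds hs, ?_⟩
    exact (this.integrableOn_comp_preimage (Homeomorph.addLeft x).measurableEmbedding).2 hs'
  have := h1.integrable_smul_left_of_hasCompactSupport (hΩ.contDiff_kern k).continuous
    (hΩ.hasCompactSupport_kern k)
  simpa [ENNReal.toReal_ofReal (hΩ.kern_nonneg k _)] using this

theorem moll_sub {u v : E n → V} (hu : LocallyIntegrable u) (hv : LocallyIntegrable v)
    (k : ℕ) (x : E n) : hΩ.moll k (u - v) x = hΩ.moll k u x - hΩ.moll k v x := by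
  simp only [moll_eq_integral_kernMeasure, Pi.sub_apply]
  exact integral_sub (hΩ.integrable_kernMeasure hu k x) (hΩ.integrable_kernMeasure hv k x)

theorem enorm_moll_sq_le {u : E n → V} (hu : StronglyMeasurable u) (k : ℕ) (x : E n) :
    ‖hΩ.moll k u x‖ₑ ^ 2 ≤ ∫⁻ z, ‖u (x + z)‖ₑ ^ 2 ∂hΩ.kernMeasure k := by
  calc _ ≤ (∫⁻ z, ‖u (x + z)‖ₑ ∂hΩ.kernMeasure k) ^ 2 := by
        gcongr; exact hΩ.enorm_moll_le k u x
    _ ≤ _ := by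
      refine (sq_lintegral_le _ ?_).trans (by simp)
      exact (hu.comp_measurable (measurable_const_add x)).enorm.aemeasurable

theorem lintegral_add_le (f : E n → ℝ≥0∞) {z : E n} (hz : ∀ x ∈ Ω, x + z ∈ Ω) :
    ∫⁻ x in Ω, f (x + z) ≤ ∫⁻ x in Ω, f x := by
  have h := (measurePreserving_add_right (volume : Measure (E n)) z).setLIntegral_comp_emb
    (Homeomorph.addRight z).measurableEmbedding f Ω
  rw [h]
  refine lintegral_mono_set ?_
  rintro _ ⟨x, hx, rfl⟩
  exact hz x hx

/-- Jensen's inequality for the probability measure `kernMeasure`, then Tonelli. Each translation by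
a `z` in the support maps `Ω` into itself, so no value of `u` outside `Ω` is seen. -/
theorem l2Sq_moll_le {u : E n → V} (hu : StronglyMeasurable u) (k : ℕ) :
    l2Sq Ω (hΩ.moll k u) ≤ l2Sq Ω u := by
  have hm : Measurable fun p : E n × E n => ‖u (p.1 + p.2)‖ₑ ^ 2 :=
    ((hu.comp_measurable (measurable_fst.add measurable_snd)).enorm).pow_const 2
  calc l2Sq Ω (hΩ.moll k u)
      ≤ ∫⁻ x in Ω, ∫⁻ z, ‖u (x + z)‖ₑ ^ 2 ∂hΩ.kernMeasure k :=
        lintegral_mono fun x => hΩ.enorm_moll_sq_le hu k x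
    _ = ∫⁻ z, (∫⁻ x in Ω, ‖u (x + z)‖ₑ ^ 2) ∂hΩ.kernMeasure k :=
        lintegral_lintegral_swap hm.aemeasurable
    _ ≤ ∫⁻ _, l2Sq Ω u ∂hΩ.kernMeasure k := by
        refine lintegral_mono_ae ?_
        filter_upwards [hΩ.ae_kernMeasure_mem k] with z hz
        exact lintegral_add_le (fun x => ‖u x‖ₑ ^ 2)
          fun x hx => hΩ.add_mem_of_mem_tsupport hx hz
    _ = l2Sq Ω u := by simp

/-- Both points are translated by the same `z`, which leaves `‖x - y‖` unchanged, so the argument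
for `L²` carries over to the double integral. -/
theorem slobodetskiiSq_moll_le {u : E n → V} (hu : StronglyMeasurable u)
    (hu' : LocallyIntegrable u) (θ : ℝ) (k : ℕ) :
    slobodetskiiSq n θ Ω (hΩ.moll k u) ≤ slobodetskiiSq n θ Ω u := by
  have hm : Measurable fun p : E n × (E n × E n) =>
      ‖u (p.1 + p.2.2) - u (p.2.1 + p.2.2)‖ₑ ^ 2 /
        ENNReal.ofReal (‖p.1 - p.2.1‖ ^ ((n : ℝ) + 2 * θ)) := by
    refine Measurable.div (Measurable.pow_const ?_ 2) (by fun_prop)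
    exact ((hu.comp_measurable (by fun_prop)).sub (hu.comp_measurable (by fun_prop))).enorm
  have key : ∀ x y, ‖hΩ.moll k u x - hΩ.moll k u y‖ₑ ^ 2 ≤
      ∫⁻ z, ‖u (x + z) - u (y + z)‖ₑ ^ 2 ∂hΩ.kernMeasure k := by
    intro x y
    rw [moll_eq_integral_kernMeasure, moll_eq_integral_kernMeasure,
      ← integral_sub (hΩ.integrable_kernMeasure hu' k x) (hΩ.integrable_kernMeasure hu' k y)]
    calc _ ≤ (∫⁻ z, ‖u (x + z) - u (y + z)‖ₑ ∂hΩ.kernMeasure k) ^ 2 := by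
          gcongr; exact enorm_integral_le_lintegral_enorm _
      _ ≤ _ := by
        refine (sq_lintegral_le _ ?_).trans (by simp)
        exact ((hu.comp_measurable (by fun_prop)).sub
          (hu.comp_measurable (by fun_prop))).enorm.aemeasurable
  set K : E n → E n → E n → ℝ≥0∞ := fun x y z => ‖u (x + z) - u (y + z)‖ₑ ^ 2 /
        ENNReal.ofReal (‖x - y‖ ^ ((n : ℝ) + 2 * θ)) with hK
  calc slobodetskiiSq n θ Ω (hΩ.moll k u)
      ≤ ∫⁻ x in Ω, ∫⁻ y in Ω, ∫⁻ z, K x y z ∂hΩ.kernMeasure k := by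
        refine lintegral_mono fun x => lintegral_mono fun y => ?_
        simp only [hK, div_eq_mul_inv]
        rw [lintegral_mul_const]
        · gcongr; exact key x y
        · exact ((hu.comp_measurable (by fun_prop)).sub
            (hu.comp_measurable (by fun_prop))).enorm.pow_const 2
    _ = ∫⁻ x in Ω, ∫⁻ z, (∫⁻ y in Ω, K x y z) ∂hΩ.kernMeasure k := by
        refine lintegral_congr fun x => ?_
        exact lintegral_lintegral_swap
          (hm.comp (g := fun p : E n × (E n × E n) => _) (f := fun q : E n × E n => (x, q))
            (by fun_prop)).aemeasurable
    _ = ∫⁻ z, (∫⁻ x in Ω, ∫⁻ y in Ω, K x y z) ∂hΩ.kernMeasure k := by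
        refine lintegral_lintegral_swap (Measurable.aemeasurable ?_)
        refine Measurable.lintegral_prod_right' (f := fun q : (E n × E n) × E n =>
          K q.1.1 q.2 q.1.2) ?_
        exact hm.comp (g := fun p : E n × (E n × E n) => _)
          (f := fun q : (E n × E n) × E n => (q.1.1, (q.2, q.1.2))) (by fun_prop)
    _ ≤ ∫⁻ _, slobodetskiiSq n θ Ω u ∂hΩ.kernMeasure k := by
        refine lintegral_mono_ae ?_
        filter_upwards [hΩ.ae_kernMeasure_mem k] with z hz
        have hz' : ∀ x ∈ Ω, x + z ∈ Ω := fun x hx => hΩ.add_mem_of_mem_tsupport hx hz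
        set J : E n → E n → ℝ≥0∞ := fun x y => ‖u x - u y‖ₑ ^ 2 /
          ENNReal.ofReal (‖x - y‖ ^ ((n : ℝ) + 2 * θ))
        have e : ∀ x y, K x y z = J (x + z) (y + z) := by intro x y; simp [hK, J]
        simp only [e]
        calc _ ≤ ∫⁻ x in Ω, ∫⁻ y in Ω, J (x + z) y :=
              lintegral_mono fun x => lintegral_add_le (J (x + z)) hz'
          _ ≤ _ := lintegral_add_le (fun x => ∫⁻ y in Ω, J x y) hz'
    _ = slobodetskiiSq n θ Ω u := by simp

theorem enorm_moll_le_of_ae {u : E n → V} {b : ℝ≥0∞}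
    (hb : ∀ᵐ x ∂volume.restrict Ω, ‖u x‖ₑ ≤ b) (k : ℕ) {x : E n} (hx : x ∈ Ω) :
    ‖hΩ.moll k u x‖ₑ ≤ b := by
  refine (hΩ.enorm_moll_le k u x).trans ?_
  have h : ∀ᵐ z ∂hΩ.kernMeasure k, ‖u (x + z)‖ₑ ≤ b := by
    have h1 : ∀ᵐ z ∂(volume : Measure (E n)), x + z ∈ Ω → ‖u (x + z)‖ₑ ≤ b :=
      (measurePreserving_add_left volume x).quasiMeasurePreserving.ae
        ((ae_restrict_iff' hΩ.measurableSet).1 hb)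
    have h2 : ∀ᵐ z ∂hΩ.kernMeasure k, x + z ∈ Ω → ‖u (x + z)‖ₑ ≤ b :=
      (withDensity_absolutelyContinuous _ _).ae_le h1
    filter_upwards [h2, hΩ.ae_kernMeasure_mem k] with z hz hz'
    exact hz (hΩ.add_mem_of_mem_tsupport hx hz')
  calc _ ≤ ∫⁻ _, b ∂hΩ.kernMeasure k := lintegral_mono_ae h
    _ = b := by simp

theorem moll_eq_convolution (k : ℕ) (u : E n → V) : hΩ.moll k u =
    MeasureTheory.convolution (fun z => hΩ.kern k (-z)) u (ContinuousLinearMap.lsmul ℝ ℝ)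
      volume := by
  ext x
  rw [convolution_eq_swap, moll]
  simp

theorem contDiff_kern_neg (k : ℕ) : ContDiff ℝ ∞ fun z => hΩ.kern k (-z) :=
  (hΩ.contDiff_kern k).comp contDiff_neg

theorem hasCompactSupport_kern_neg (k : ℕ) : HasCompactSupport fun z => hΩ.kern k (-z) :=
  (hΩ.hasCompactSupport_kern k).comp_homeomorph (Homeomorph.neg _)

theorem contDiff_moll {u : E n → V} (hu : LocallyIntegrable u) (k : ℕ) :
    ContDiff ℝ ∞ (hΩ.moll k u) := by
  rw [moll_eq_convolution]
  exact (hΩ.hasCompactSupport_kern_neg k).contDiff_convolution_left _ (hΩ.contDiff_kern_neg k) hu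

theorem integrable_fderiv_kern_smul {u : E n → V} (hu : LocallyIntegrable u) (k : ℕ) (x e : E n) :
    Integrable fun y => fderiv ℝ (hΩ.kern k) (y - x) e • u y := by
  refine hu.integrable_smul_left_of_hasCompactSupport ?_ ?_
  · have h1 : Continuous (fderiv ℝ (hΩ.kern k)) :=
      (hΩ.contDiff_kern k).continuous_fderiv (by norm_num)
    fun_prop
  · have := ((hΩ.hasCompactSupport_kern k).fderiv_apply (𝕜 := ℝ) e).comp_homeomorph
      (Homeomorph.subRight x)
    exact this

/-- Differentiating `kern k (y - x)` in `x` produces a minus sign, the one that cancels the sign in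
the integration by parts defining weak derivatives. -/
theorem fderiv_moll [CompleteSpace V] {u : E n → V} (hu : LocallyIntegrable u) (k : ℕ) (x e : E n) :
    fderiv ℝ (hΩ.moll k u) x e = -∫ y, fderiv ℝ (hΩ.kern k) (y - x) e • u y := by
  have h := (hΩ.hasCompactSupport_kern_neg k).hasFDerivAt_convolution_left (μ := volume)
    (ContinuousLinearMap.lsmul ℝ ℝ) ((hΩ.contDiff_kern_neg k).of_le (by norm_num)) hu x
  rw [moll_eq_convolution, h.fderiv, convolution_eq_swap, ← integral_neg]
  have hd : ∀ z, fderiv ℝ (fun z => hΩ.kern k (-z)) z = -fderiv ℝ (hΩ.kern k) (-z) := by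
    intro z
    have h1 : HasFDerivAt (fun z => hΩ.kern k (-z)) (-fderiv ℝ (hΩ.kern k) (-z)) z := by
      have h2 := ((hΩ.contDiff_kern k).differentiable (by norm_num) (-z)).hasFDerivAt.comp z
        (hasFDerivAt_id z).neg
      have h3 : fderiv ℝ (hΩ.kern k) (-z) ∘SL (-ContinuousLinearMap.id ℝ (E n)) =
          -fderiv ℝ (hΩ.kern k) (-z) := by ext; simp
      rw [h3] at h2
      exact h2
    exact h1.fderiv
  refine (ContinuousLinearMap.integral_comp_comm
    (ContinuousLinearMap.apply ℝ V e) ?_).symm.trans ?_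
  rotate_left
  · refine integral_congr_ae (ae_of_all _ fun y => ?_)
    simp [ContinuousLinearMap.precompL_apply, hd]
  · have h2 : Continuous (fderiv ℝ (fun z => hΩ.kern k (-z))) :=
      (hΩ.contDiff_kern_neg k).continuous_fderiv (by norm_num)
    have h3 := ((hΩ.hasCompactSupport_kern_neg k).fderiv (𝕜 := ℝ)).convolutionExists_left
      ((ContinuousLinearMap.lsmul ℝ ℝ : ℝ →L[ℝ] V →L[ℝ] V).precompL (E n)) h2 hu x
    exact h3.integrable_swap

/-- The weak derivative of `u` in the direction `e` is `v`, tested against the translates of the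
mollifiers only. -/
def IsMollDeriv (hΩ : ConeDomain Ω c ρ) (e : E n) (u v : E n → V) : Prop :=
  ∀ k, ∀ x ∈ Ω, ∫ y, fderiv ℝ (hΩ.kern k) (y - x) e • u y = -∫ y, hΩ.kern k (y - x) • v y

theorem IsMollDeriv.fderiv_moll [CompleteSpace V] {e : E n} {u v : E n → V} (h : hΩ.IsMollDeriv e u v)
    (hu : LocallyIntegrable u) (k : ℕ) {x : E n} (hx : x ∈ Ω) :
    fderiv ℝ (hΩ.moll k u) x e = hΩ.moll k v x := by
  rw [hΩ.fderiv_moll hu, h k x hx, neg_neg, moll]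

theorem IsMollDeriv.sub {e : E n} {u v u' v' : E n → V} (h : hΩ.IsMollDeriv e u v)
    (h' : hΩ.IsMollDeriv e u' v') (hu : LocallyIntegrable u) (hu' : LocallyIntegrable u')
    (hv : LocallyIntegrable v) (hv' : LocallyIntegrable v') :
    hΩ.IsMollDeriv e (u - u') (v - v') := by
  intro k x hx
  have h1 := hΩ.moll_sub hv hv' k x
  simp only [moll] at h1
  rw [h1]
  simp only [Pi.sub_apply, smul_sub]
  rw [integral_sub (hΩ.integrable_fderiv_kern_smul hu k x e)
    (hΩ.integrable_fderiv_kern_smul hu' k x e), h k x hx, h' k x hx]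
  abel

/-- Lebesgue differentiation along balls centred at `x + εc` instead of `x`. This is admissible
because `x` stays within a fixed multiple `K` of the radius `ερ/2` from the centre. -/
theorem ae_tendsto_moll [CompleteSpace V] {u : E n → V} (hu : LocallyIntegrable u) :
    ∀ᵐ x, Tendsto (fun k => hΩ.moll k u x) atTop (𝓝 (u x)) := by
  have hρ := hΩ.pos
  set K : ℝ := 2 * (‖c‖ + 1) / ρ with hK
  filter_upwards [IsUnifLocDoublingMeasure.ae_tendsto_average_norm_sub volume hu K] with x hx
  have hε : Tendsto (fun k : ℕ => 1 / ((k : ℝ) + 1)) atTop (𝓝 0) :=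
    tendsto_one_div_add_atTop_nhds_zero_nat
  set w : ℕ → E n := fun k => x + (1 / ((k : ℝ) + 1)) • c with hw
  set δ : ℕ → ℝ := fun k => 1 / ((k : ℝ) + 1) * (ρ / 2) with hδ
  have hδ0 : ∀ k, 0 < δ k := fun k => by positivity
  have h1 : Tendsto δ atTop (𝓝[>] 0) := by
    refine tendsto_nhdsWithin_iff.2 ⟨?_, Eventually.of_forall hδ0⟩
    simpa only [zero_mul] using hε.mul_const (ρ / 2)
  have h2 := hx w δ h1 (Eventually.of_forall fun k => by
    rw [Metric.mem_closedBall, dist_eq_norm, hw]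
    simp only [sub_add_cancel_left, norm_neg, norm_smul]
    rw [Real.norm_of_nonneg (by positivity), hK, hδ]
    have : 2 * (‖c‖ + 1) / ρ * (1 / ((k : ℝ) + 1) * (ρ / 2)) =
      1 / ((k : ℝ) + 1) * (‖c‖ + 1) := by field_simp
    simp only [this]
    gcongr
    linarith)
  rw [tendsto_iff_norm_sub_tendsto_zero]
  -- The outer radius of the bump is `3/2` times the inner one, so the normalised bump is at most
  -- `(3/2)^n` over the volume of its support.
  set A : ℝ := (3 / 2 : ℝ) ^ Module.finrank ℝ (E n) with hA
  refine squeeze_zero (fun _ => norm_nonneg _) (g := fun k => A *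
    ⨍ y in Metric.closedBall (w k) (δ k), ‖u y - u x‖) (fun k => ?_) (by simpa using h2.const_mul A)
  have hint : Integrable (fun y => hΩ.kern k (y - x) • u y) :=
    hu.integrable_smul_left_of_hasCompactSupport
      ((hΩ.contDiff_kern k).continuous.comp (continuous_sub_right x))
      ((hΩ.hasCompactSupport_kern k).comp_homeomorph (Homeomorph.subRight x))
  have hone : ∫ y, hΩ.kern k (y - x) = 1 := by
    rw [integral_sub_right_eq_self (hΩ.kern k) x, integral_kern]
  have hik : Integrable (fun y => hΩ.kern k (y - x)) := (hΩ.integrable_kern k).comp_sub_right x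
  have e1 : hΩ.moll k u x - u x = ∫ y, hΩ.kern k (y - x) • (u y - u x) := by
    simp only [smul_sub]
    rw [integral_sub hint (hik.smul_const _), integral_smul_const, hone, one_smul, moll]
  have hsupp : ∀ y, y ∉ Metric.closedBall (w k) (δ k) → hΩ.kern k (y - x) = 0 := by
    intro y hy
    refine image_eq_zero_of_notMem_tsupport fun h => hy ?_
    rw [tsupport_kern, Metric.mem_closedBall, dist_eq_norm] at h
    rw [Metric.mem_closedBall, dist_eq_norm, hw]
    simpa only [sub_add_eq_sub_sub] using h
  have e2 : ∫ y, hΩ.kern k (y - x) • (u y - u x) =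
      ∫ y in Metric.closedBall (w k) (δ k), hΩ.kern k (y - x) • (u y - u x) := by
    rw [setIntegral_eq_integral_of_forall_compl_eq_zero]
    intro y hy
    rw [hsupp y hy, zero_smul]
  have hvol : (volume : Measure (E n)).real (Metric.closedBall ((1 / ((k : ℝ) + 1)) • c) (δ k)) =
      (volume : Measure (E n)).real (Metric.closedBall (w k) (δ k)) := by
    simp only [measureReal_def]
    rw [Measure.addHaar_closedBall_center, ← Measure.addHaar_closedBall_center _ (w k)]
  have hbound : ∀ z, hΩ.kern k z ≤
      A / (volume : Measure (E n)).real (Metric.closedBall (w k) (δ k)) := by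
    intro z
    rw [← hvol]
    exact (hΩ.bump k).normed_le_div_measure_closedBall_rOut volume (3 / 2) (by
      simp only [bump]; apply le_of_eq; field_simp) z
  have hio : IntegrableOn (fun y => ‖u y - u x‖) (Metric.closedBall (w k) (δ k)) := by
    refine Integrable.norm (Integrable.sub ?_ ?_)
    · exact hu.integrableOn_isCompact (isCompact_closedBall _ _)
    · exact integrableOn_const (measure_closedBall_lt_top).ne
  rw [e1, e2, setAverage_eq, smul_eq_mul, ← mul_assoc, ← div_eq_mul_inv]
  refine (norm_integral_le_integral_norm _).trans ?_
  rw [← integral_const_mul]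
  refine integral_mono_of_nonneg (ae_of_all _ fun _ => norm_nonneg _) (hio.const_mul _)
    (ae_of_all _ fun y => ?_)
  simp only [norm_smul, Real.norm_of_nonneg (hΩ.kern_nonneg k _)]
  gcongr
  exact hbound _

/-- Uniqueness of weak derivatives, from the translates of the mollifiers. -/
theorem IsMollDeriv.unique [CompleteSpace V] {e : E n} {u v v' : E n → V}
    (h : hΩ.IsMollDeriv e u v)
    (h' : hΩ.IsMollDeriv e u v') (hv : LocallyIntegrable v) (hv' : LocallyIntegrable v') :
    v =ᵐ[volume.restrict Ω] v' := by
  rw [EventuallyEq, ae_restrict_iff' hΩ.measurableSet]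
  filter_upwards [hΩ.ae_tendsto_moll hv, hΩ.ae_tendsto_moll hv'] with x h1 h2 hx
  refine tendsto_nhds_unique (h1.congr fun k => ?_) h2
  have := (h k x hx).symm.trans (h' k x hx)
  exact neg_injective this

end ConeDomain

/-! ### Averages over shrinking pieces of the cone -/

theorem le_rpow_half_of_sq_le {a b : ℝ≥0∞} (h : a ^ 2 ≤ b) : a ≤ b ^ (1 / 2 : ℝ) := by
  calc a = (a ^ 2) ^ (1 / 2 : ℝ) := by
        rw [← ENNReal.rpow_natCast, ← ENNReal.rpow_mul]; norm_num
    _ ≤ _ := by gcongr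

theorem rpow_half_sq (a : ℝ≥0∞) : (a ^ (1 / 2 : ℝ)) ^ 2 = a := by
  rw [← ENNReal.rpow_natCast, ← ENNReal.rpow_mul]; norm_num

theorem lintegral_Ioc_rpow_neg {γ δ : ℝ} (hγ : γ < 1) (hδ : 0 < δ) :
    ∫⁻ σ in Set.Ioc 0 δ, ENNReal.ofReal (σ ^ (-γ)) = ENNReal.ofReal (δ ^ (1 - γ) / (1 - γ)) := by
  have hi : IntervalIntegrable (fun σ : ℝ => σ ^ (-γ)) volume 0 δ :=
    intervalIntegral.intervalIntegrable_rpow' (by linarith)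
  rw [← ofReal_integral_eq_lintegral_ofReal
    ((intervalIntegrable_iff_integrableOn_Ioc_of_le hδ.le).1 hi)]
  · rw [← intervalIntegral.integral_of_le hδ.le, integral_rpow (Or.inl (by linarith))]
    congr 1
    rw [show -γ + 1 = 1 - γ by ring, Real.zero_rpow (by linarith), sub_zero]
  · filter_upwards [ae_restrict_mem measurableSet_Ioc] with σ hσ
    exact Real.rpow_nonneg hσ.1.le _

theorem measurable_slobodetskii_integrand {n : ℕ} {V α : Type*} [NormedAddCommGroup V]
    [MeasurableSpace α] {g : E n → V} (hg : StronglyMeasurable g) (θ : ℝ) {p q : α → E n}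
    (hp : Measurable p) (hq : Measurable q) :
    Measurable fun a =>
      ‖g (p a) - g (q a)‖ₑ ^ 2 / ENNReal.ofReal (‖p a - q a‖ ^ ((n : ℝ) + 2 * θ)) :=
  Measurable.div (Measurable.pow_const
    ((hg.comp_measurable hp).sub (hg.comp_measurable hq)).enorm 2) (by fun_prop)

namespace ConeDomain

variable {n : ℕ} {Ω : Set (E n)} {c : E n} {ρ : ℝ} (hΩ : ConeDomain Ω c ρ)
  {V : Type*} [NormedAddCommGroup V] [NormedSpace ℝ V]

include hΩ

/-- The substitution `y = x + σz` costs the Jacobian `σ⁻ⁿ`, and the cone property keeps `y` in `Ω`.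
-/
theorem lintegral_ball_comp_smul_le {f : E n → ℝ≥0∞} (hf : Measurable f) {x : E n} (hx : x ∈ Ω)
    {σ : ℝ} (hσ : 0 < σ) :
    ∫⁻ z in Metric.ball c ρ, f (x + σ • z) ≤ ENNReal.ofReal ((σ ^ n)⁻¹) * ∫⁻ y in Ω, f y := by
  set F : E n → ℝ≥0∞ := Ω.indicator f with hF
  have hFm : Measurable F := hf.indicator hΩ.measurableSet
  calc ∫⁻ z in Metric.ball c ρ, f (x + σ • z)
      ≤ ∫⁻ z in Metric.ball c ρ, F (x + σ • z) := by
        refine lintegral_mono_ae ?_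
        filter_upwards [ae_restrict_mem measurableSet_ball] with z hz
        rw [hF, Set.indicator_of_mem (hΩ.add_mem x hx σ hσ.le z hz)]
    _ ≤ ∫⁻ z, F (x + σ • z) := setLIntegral_le_lintegral _ _
    _ = ∫⁻ p, F (x + p) ∂Measure.map (σ • ·) volume := by
        exact (lintegral_map (f := fun p => F (x + p)) (hFm.comp (measurable_const_add x))
          (measurable_const_smul σ)).symm
    _ = ENNReal.ofReal ((σ ^ n)⁻¹) * ∫⁻ p, F (x + p) := by
        rw [Measure.map_addHaar_smul _ hσ.ne', lintegral_smul_measure, smul_eq_mul,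
          finrank_euclideanSpace_fin, abs_of_pos (by positivity)]
    _ = ENNReal.ofReal ((σ ^ n)⁻¹) * ∫⁻ y in Ω, f y := by
        rw [lintegral_add_left_eq_self F x, hF, lintegral_indicator hΩ.measurableSet]

theorem volume_ball_pos : 0 < volume (Metric.ball c ρ) := Metric.measure_ball_pos _ _ hΩ.pos

omit hΩ in
theorem norm_lt_of_mem_ball {z : E n} (hz : z ∈ Metric.ball c ρ) : ‖z‖ < ‖c‖ + ρ := by
  rw [Metric.mem_ball, dist_eq_norm] at hz
  calc ‖z‖ = ‖c + (z - c)‖ := by congr 1; abel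
    _ ≤ ‖c‖ + ‖z - c‖ := norm_add_le _ _
    _ < _ := by linarith

omit [NormedSpace ℝ V] in
-- Averages at scales `σ` and `2σ` are compared by integrating `|g(x + σz) - g(x + 2σz')|` over both
-- `z` and `z'`. After Cauchy–Schwarz, the distance of the two points, at most `3(‖c‖ + ρ)σ`,
-- contributes `σ^{n+2θ}`, and the two Jacobians contribute `σ^{-2n}`. The square root of the
-- product is `σ^{-(n/2-θ)}`.
theorem lintegral_ball_step {θ : ℝ} (hθ : 0 < θ) {g : E n → V} (hg : StronglyMeasurable g)
    {x : E n} (hx : x ∈ Ω) {σ : ℝ} (hσ : 0 < σ) :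
    ∫⁻ z in Metric.ball c ρ, ‖g (x + σ • z)‖ₑ ≤
      (∫⁻ z in Metric.ball c ρ, ‖g (x + (2 * σ) • z)‖ₑ) +
        ENNReal.ofReal ((3 * (‖c‖ + ρ)) ^ ((n : ℝ) / 2 + θ) * σ ^ (-((n : ℝ) / 2 - θ))) *
          slobodetskiiSq n θ Ω g ^ (1 / 2 : ℝ) := by
  have hρ := hΩ.pos
  set B := Metric.ball c ρ with hB
  set β := volume B with hβ
  set A := slobodetskiiSq n θ Ω g with hA
  have hβ0 : β ≠ 0 := hΩ.volume_ball_pos.ne'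
  have hβt : β ≠ ⊤ := measure_ball_lt_top.ne
  have hR : 0 < ‖c‖ + ρ := by positivity
  have hm : Measurable fun p : E n × E n => ‖g (x + σ • p.1) - g (x + (2 * σ) • p.2)‖ₑ :=
    ((hg.comp_measurable (by fun_prop)).sub (hg.comp_measurable (by fun_prop))).enorm
  have hm2 : ∀ s : ℝ, Measurable fun z => ‖g (x + s • z)‖ₑ := fun s =>
    (hg.comp_measurable (by fun_prop)).enorm
  set J := ∫⁻ z in B, ∫⁻ z' in B, ‖g (x + σ • z) - g (x + (2 * σ) • z')‖ₑ with hJ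
  have h1 : β * ∫⁻ z in B, ‖g (x + σ • z)‖ₑ ≤ β * (∫⁻ z in B, ‖g (x + (2 * σ) • z)‖ₑ) + J := by
    calc β * ∫⁻ z in B, ‖g (x + σ • z)‖ₑ = ∫⁻ z in B, ∫⁻ _ in B, ‖g (x + σ • z)‖ₑ := by
          simp only [lintegral_const, Measure.restrict_apply_univ]
          rw [lintegral_mul_const _ (hm2 σ), mul_comm]
      _ ≤ ∫⁻ z in B, ∫⁻ z' in B, (‖g (x + (2 * σ) • z')‖ₑ +
            ‖g (x + σ • z) - g (x + (2 * σ) • z')‖ₑ) := by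
          refine lintegral_mono fun z => lintegral_mono fun z' => ?_
          calc ‖g (x + σ • z)‖ₑ = ‖g (x + (2 * σ) • z') +
                (g (x + σ • z) - g (x + (2 * σ) • z'))‖ₑ := by congr 1; abel
            _ ≤ _ := enorm_add_le _ _
      _ = _ := by
          simp_rw [lintegral_add_left (hm2 (2 * σ))]
          rw [lintegral_add_left measurable_const, lintegral_const, Measure.restrict_apply_univ,
            mul_comm]
  have h2 : J ^ 2 ≤ β ^ 2 * (ENNReal.ofReal ((3 * (‖c‖ + ρ)) ^ ((n : ℝ) / 2 + θ) *
      σ ^ (-((n : ℝ) / 2 - θ))) ^ 2 * A) := by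
    set G : E n → E n → ℝ≥0∞ := fun p q =>
      ‖g p - g q‖ₑ ^ 2 / ENNReal.ofReal (‖p - q‖ ^ ((n : ℝ) + 2 * θ)) with hG
    have hGc : ∀ {α : Type} [MeasurableSpace α] {p q : α → E n}, Measurable p → Measurable q →
        Measurable fun z => G (p z) (q z) := fun hp hq =>
      measurable_slobodetskii_integrand hg θ hp hq
    have hGe : ∀ p q, ‖g p - g q‖ₑ ^ 2 / ENNReal.ofReal (‖p - q‖ ^ ((n : ℝ) + 2 * θ)) = G p q :=
      fun _ _ => rfl
    have hAG : ∫⁻ p in Ω, ∫⁻ q in Ω, G p q = A := rfl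
    clear_value G
    have hs1 : J ^ 2 ≤ β ^ 2 *
        ∫⁻ z in B, ∫⁻ z' in B, ‖g (x + σ • z) - g (x + (2 * σ) • z')‖ₑ ^ 2 := by
      calc J ^ 2 ≤ β * ∫⁻ z in B, (∫⁻ z' in B, ‖g (x + σ • z) - g (x + (2 * σ) • z')‖ₑ) ^ 2 := by
            refine (sq_lintegral_le _ ?_).trans (by rw [Measure.restrict_apply_univ])
            exact hm.lintegral_prod_right'.aemeasurable
        _ ≤ β * ∫⁻ z in B, β * ∫⁻ z' in B, ‖g (x + σ • z) - g (x + (2 * σ) • z')‖ₑ ^ 2 := by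
            gcongr with z
            refine (sq_lintegral_le _ ?_).trans (by rw [Measure.restrict_apply_univ])
            exact (hm.comp (measurable_const.prodMk measurable_id)).aemeasurable
        _ = _ := by
            rw [lintegral_const_mul _ (hm.pow_const 2).lintegral_prod_right']
            ring
    refine hs1.trans ?_
    gcongr
    have hs2 : ∀ z ∈ B, ∀ z' ∈ B, ‖g (x + σ • z) - g (x + (2 * σ) • z')‖ₑ ^ 2 ≤
        ENNReal.ofReal ((3 * (‖c‖ + ρ) * σ) ^ ((n : ℝ) + 2 * θ)) *
          G (x + σ • z) (x + (2 * σ) • z') := by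
      intro z hz z' hz'
      set p := x + σ • z
      set q := x + (2 * σ) • z'
      rcases eq_or_ne p q with h | h
      · simp [h]
      have hpq : 0 < ‖p - q‖ := norm_pos_iff.2 (sub_ne_zero.2 h)
      have hle : ‖p - q‖ ≤ 3 * (‖c‖ + ρ) * σ := by
        have e : p - q = σ • z - (2 * σ) • z' := by simp only [p, q]; abel
        rw [e]
        refine (norm_sub_le _ _).trans ?_
        rw [norm_smul, norm_smul, Real.norm_of_nonneg hσ.le, Real.norm_of_nonneg (by positivity)]
        nlinarith [norm_lt_of_mem_ball hz, norm_lt_of_mem_ball hz']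
      have hpos : 0 < ‖p - q‖ ^ ((n : ℝ) + 2 * θ) := Real.rpow_pos_of_pos hpq _
      calc ‖g p - g q‖ₑ ^ 2 = ENNReal.ofReal (‖p - q‖ ^ ((n : ℝ) + 2 * θ)) * G p q := by
            rw [← hGe, ENNReal.mul_div_cancel (by simpa using hpos) ENNReal.ofReal_ne_top]
        _ ≤ _ := by gcongr
    calc ∫⁻ z in B, ∫⁻ z' in B, ‖g (x + σ • z) - g (x + (2 * σ) • z')‖ₑ ^ 2
        ≤ ∫⁻ z in B, ∫⁻ z' in B, ENNReal.ofReal ((3 * (‖c‖ + ρ) * σ) ^ ((n : ℝ) + 2 * θ)) *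
          G (x + σ • z) (x + (2 * σ) • z') := by
          refine lintegral_mono_ae ?_
          filter_upwards [ae_restrict_mem measurableSet_ball] with z hz
          refine lintegral_mono_ae ?_
          filter_upwards [ae_restrict_mem measurableSet_ball] with z' hz'
          exact hs2 z hz z' hz'
      _ ≤ ∫⁻ z in B, ENNReal.ofReal ((3 * (‖c‖ + ρ) * σ) ^ ((n : ℝ) + 2 * θ)) *
          (ENNReal.ofReal (((2 * σ) ^ n)⁻¹) * ∫⁻ q in Ω, G (x + σ • z) q) := by
          refine lintegral_mono fun z => ?_
          dsimp only
          have hGz : Measurable fun z' => G (x + σ • z) (x + (2 * σ) • z') :=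
            hGc measurable_const (by fun_prop)
          rw [lintegral_const_mul _ hGz]
          gcongr
          exact hΩ.lintegral_ball_comp_smul_le (f := G (x + σ • z))
            (hGc measurable_const measurable_id) hx (by positivity)
      _ ≤ ENNReal.ofReal ((3 * (‖c‖ + ρ) * σ) ^ ((n : ℝ) + 2 * θ)) *
          (ENNReal.ofReal (((2 * σ) ^ n)⁻¹) * (ENNReal.ofReal ((σ ^ n)⁻¹) * A)) := by
          have hGm' : Measurable fun p => ∫⁻ q in Ω, G p q :=
            (hGc measurable_fst measurable_snd).lintegral_prod_right'
          have hGm'' : Measurable fun z => ∫⁻ q in Ω, G (x + σ • z) q :=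
            hGm'.comp (by fun_prop)
          rw [lintegral_const_mul _ (hGm''.const_mul _), lintegral_const_mul _ hGm'']
          gcongr
          rw [← hAG]
          exact hΩ.lintegral_ball_comp_smul_le hGm' hx hσ
      _ ≤ _ := by
          rw [← mul_assoc, ← mul_assoc, ← ENNReal.ofReal_mul (by positivity),
            ← ENNReal.ofReal_mul (by positivity), ← ENNReal.ofReal_pow (by positivity)]
          gcongr
          have e1 : (3 * (‖c‖ + ρ) * σ) ^ ((n : ℝ) + 2 * θ) =
              ((3 * (‖c‖ + ρ)) ^ ((n : ℝ) / 2 + θ)) ^ 2 * (σ ^ ((n : ℝ) / 2 + θ)) ^ 2 := by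
            rw [← mul_pow, ← Real.mul_rpow (by positivity) hσ.le, ← Real.rpow_natCast,
              ← Real.rpow_mul (by positivity)]
            congr 1; push_cast; ring
          have e2 : σ ^ (-((n : ℝ) / 2 - θ)) = σ ^ ((n : ℝ) / 2 + θ) * (σ ^ n)⁻¹ := by
            rw [← Real.rpow_natCast, ← Real.rpow_neg hσ.le, ← Real.rpow_add hσ]
            congr 1; ring
          have e3 : ((2 * σ) ^ n)⁻¹ ≤ (σ ^ n)⁻¹ := by
            gcongr; linarith
          rw [e1, e2]
          have h0 : 0 ≤ (σ ^ n)⁻¹ := by positivity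
          set X := (3 * (‖c‖ + ρ)) ^ ((n : ℝ) / 2 + θ)
          set Y := σ ^ ((n : ℝ) / 2 + θ)
          calc X ^ 2 * Y ^ 2 * ((2 * σ) ^ n)⁻¹ * (σ ^ n)⁻¹
              ≤ X ^ 2 * Y ^ 2 * (σ ^ n)⁻¹ * (σ ^ n)⁻¹ := by gcongr
            _ = _ := by ring
  set D := ENNReal.ofReal ((3 * (‖c‖ + ρ)) ^ ((n : ℝ) / 2 + θ) * σ ^ (-((n : ℝ) / 2 - θ)))
  have h3 : J ≤ β * (D * A ^ (1 / 2 : ℝ)) := by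
    refine (le_rpow_half_of_sq_le h2).trans (le_of_eq ?_)
    have : β ^ 2 * (D ^ 2 * A) = (β * (D * A ^ (1 / 2 : ℝ))) ^ 2 := by
      rw [mul_pow, mul_pow, rpow_half_sq]
    rw [this, ← ENNReal.rpow_natCast, ← ENNReal.rpow_mul]
    norm_num
  have h4 := h1.trans (add_le_add le_rfl h3)
  rw [← mul_add] at h4
  exact (ENNReal.mul_le_mul_iff_right hβ0 hβt).1 h4

omit [NormedSpace ℝ V] in
-- Dyadic iteration of the doubling step, starting from scales in `[1/2, 1]`, where Cauchy–Schwarz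
-- and the `L²` norm suffice. The increments form a geometric progression dominated by the last one,
-- because `n/2 - θ > 0`.
theorem exists_lintegral_ball_le {θ : ℝ} (hθ : 0 < θ) (hθn : θ < (n : ℝ) / 2) :
    ∃ C : ℝ, 0 < C ∧ ∀ g : E n → V, StronglyMeasurable g → ∀ x ∈ Ω, ∀ σ : ℝ, 0 < σ → σ ≤ 1 →
      ∫⁻ z in Metric.ball c ρ, ‖g (x + σ • z)‖ₑ ≤ ENNReal.ofReal (C * σ ^ (-((n : ℝ) / 2 - θ))) *
        (l2Sq Ω g + slobodetskiiSq n θ Ω g) ^ (1 / 2 : ℝ) := by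
  have hρ := hΩ.pos
  set γ : ℝ := (n : ℝ) / 2 - θ with hγ
  have hγ0 : 0 < γ := by linarith
  set D : ℝ := (3 * (‖c‖ + ρ)) ^ ((n : ℝ) / 2 + θ) with hD
  have hD0 : 0 < D := by positivity
  set q : ℝ := 2 ^ (-γ) with hq
  have hq0 : 0 < q := by positivity
  have hq1 : q < 1 := Real.rpow_lt_one_of_one_lt_of_neg (by norm_num) (by linarith)
  set β := (volume (Metric.ball c ρ)).toReal with hβ
  have hβe : volume (Metric.ball c ρ) = ENNReal.ofReal β :=
    (ENNReal.ofReal_toReal measure_ball_lt_top.ne).symm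
  have hβ0 : 0 < β := ENNReal.toReal_pos hΩ.volume_ball_pos.ne' measure_ball_lt_top.ne
  -- The first entry handles the scales in `[1/2, 1]`. The second is the fixed point of `C ↦ Cq +
  -- D`, so passing from `2σ` to `σ` reproduces the same constant.
  set C : ℝ := max ((β * 2 ^ n) ^ (1 / 2 : ℝ)) (D / (1 - q)) with hC
  have hC0 : 0 < C := lt_max_of_lt_right (by have : 0 < 1 - q := by linarith
                                             positivity)
  have hCD : C * q + D ≤ C := by
    have : D / (1 - q) ≤ C := le_max_right _ _
    rw [div_le_iff₀ (by linarith)] at this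
    linarith
  refine ⟨C, hC0, fun g hg x hx => ?_⟩
  set S := (l2Sq Ω g + slobodetskiiSq n θ Ω g) ^ (1 / 2 : ℝ) with hS
  have key : ∀ k : ℕ, ∀ σ : ℝ, (1 / 2 : ℝ) ^ (k + 1) ≤ σ → σ ≤ 1 →
      ∫⁻ z in Metric.ball c ρ, ‖g (x + σ • z)‖ₑ ≤ ENNReal.ofReal (C * σ ^ (-γ)) * S := by
    intro k
    have base : ∀ σ : ℝ, 1 / 2 ≤ σ → σ ≤ 1 →
        ∫⁻ z in Metric.ball c ρ, ‖g (x + σ • z)‖ₑ ≤ ENNReal.ofReal (C * σ ^ (-γ)) * S := by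
      intro σ h1 h2
      have hσ : 0 < σ := by linarith
      have hm : Measurable fun z => ‖g (x + σ • z)‖ₑ := (hg.comp_measurable (by fun_prop)).enorm
      have h3 : (∫⁻ z in Metric.ball c ρ, ‖g (x + σ • z)‖ₑ) ^ 2 ≤
          ENNReal.ofReal (β * 2 ^ n) * (l2Sq Ω g + slobodetskiiSq n θ Ω g) := by
        calc _ ≤ volume (Metric.ball c ρ) * ∫⁻ z in Metric.ball c ρ, ‖g (x + σ • z)‖ₑ ^ 2 := by
              refine (sq_lintegral_le _ hm.aemeasurable).trans ?_
              rw [Measure.restrict_apply_univ]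
          _ ≤ ENNReal.ofReal β * (ENNReal.ofReal (2 ^ n) * l2Sq Ω g) := by
              rw [hβe]
              gcongr
              refine (hΩ.lintegral_ball_comp_smul_le (f := fun y => ‖g y‖ₑ ^ 2)
                (hg.enorm.pow_const 2) hx hσ).trans ?_
              unfold l2Sq
              gcongr
              rw [← inv_pow]
              gcongr
              rw [inv_le_comm₀ hσ (by norm_num)]
              linarith
          _ = ENNReal.ofReal (β * 2 ^ n) * l2Sq Ω g := by
              rw [← mul_assoc, ← ENNReal.ofReal_mul hβ0.le]
          _ ≤ _ := by gcongr; exact le_self_add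
      refine (le_rpow_half_of_sq_le h3).trans ?_
      rw [ENNReal.mul_rpow_of_nonneg _ _ (by norm_num),
        ENNReal.ofReal_rpow_of_nonneg (by positivity) (by norm_num)]
      gcongr
      calc (β * 2 ^ n) ^ (1 / 2 : ℝ) ≤ C * 1 := by rw [mul_one]; exact le_max_left _ _
        _ ≤ C * σ ^ (-γ) := by
          gcongr
          exact Real.one_le_rpow_of_pos_of_le_one_of_nonpos hσ h2 (by linarith)
    induction k with
    | zero => intro σ h1 h2; exact base σ (by simpa using h1) h2
    | succ k ih =>
      intro σ h1 h2
      rcases le_total (1 / 2) σ with h | h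
      · exact base σ h h2
      have hσ : 0 < σ := lt_of_lt_of_le (by positivity) h1
      refine (hΩ.lintegral_ball_step hθ hg hx hσ).trans ?_
      have h3 := ih (2 * σ) (by rw [pow_succ] at h1; linarith) (by linarith)
      calc _ ≤ ENNReal.ofReal (C * (2 * σ) ^ (-γ)) * S + ENNReal.ofReal (D * σ ^ (-γ)) * S := by
            have h4 : slobodetskiiSq n θ Ω g ^ (1 / 2 : ℝ) ≤ S := by
              rw [hS]; gcongr; exact le_add_self
            exact add_le_add h3 (by gcongr)
        _ = ENNReal.ofReal ((C * q + D) * σ ^ (-γ)) * S := by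
            rw [← add_mul, ← ENNReal.ofReal_add (by positivity) (by positivity),
              Real.mul_rpow (by norm_num) hσ.le]
            congr 2; rw [hq]; ring
        _ ≤ _ := by gcongr
  intro σ hσ h1
  obtain ⟨k, hk⟩ := exists_pow_lt_of_lt_one hσ (by norm_num : (1 / 2 : ℝ) < 1)
  refine key k σ ?_ h1
  rw [pow_succ]
  have : (0 : ℝ) < (1 / 2) ^ k := by positivity
  linarith

omit hΩ in
theorem clm_apply_eq_sum (L : E n →L[ℝ] V) (z : E n) : L z = ∑ i, z i • L (dirE n i) := by
  conv_lhs => rw [← (EuclideanSpace.basisFun (Fin n) ℝ).sum_repr z]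
  simp [dirE]

/-- `w` is of class `C¹` and `g i` are its partial derivatives on `Ω`. -/
def HasGradOn (Ω : Set (E n)) (w : E n → V) (g : Fin n → E n → V) : Prop :=
  ContDiff ℝ 1 w ∧ ∀ x ∈ Ω, ∀ i, fderiv ℝ w x (dirE n i) = g i x

omit hΩ in
theorem HasGradOn.enorm_fderiv_le {w : E n → V} {g : Fin n → E n → V} (h : HasGradOn Ω w g)
    {x : E n} (hx : x ∈ Ω) (z : E n) : ‖fderiv ℝ w x z‖ₑ ≤ ‖z‖ₑ * ∑ i, ‖g i x‖ₑ := by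
  rw [clm_apply_eq_sum, Finset.mul_sum]
  refine (enorm_sum_le _ _).trans (Finset.sum_le_sum fun i _ => ?_)
  rw [enorm_smul, h.2 x hx i]
  gcongr
  exact enorm_le_iff_norm_le.2 (EuclideanSpace.norm_eq z ▸ PiLp.norm_apply_le z i)

theorem HasGradOn.enorm_sub_le [CompleteSpace V] {w : E n → V} {g : Fin n → E n → V}
    (h : HasGradOn Ω w g)
    {x z : E n} (hx : x ∈ Ω) (hz : z ∈ Metric.ball c ρ) {δ : ℝ} (hδ : 0 ≤ δ) :
    ‖w (x + δ • z) - w x‖ₑ ≤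
      ∫⁻ σ in Set.Ioc 0 δ, ENNReal.ofReal (‖c‖ + ρ) * ∑ i, ‖g i (x + σ • z)‖ₑ := by
  have hd : ∀ σ : ℝ, HasDerivAt (fun σ : ℝ => w (x + σ • z)) (fderiv ℝ w (x + σ • z) z) σ := by
    intro σ
    have h1 : HasDerivAt (fun σ : ℝ => x + σ • z) z σ := by
      simpa using ((hasDerivAt_id σ).smul_const z).const_add x
    exact (h.1.differentiable (by norm_num) _).hasFDerivAt.comp_hasDerivAt σ h1
  have hc : Continuous fun σ : ℝ => fderiv ℝ w (x + σ • z) z := by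
    have := h.1.continuous_fderiv (by norm_num)
    fun_prop
  have e := intervalIntegral.integral_eq_sub_of_hasDerivAt (fun σ _ => hd σ)
    (hc.intervalIntegrable 0 δ)
  rw [zero_smul, add_zero, intervalIntegral.integral_of_le hδ] at e
  rw [← e]
  refine (enorm_integral_le_lintegral_enorm _).trans (lintegral_mono_ae ?_)
  filter_upwards [ae_restrict_mem measurableSet_Ioc] with σ hσ
  refine (h.enorm_fderiv_le (hΩ.add_mem x hx σ hσ.1.le z hz) z).trans ?_
  gcongr
  rw [← ofReal_norm]
  exact ENNReal.ofReal_le_ofReal (norm_lt_of_mem_ball hz).le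

/-- Writing the increment as an integral of the gradient along rays leaves `∫₀^δ σ^{-γ} dσ` with `γ
= n/2 - θ`. It converges because `γ < 1`, and it produces the Hölder exponent `1 - γ`. -/
theorem exists_lintegral_ball_sub_le [CompleteSpace V] {θ : ℝ} (hθ : 0 < θ)
    (hθn : θ < (n : ℝ) / 2) (hn : (n : ℝ) / 2 < 1 + θ) :
    ∃ C : ℝ, 0 < C ∧ ∀ (w : E n → V) (g : Fin n → E n → V), (∀ i, StronglyMeasurable (g i)) →
      HasGradOn Ω w g → ∀ x ∈ Ω, ∀ δ : ℝ, 0 < δ → δ ≤ 1 →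
      ∫⁻ z in Metric.ball c ρ, ‖w (x + δ • z) - w x‖ₑ ≤
        ENNReal.ofReal (C * δ ^ (1 - ((n : ℝ) / 2 - θ))) *
        ∑ i, (l2Sq Ω (g i) + slobodetskiiSq n θ Ω (g i)) ^ (1 / 2 : ℝ) := by
  obtain ⟨C, hC, H⟩ := hΩ.exists_lintegral_ball_le (V := V) hθ hθn
  have hρ := hΩ.pos
  set γ : ℝ := (n : ℝ) / 2 - θ with hγ
  have hγ0 : 0 < γ := by linarith
  have hγ1 : γ < 1 := by linarith
  have hγ1' : 0 < 1 - γ := by linarith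
  refine ⟨(‖c‖ + ρ) * C / (1 - γ), by positivity, fun w g hg hw x hx δ hδ hδ1 => ?_⟩
  set S : Fin n → ℝ≥0∞ := fun i => (l2Sq Ω (g i) + slobodetskiiSq n θ Ω (g i)) ^ (1 / 2 : ℝ)
  have hm : ∀ i, Measurable fun p : E n × ℝ => ‖g i (x + p.2 • p.1)‖ₑ := fun i =>
    ((hg i).comp_measurable (by fun_prop)).enorm
  calc ∫⁻ z in Metric.ball c ρ, ‖w (x + δ • z) - w x‖ₑ
      ≤ ∫⁻ z in Metric.ball c ρ, ∫⁻ σ in Set.Ioc 0 δ,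
          ENNReal.ofReal (‖c‖ + ρ) * ∑ i, ‖g i (x + σ • z)‖ₑ := by
        refine lintegral_mono_ae ?_
        filter_upwards [ae_restrict_mem measurableSet_ball] with z hz
        exact HasGradOn.enorm_sub_le hΩ hw hx hz hδ.le
    _ = ∫⁻ σ in Set.Ioc 0 δ, ∫⁻ z in Metric.ball c ρ,
          ENNReal.ofReal (‖c‖ + ρ) * ∑ i, ‖g i (x + σ • z)‖ₑ := by
        refine lintegral_lintegral_swap (Measurable.aemeasurable ?_)
        exact (Finset.measurable_fun_sum _ fun i _ => hm i).const_mul _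
    _ ≤ ∫⁻ σ in Set.Ioc 0 δ, ENNReal.ofReal (σ ^ (-γ)) *
          (ENNReal.ofReal ((‖c‖ + ρ) * C) * ∑ i, S i) := by
        refine lintegral_mono_ae ?_
        filter_upwards [ae_restrict_mem measurableSet_Ioc] with σ hσ
        have hm' : ∀ i, Measurable fun z : E n => ‖g i (x + σ • z)‖ₑ := fun i =>
          ((hg i).comp_measurable (by fun_prop)).enorm
        rw [lintegral_const_mul _ (Finset.measurable_fun_sum _ fun i _ => hm' i),
          lintegral_finsetSum _ fun i _ => hm' i]
        calc _ ≤ ENNReal.ofReal (‖c‖ + ρ) * ∑ i, ENNReal.ofReal (C * σ ^ (-γ)) * S i := by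
              gcongr with i
              exact H (g i) (hg i) x hx σ hσ.1 (hσ.2.trans hδ1)
          _ = _ := by
              rw [← Finset.mul_sum, ← mul_assoc, ← mul_assoc, ← ENNReal.ofReal_mul (by positivity),
                ← ENNReal.ofReal_mul (Real.rpow_nonneg hσ.1.le _)]
              congr 2; ring
    _ = _ := by
        rw [lintegral_mul_const _ (by fun_prop), lintegral_Ioc_rpow_neg hγ1 hδ, ← mul_assoc,
          ← ENNReal.ofReal_mul (by positivity)]
        congr 2; ring

end ConeDomain

theorem le_inv_mul_of_mul_le {a b d : ℝ≥0∞} (h0 : b ≠ 0) (ht : b ≠ ⊤) (h : b * a ≤ d) :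
    a ≤ b⁻¹ * d := by
  calc a = b⁻¹ * (b * a) := by rw [← mul_assoc, ENNReal.inv_mul_cancel h0 ht, one_mul]
    _ ≤ _ := by gcongr

/-! ### Sobolev embeddings on cone domains -/

namespace ConeDomain

variable {n : ℕ} {Ω : Set (E n)} {c : E n} {ρ : ℝ} (hΩ : ConeDomain Ω c ρ)
  {V : Type*} [NormedAddCommGroup V] [NormedSpace ℝ V] [CompleteSpace V]

include hΩ

/-- The value at `x` is compared with the values at `x + z`, averaged over the ball at scale 1: the
average costs the `L²` norm of `w`, the difference only its gradient. -/
theorem HasGradOn.exists_enorm_le {θ : ℝ} (hθ : 0 < θ)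
    (hθn : θ < (n : ℝ) / 2) (hn : (n : ℝ) / 2 < 1 + θ) :
    ∃ C : ℝ, 0 < C ∧ ∀ (w : E n → V) (g : Fin n → E n → V), (∀ i, StronglyMeasurable (g i)) →
      HasGradOn Ω w g → ∀ x ∈ Ω, ‖w x‖ₑ ≤ ENNReal.ofReal C * (l2Sq Ω w ^ (1 / 2 : ℝ) +
        ∑ i, (l2Sq Ω (g i) + slobodetskiiSq n θ Ω (g i)) ^ (1 / 2 : ℝ)) := by
  obtain ⟨C, hC, H⟩ := hΩ.exists_lintegral_ball_sub_le (V := V) hθ hθn hn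
  set β := (volume (Metric.ball c ρ)).toReal with hβ
  have hβe : volume (Metric.ball c ρ) = ENNReal.ofReal β :=
    (ENNReal.ofReal_toReal measure_ball_lt_top.ne).symm
  have hβ0 : 0 < β := ENNReal.toReal_pos hΩ.volume_ball_pos.ne' measure_ball_lt_top.ne
  set C' : ℝ := max (β ^ (1 / 2 : ℝ)) C with hC'
  refine ⟨β⁻¹ * C', by positivity, fun w g hg hw x hx => ?_⟩
  set T := ∑ i, (l2Sq Ω (g i) + slobodetskiiSq n θ Ω (g i)) ^ (1 / 2 : ℝ)
  have hwm : StronglyMeasurable w := hw.1.continuous.stronglyMeasurable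
  have hm : Measurable fun z => ‖w (x + (1 : ℝ) • z)‖ₑ := (hwm.comp_measurable (by fun_prop)).enorm
  have h1 : ENNReal.ofReal β * ‖w x‖ₑ ≤ ENNReal.ofReal C' * (l2Sq Ω w ^ (1 / 2 : ℝ) + T) := by
    calc ENNReal.ofReal β * ‖w x‖ₑ = ∫⁻ _ in Metric.ball c ρ, ‖w x‖ₑ := by
          rw [lintegral_const, Measure.restrict_apply_univ, hβe, mul_comm]
      _ ≤ ∫⁻ z in Metric.ball c ρ, (‖w (x + (1 : ℝ) • z)‖ₑ + ‖w (x + (1 : ℝ) • z) - w x‖ₑ) := by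
          refine lintegral_mono fun z => ?_
          calc ‖w x‖ₑ = ‖w (x + (1 : ℝ) • z) - (w (x + (1 : ℝ) • z) - w x)‖ₑ := by congr 1; abel
            _ ≤ _ := _root_.enorm_sub_le
      _ = (∫⁻ z in Metric.ball c ρ, ‖w (x + (1 : ℝ) • z)‖ₑ) +
            ∫⁻ z in Metric.ball c ρ, ‖w (x + (1 : ℝ) • z) - w x‖ₑ := lintegral_add_left hm _
      _ ≤ ENNReal.ofReal (β ^ (1 / 2 : ℝ)) * l2Sq Ω w ^ (1 / 2 : ℝ) + ENNReal.ofReal C * T := by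
          gcongr
          · rw [← ENNReal.ofReal_rpow_of_nonneg hβ0.le (by norm_num),
              ← ENNReal.mul_rpow_of_nonneg _ _ (by norm_num)]
            apply le_rpow_half_of_sq_le
            refine (sq_lintegral_le _ hm.aemeasurable).trans ?_
            rw [Measure.restrict_apply_univ, hβe]
            gcongr
            refine (hΩ.lintegral_ball_comp_smul_le (f := fun y => ‖w y‖ₑ ^ 2)
              (hwm.enorm.pow_const 2) hx one_pos).trans ?_
            simp [l2Sq]
          · have := H w g hg hw x hx 1 one_pos le_rfl
            rwa [Real.one_rpow, mul_one] at this
      _ ≤ ENNReal.ofReal C' * l2Sq Ω w ^ (1 / 2 : ℝ) + ENNReal.ofReal C' * T := by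
          gcongr
          · exact le_max_left _ _
          · exact le_max_right _ _
      _ = _ := by rw [mul_add]
  rw [ENNReal.ofReal_mul (by positivity), ENNReal.ofReal_inv_of_pos hβ0, mul_assoc]
  exact le_inv_mul_of_mul_le (by simpa using hβ0) ENNReal.ofReal_ne_top h1

omit hΩ in
theorem add_smul_eq {x y z : E n} {δ : ℝ} (hδ : δ ≠ 0) :
    x + δ • z = y + δ • (z + δ⁻¹ • (x - y)) := by
  rw [smul_add, smul_smul, mul_inv_cancel₀ hδ, one_smul]; abel

/-- Morrey's argument: `x` and `y` are compared through points reached from both. With `δ = 2‖x -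
y‖/ρ` one has `x + δz = y + δ(z + a)` and `‖a‖ = ρ/2`, so for `z` in the half-size ball both `z` and
`z + a` lie in `B(c, ρ)`. The restriction on `‖x - y‖` keeps `δ ≤ 1`. -/
theorem HasGradOn.exists_enorm_sub_le {θ : ℝ} (hθ : 0 < θ)
    (hθn : θ < (n : ℝ) / 2) (hn : (n : ℝ) / 2 < 1 + θ) :
    ∃ C : ℝ, 0 < C ∧ ∀ (w : E n → V) (g : Fin n → E n → V), (∀ i, StronglyMeasurable (g i)) →
      HasGradOn Ω w g → ∀ x ∈ Ω, ∀ y ∈ Ω, ‖x - y‖ ≤ ρ / 2 →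
      ‖w x - w y‖ₑ ≤ ENNReal.ofReal (C * ‖x - y‖ ^ (1 - ((n : ℝ) / 2 - θ))) *
        ∑ i, (l2Sq Ω (g i) + slobodetskiiSq n θ Ω (g i)) ^ (1 / 2 : ℝ) := by
  obtain ⟨C, hC, H⟩ := hΩ.exists_lintegral_ball_sub_le (V := V) hθ hθn hn
  have hρ := hΩ.pos
  set α := 1 - ((n : ℝ) / 2 - θ) with hα
  set β := (volume (Metric.ball c (ρ / 2))).toReal with hβ
  have hβe : volume (Metric.ball c (ρ / 2)) = ENNReal.ofReal β :=
    (ENNReal.ofReal_toReal measure_ball_lt_top.ne).symm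
  have hβ0 : 0 < β := ENNReal.toReal_pos (Metric.measure_ball_pos _ _ (by linarith)).ne'
    measure_ball_lt_top.ne
  refine ⟨β⁻¹ * (2 * (C * (2 / ρ) ^ α)), by positivity, fun w g hg hw x hx y hy hxy => ?_⟩
  set T := ∑ i, (l2Sq Ω (g i) + slobodetskiiSq n θ Ω (g i)) ^ (1 / 2 : ℝ)
  rcases eq_or_ne x y with rfl | hne
  · simp
  have hr : 0 < ‖x - y‖ := norm_pos_iff.2 (sub_ne_zero.2 hne)
  set δ := 2 / ρ * ‖x - y‖ with hδ
  have hδ0 : 0 < δ := by positivity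
  have hδ1 : δ ≤ 1 := by
    rw [hδ, div_mul_eq_mul_div, div_le_one hρ]; linarith
  have hwm : StronglyMeasurable w := hw.1.continuous.stronglyMeasurable
  set a := δ⁻¹ • (x - y) with ha
  have hna : ‖a‖ = ρ / 2 := by
    rw [ha, norm_smul, norm_inv, Real.norm_of_nonneg hδ0.le, hδ]
    field_simp
  have hm : ∀ p : E n, Measurable fun z => ‖w (p + δ • z) - w p‖ₑ := fun p =>
    ((hwm.comp_measurable (by fun_prop)).sub stronglyMeasurable_const).enorm
  have hsub : Metric.ball c (ρ / 2) ⊆ Metric.ball c ρ := Metric.ball_subset_ball (by linarith)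
  have hy2 : ∫⁻ z in Metric.ball c (ρ / 2), ‖w (y + δ • (z + a)) - w y‖ₑ ≤
      ∫⁻ z in Metric.ball c ρ, ‖w (y + δ • z) - w y‖ₑ := by
    have h := (measurePreserving_add_right (volume : Measure (E n)) a).setLIntegral_comp_emb
      (Homeomorph.addRight a).measurableEmbedding (fun z => ‖w (y + δ • z) - w y‖ₑ)
      (Metric.ball c (ρ / 2))
    rw [h]
    refine lintegral_mono_set ?_
    rintro _ ⟨z, hz, rfl⟩
    rw [Metric.mem_ball, dist_eq_norm] at hz ⊢
    calc ‖z + a - c‖ = ‖(z - c) + a‖ := by congr 1; abel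
      _ ≤ ‖z - c‖ + ‖a‖ := norm_add_le _ _
      _ < ρ := by linarith
  have h1 : ENNReal.ofReal β * ‖w x - w y‖ₑ ≤
      ENNReal.ofReal (2 * (C * δ ^ α)) * T := by
    calc ENNReal.ofReal β * ‖w x - w y‖ₑ = ∫⁻ _ in Metric.ball c (ρ / 2), ‖w x - w y‖ₑ := by
          rw [lintegral_const, Measure.restrict_apply_univ, hβe, mul_comm]
      _ ≤ ∫⁻ z in Metric.ball c (ρ / 2), (‖w (x + δ • z) - w x‖ₑ +
            ‖w (y + δ • (z + a)) - w y‖ₑ) := by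
          refine lintegral_mono fun z => ?_
          rw [ha, ← add_smul_eq hδ0.ne']
          calc ‖w x - w y‖ₑ = ‖(w (x + δ • z) - w y) - (w (x + δ • z) - w x)‖ₑ := by
                congr 1; abel
            _ ≤ _ := _root_.enorm_sub_le
            _ = _ := add_comm _ _
      _ = (∫⁻ z in Metric.ball c (ρ / 2), ‖w (x + δ • z) - w x‖ₑ) +
            ∫⁻ z in Metric.ball c (ρ / 2), ‖w (y + δ • (z + a)) - w y‖ₑ :=
          lintegral_add_left (hm x) _
      _ ≤ ENNReal.ofReal (C * δ ^ α) * T + ENNReal.ofReal (C * δ ^ α) * T := by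
          refine add_le_add ?_ ?_
          · exact (lintegral_mono_set hsub).trans (H w g hg hw x hx δ hδ0 hδ1)
          · exact hy2.trans (H w g hg hw y hy δ hδ0 hδ1)
      _ = _ := by
          rw [← add_mul, ← ENNReal.ofReal_add (by positivity) (by positivity), two_mul]
  have e : β⁻¹ * (2 * (C * (2 / ρ) ^ α)) * ‖x - y‖ ^ α = β⁻¹ * (2 * (C * δ ^ α)) := by
    rw [hδ, Real.mul_rpow (by positivity) (by positivity)]; ring
  rw [e, ENNReal.ofReal_mul (by positivity), ENNReal.ofReal_inv_of_pos hβ0, mul_assoc]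
  exact le_inv_mul_of_mul_le (by simpa using hβ0) ENNReal.ofReal_ne_top h1

/-- The segment from `x` to `y` may leave `Ω`, so the two points are joined through `x + δc`, which
also lies on a ray of the cone at `y`. The cone is infinite, hence no restriction on `‖x - y‖`; the
factor `4/ρ` comes from two segments with `δ = 2‖x - y‖/ρ`. -/
theorem HasGradOn.enorm_sub_le_of_bound {w : E n → V} {g : Fin n → E n → V}
    (h : HasGradOn Ω w g) {b : ℝ≥0∞} (hb : ∀ i, ∀ x ∈ Ω, ‖g i x‖ₑ ≤ b) {x y : E n}
    (hx : x ∈ Ω) (hy : y ∈ Ω) :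
    ‖w x - w y‖ₑ ≤ ENNReal.ofReal (4 * n * (‖c‖ + ρ) / ρ * ‖x - y‖) * b := by
  have hρ := hΩ.pos
  rcases eq_or_ne x y with rfl | hne
  · simp
  have hr : 0 < ‖x - y‖ := norm_pos_iff.2 (sub_ne_zero.2 hne)
  set δ := 2 / ρ * ‖x - y‖ with hδ
  have hδ0 : 0 < δ := by positivity
  have step : ∀ p ∈ Ω, ∀ z ∈ Metric.ball c ρ,
      ‖w (p + δ • z) - w p‖ₑ ≤ ENNReal.ofReal (n * (‖c‖ + ρ) * δ) * b := by
    intro p hp z hz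
    refine (HasGradOn.enorm_sub_le hΩ h hp hz hδ0.le).trans ?_
    calc _ ≤ ∫⁻ σ in Set.Ioc 0 δ, ENNReal.ofReal (‖c‖ + ρ) * ∑ i : Fin n, b := by
          refine lintegral_mono_ae ?_
          filter_upwards [ae_restrict_mem measurableSet_Ioc] with σ hσ
          gcongr with i
          exact hb i _ (hΩ.add_mem p hp σ hσ.1.le z hz)
      _ = _ := by
          rw [lintegral_const, Measure.restrict_apply_univ, Real.volume_Ioc, sub_zero,
            Finset.sum_const, Finset.card_univ, Fintype.card_fin, nsmul_eq_mul,
            mul_assoc (n : ℝ), ENNReal.ofReal_mul (p := (n : ℝ)) (by positivity),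
            ENNReal.ofReal_mul (p := ‖c‖ + ρ) (by positivity), ENNReal.ofReal_natCast]
          ring
  have hc : c ∈ Metric.ball c ρ := Metric.mem_ball_self hρ
  have hz : c + δ⁻¹ • (x - y) ∈ Metric.ball c ρ := by
    rw [Metric.mem_ball, dist_eq_norm, add_sub_cancel_left, norm_smul, norm_inv,
      Real.norm_of_nonneg hδ0.le, hδ]
    have : (2 / ρ * ‖x - y‖)⁻¹ * ‖x - y‖ = ρ / 2 := by field_simp
    rw [this]; linarith
  have h1 := step x hx c hc
  have h2 := step y hy _ hz
  rw [← add_smul_eq hδ0.ne'] at h2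
  calc ‖w x - w y‖ₑ = ‖(w (x + δ • c) - w y) - (w (x + δ • c) - w x)‖ₑ := by congr 1; abel
    _ ≤ _ := _root_.enorm_sub_le
    _ ≤ _ := add_le_add h2 h1
    _ = _ := by
      rw [← add_mul, ← ENNReal.ofReal_add (by positivity) (by positivity), hδ]
      congr 2; field_simp; ring

theorem HasGradOn.moll {u : E n → V} {v : Fin n → E n → V} (hu : LocallyIntegrable u)
    (h : ∀ i, hΩ.IsMollDeriv (dirE n i) u (v i)) (k : ℕ) :
    HasGradOn Ω (hΩ.moll k u) (fun i => hΩ.moll k (v i)) :=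
  ⟨(hΩ.contDiff_moll hu k).of_le (by norm_num), fun _ hx i => (h i).fderiv_moll hΩ hu k hx⟩

omit [CompleteSpace V] in
theorem stronglyMeasurable_moll {u : E n → V} (hu : LocallyIntegrable u) (k : ℕ) :
    StronglyMeasurable (hΩ.moll k u) := (hΩ.contDiff_moll hu k).continuous.stronglyMeasurable

theorem ae_restrict_tendsto_moll {u : E n → V} (hu : LocallyIntegrable u) :
    ∀ᵐ x ∂volume.restrict Ω, x ∈ Ω ∧ Tendsto (fun k => hΩ.moll k u x) atTop (𝓝 (u x)) := by
  filter_upwards [ae_restrict_mem hΩ.measurableSet, ae_restrict_of_ae (hΩ.ae_tendsto_moll hu)]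
    with x hx h using ⟨hx, h⟩

/-- Sobolev embedding into `L^∞`. -/
theorem exists_ae_enorm_sq_le {θ : ℝ} (hθ : 0 < θ) (hθn : θ < (n : ℝ) / 2)
    (hn : (n : ℝ) / 2 < 1 + θ) :
    ∃ C : ℝ, 0 < C ∧ ∀ (u : E n → V) (v : Fin n → E n → V), StronglyMeasurable u →
      (∀ i, StronglyMeasurable (v i)) → LocallyIntegrable u → (∀ i, LocallyIntegrable (v i)) →
      (∀ i, hΩ.IsMollDeriv (dirE n i) u (v i)) →
      ∀ᵐ x ∂volume.restrict Ω, ‖u x‖ₑ ^ 2 ≤ ENNReal.ofReal C * (l2Sq Ω u +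
        ∑ i, (l2Sq Ω (v i) + slobodetskiiSq n θ Ω (v i))) := by
  obtain ⟨C, hC, H⟩ := HasGradOn.exists_enorm_le hΩ (V := V) hθ hθn hn
  refine ⟨C ^ 2 * 2 * (n + 1), by positivity, fun u v hum hvm hu hv h => ?_⟩
  filter_upwards [hΩ.ae_restrict_tendsto_moll hu] with x ⟨hx, hlim⟩
  -- The bound holds at every point of `Ω` for each mollification, and mollifying does not increase
  -- its right side; it therefore survives the almost everywhere limit.
  refine le_of_tendsto ((ENNReal.continuous_pow 2).tendsto _ |>.comp hlim.enorm)
    (Eventually.of_forall fun k => ?_)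
  have h1 := H _ _ (fun i => hΩ.stronglyMeasurable_moll (hv i) k) (HasGradOn.moll hΩ hu h k) x hx
  set S : Fin n → ℝ≥0∞ := fun i => l2Sq Ω (v i) + slobodetskiiSq n θ Ω (v i) with hS
  have h2 : ∀ i, (l2Sq Ω (hΩ.moll k (v i)) + slobodetskiiSq n θ Ω (hΩ.moll k (v i))) ≤ S i :=
    fun i => add_le_add (hΩ.l2Sq_moll_le (hvm i) k)
      (hΩ.slobodetskiiSq_moll_le (hvm i) (hv i) θ k)
  simp only [Function.comp]
  calc ‖hΩ.moll k u x‖ₑ ^ 2 ≤ (ENNReal.ofReal C * (l2Sq Ω u ^ (1 / 2 : ℝ) +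
        ∑ i, S i ^ (1 / 2 : ℝ))) ^ 2 := by
        gcongr
        refine h1.trans ?_
        gcongr with i
        · exact hΩ.l2Sq_moll_le hum k
        · exact h2 i
    _ ≤ ENNReal.ofReal C ^ 2 * (2 * ((l2Sq Ω u ^ (1 / 2 : ℝ)) ^ 2 +
          n * ∑ i, (S i ^ (1 / 2 : ℝ)) ^ 2)) := by
        rw [mul_pow]
        gcongr
        refine (add_sq_le_two_mul _ _).trans ?_
        gcongr
        simpa using sum_sq_le_card_mul Finset.univ fun i => S i ^ (1 / 2 : ℝ)
    _ ≤ ENNReal.ofReal C ^ 2 * (2 * ((n + 1) * (l2Sq Ω u + ∑ i, S i))) := by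
        simp only [rpow_half_sq]
        gcongr
        rw [mul_add]
        gcongr
        · exact le_mul_of_one_le_left (by positivity) le_add_self
        · exact le_self_add
    _ = _ := by
        rw [ENNReal.ofReal_mul (by positivity), ENNReal.ofReal_mul (by positivity),
          ENNReal.ofReal_pow hC.le, ENNReal.ofReal_add (by positivity) (by positivity),
          ENNReal.ofReal_natCast, ENNReal.ofReal_ofNat, ENNReal.ofReal_one]
        ring

/-- Sobolev embedding into a Hölder space. -/
theorem exists_ae_enorm_sub_sq_le {θ : ℝ} (hθ : 0 < θ) (hθn : θ < (n : ℝ) / 2)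
    (hn : (n : ℝ) / 2 < 1 + θ) :
    ∃ C : ℝ, 0 < C ∧ ∀ (u : E n → V) (v : Fin n → E n → V),
      (∀ i, StronglyMeasurable (v i)) → LocallyIntegrable u → (∀ i, LocallyIntegrable (v i)) →
      (∀ i, hΩ.IsMollDeriv (dirE n i) u (v i)) →
      ∀ᵐ x ∂volume.restrict Ω, ∀ᵐ y ∂volume.restrict Ω, ‖x - y‖ ≤ ρ / 2 →
        ‖u x - u y‖ₑ ^ 2 ≤ ENNReal.ofReal (C * ‖x - y‖ ^ (2 * (1 - ((n : ℝ) / 2 - θ)))) *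
          ∑ i, (l2Sq Ω (v i) + slobodetskiiSq n θ Ω (v i)) := by
  obtain ⟨C, hC, H⟩ := HasGradOn.exists_enorm_sub_le hΩ (V := V) hθ hθn hn
  refine ⟨C ^ 2 * (n + 1), by positivity, fun u v hvm hu hv h => ?_⟩
  filter_upwards [hΩ.ae_restrict_tendsto_moll hu] with x ⟨hx, hxl⟩
  filter_upwards [hΩ.ae_restrict_tendsto_moll hu] with y ⟨hy, hyl⟩ hxy
  refine le_of_tendsto ((ENNReal.continuous_pow 2).tendsto _ |>.comp (hxl.sub hyl).enorm)
    (Eventually.of_forall fun k => ?_)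
  have h1 := H _ _ (fun i => hΩ.stronglyMeasurable_moll (hv i) k) (HasGradOn.moll hΩ hu h k)
    x hx y hy hxy
  set S : Fin n → ℝ≥0∞ := fun i => l2Sq Ω (v i) + slobodetskiiSq n θ Ω (v i) with hS
  set α := 1 - ((n : ℝ) / 2 - θ) with hα
  have h2 : ∀ i, (l2Sq Ω (hΩ.moll k (v i)) + slobodetskiiSq n θ Ω (hΩ.moll k (v i))) ≤ S i :=
    fun i => add_le_add (hΩ.l2Sq_moll_le (hvm i) k)
      (hΩ.slobodetskiiSq_moll_le (hvm i) (hv i) θ k)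
  simp only [Function.comp]
  calc ‖hΩ.moll k u x - hΩ.moll k u y‖ₑ ^ 2 ≤ (ENNReal.ofReal (C * ‖x - y‖ ^ α) *
        ∑ i, S i ^ (1 / 2 : ℝ)) ^ 2 := by
        gcongr
        refine h1.trans ?_
        gcongr with i
        exact h2 i
    _ ≤ ENNReal.ofReal (C * ‖x - y‖ ^ α) ^ 2 * (n * ∑ i, (S i ^ (1 / 2 : ℝ)) ^ 2) := by
        rw [mul_pow]
        gcongr
        simpa using sum_sq_le_card_mul Finset.univ fun i => S i ^ (1 / 2 : ℝ)
    _ ≤ ENNReal.ofReal (C * ‖x - y‖ ^ α) ^ 2 * ((n + 1) * ∑ i, S i) := by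
        simp only [rpow_half_sq]
        gcongr
        exact le_self_add
    _ = _ := by
        rw [← ENNReal.ofReal_pow (by positivity), ← mul_assoc]
        have : ((n : ℝ≥0∞) + 1) = ENNReal.ofReal (n + 1) := by
          rw [ENNReal.ofReal_add (by positivity) (by positivity), ENNReal.ofReal_natCast,
            ENNReal.ofReal_one]
        rw [this, ← ENNReal.ofReal_mul (by positivity)]
        congr 2
        rw [mul_pow, ← Real.rpow_natCast (‖x - y‖ ^ α), ← Real.rpow_mul (norm_nonneg _)]
        push_cast
        rw [mul_comm α 2]; ring

theorem ae_enorm_sub_le_of_bound {u : E n → V} {v : Fin n → E n → V}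
    (hu : LocallyIntegrable u) (h : ∀ i, hΩ.IsMollDeriv (dirE n i) u (v i)) {b : ℝ≥0∞}
    (hb : ∀ i, ∀ᵐ x ∂volume.restrict Ω, ‖v i x‖ₑ ≤ b) :
    ∀ᵐ x ∂volume.restrict Ω, ∀ᵐ y ∂volume.restrict Ω,
      ‖u x - u y‖ₑ ≤ ENNReal.ofReal (4 * n * (‖c‖ + ρ) / ρ * ‖x - y‖) * b := by
  filter_upwards [hΩ.ae_restrict_tendsto_moll hu] with x ⟨hx, hxl⟩
  filter_upwards [hΩ.ae_restrict_tendsto_moll hu] with y ⟨hy, hyl⟩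
  refine le_of_tendsto (hxl.sub hyl).enorm (Eventually.of_forall fun k => ?_)
  exact HasGradOn.enorm_sub_le_of_bound hΩ (HasGradOn.moll hΩ hu h k)
    (fun i x hx => hΩ.enorm_moll_le_of_ae (hb i) k hx) hx hy

end ConeDomain

/-! ### Interpolation of first derivatives -/

theorem add_add_sq_le_three_mul (a b d : ℝ≥0∞) :
    (a + b + d) ^ 2 ≤ 3 * (a ^ 2 + b ^ 2 + d ^ 2) := by
  have := sum_sq_le_card_mul Finset.univ ![a, b, d]
  simpa [Fin.sum_univ_three] using this

theorem l2Sq_le_liminf {n : ℕ} {V : Type*} [NormedAddCommGroup V] [NormedSpace ℝ V] {Ω : Set (E n)}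
    {u : E n → V} {f : ℕ → E n → V} (hf : ∀ k, StronglyMeasurable (f k))
    (h : ∀ᵐ x ∂volume.restrict Ω, Tendsto (fun k => f k x) atTop (𝓝 (u x))) {b : ℝ≥0∞}
    (hb : ∀ k, l2Sq Ω (f k) ≤ b) : l2Sq Ω u ≤ b := by
  calc l2Sq Ω u = ∫⁻ x in Ω, liminf (fun k => ‖f k x‖ₑ ^ 2) atTop := by
        refine lintegral_congr_ae ?_
        filter_upwards [h] with x hx
        exact (((ENNReal.continuous_pow 2).tendsto _).comp hx.enorm).liminf_eq.symm
    _ ≤ liminf (fun k => l2Sq Ω (f k)) atTop :=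
        lintegral_liminf_le fun k => (hf k).enorm.pow_const 2
    _ ≤ b := by
        refine liminf_le_of_le (by isBoundedDefault) fun d hd => ?_
        obtain ⟨k, hk⟩ := hd.exists
        exact hk.trans (hb k)

namespace ConeDomain

variable {n : ℕ} {Ω : Set (E n)} {c : E n} {ρ : ℝ} (hΩ : ConeDomain Ω c ρ)
  {V : Type*} [NormedAddCommGroup V] [NormedSpace ℝ V] [CompleteSpace V]

include hΩ

/-- First-order Taylor expansion along a ray, solved for the derivative: `δ Dw(x)z` is `w(x + δz) -
w(x)` minus the integral of `Dw(x + σz)z - Dw(x)z`. That last difference is controlled by the second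
derivatives along the ray. -/
theorem HasGradOn.smul_enorm_fderiv_le {w : E n → V} {g : Fin n → E n → V}
    {h : Fin n → Fin n → E n → V} (hw : HasGradOn Ω w g) (hg : ∀ i, HasGradOn Ω (g i) (h i))
    (hh : ∀ i j, StronglyMeasurable (h i j)) {x z : E n} (hx : x ∈ Ω) (hz : z ∈ Metric.ball c ρ) {δ : ℝ} (hδ : 0 ≤ δ) :
    ENNReal.ofReal δ * ‖fderiv ℝ w x z‖ₑ ≤ ‖w (x + δ • z)‖ₑ + ‖w x‖ₑ +
      ENNReal.ofReal δ * ∫⁻ σ in Set.Ioc 0 δ,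
        ENNReal.ofReal ((‖c‖ + ρ) ^ 2) * ∑ i, ∑ j, ‖h i j (x + σ • z)‖ₑ := by
  have hρ := hΩ.pos
  have hzl : ‖z‖ₑ ≤ ENNReal.ofReal (‖c‖ + ρ) := by
    rw [← ofReal_norm]
    exact ENNReal.ofReal_le_ofReal (norm_lt_of_mem_ball hz).le
  set I := ∫⁻ σ in Set.Ioc 0 δ,
        ENNReal.ofReal ((‖c‖ + ρ) ^ 2) * ∑ i, ∑ j, ‖h i j (x + σ • z)‖ₑ with hI
  have hd : ∀ σ : ℝ, HasDerivAt (fun σ : ℝ => w (x + σ • z)) (fderiv ℝ w (x + σ • z) z) σ := by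
    intro σ
    have h1 : HasDerivAt (fun σ : ℝ => x + σ • z) z σ := by
      simpa using ((hasDerivAt_id σ).smul_const z).const_add x
    exact (hw.1.differentiable (by norm_num) _).hasFDerivAt.comp_hasDerivAt σ h1
  have hc : Continuous fun σ : ℝ => fderiv ℝ w (x + σ • z) z := by
    have := hw.1.continuous_fderiv (by norm_num)
    fun_prop
  have e := intervalIntegral.integral_eq_sub_of_hasDerivAt (fun σ _ => hd σ)
    (hc.intervalIntegrable 0 δ)
  rw [zero_smul, add_zero] at e
  have key : ∀ σ ∈ Set.Ioc 0 δ, ‖fderiv ℝ w (x + σ • z) z - fderiv ℝ w x z‖ₑ ≤ I := by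
    intro σ hσ
    have hxσ := hΩ.add_mem x hx σ hσ.1.le z hz
    calc ‖fderiv ℝ w (x + σ • z) z - fderiv ℝ w x z‖ₑ
        = ‖∑ i, z i • (g i (x + σ • z) - g i x)‖ₑ := by
          rw [clm_apply_eq_sum, clm_apply_eq_sum (fderiv ℝ w x), ← Finset.sum_sub_distrib]
          congr 1
          refine Finset.sum_congr rfl fun i _ => ?_
          rw [hw.2 _ hxσ i, hw.2 _ hx i, smul_sub]
      _ ≤ ∑ i, ENNReal.ofReal (‖c‖ + ρ) * ∫⁻ s in Set.Ioc 0 δ,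
            ENNReal.ofReal (‖c‖ + ρ) * ∑ j, ‖h i j (x + s • z)‖ₑ := by
          refine (enorm_sum_le _ _).trans (Finset.sum_le_sum fun i _ => ?_)
          rw [enorm_smul]
          gcongr
          · exact (enorm_le_iff_norm_le.2 (PiLp.norm_apply_le z i)).trans hzl
          · exact (HasGradOn.enorm_sub_le hΩ (hg i) hx hz hσ.1.le).trans
              (lintegral_mono_set (Set.Ioc_subset_Ioc_right hσ.2))
      _ ≤ I := by
          have hR : (0 : ℝ) ≤ ‖c‖ + ρ := by positivity
          rw [hI, ENNReal.ofReal_pow hR, lintegral_const_mul' _ _ (by simp), sq, mul_assoc,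
            ← Finset.mul_sum]
          gcongr
          simp_rw [lintegral_const_mul' _ _ (ENNReal.ofReal_ne_top)]
          rw [← Finset.mul_sum]
          gcongr
          have hm : ∀ i j, Measurable fun s : ℝ => ‖h i j (x + s • z)‖ₑ := fun i j =>
            ((hh i j).comp_measurable (by fun_prop)).enorm
          rw [lintegral_finsetSum _ fun i _ => Finset.measurable_fun_sum _ fun j _ => hm i j]
  have e2 : δ • fderiv ℝ w x z = (w (x + δ • z) - w x) -
      ∫ σ in (0 : ℝ)..δ, (fderiv ℝ w (x + σ • z) z - fderiv ℝ w x z) := by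
    rw [intervalIntegral.integral_sub (hc.intervalIntegrable 0 δ) (by simp), e,
      intervalIntegral.integral_const]
    simp
  calc ENNReal.ofReal δ * ‖fderiv ℝ w x z‖ₑ = ‖δ • fderiv ℝ w x z‖ₑ := by
        rw [enorm_smul, Real.enorm_of_nonneg hδ]
    _ ≤ ‖w (x + δ • z)‖ₑ + ‖w x‖ₑ +
        ‖∫ σ in (0 : ℝ)..δ, (fderiv ℝ w (x + σ • z) z - fderiv ℝ w x z)‖ₑ := by
        rw [e2]
        refine _root_.enorm_sub_le.trans ?_
        gcongr
        exact _root_.enorm_sub_le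
    _ ≤ _ := by
        gcongr
        rw [intervalIntegral.integral_of_le hδ]
        refine (enorm_integral_le_lintegral_enorm _).trans ?_
        calc _ ≤ ∫⁻ _ in Set.Ioc 0 δ, I := by
              refine lintegral_mono_ae ?_
              filter_upwards [ae_restrict_mem measurableSet_Ioc] with σ hσ using key σ hσ
          _ = _ := by
              rw [lintegral_const, Measure.restrict_apply_univ, Real.volume_Ioc, sub_zero, mul_comm]

/-- The constant in the interpolation inequality between `L²`, `W_2^1` and `W_2^2`. -/
theorem HasGradOn.lintegral_fderiv_sq_le {w : E n → V} {g : Fin n → E n → V}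
    {h : Fin n → Fin n → E n → V} (hw : HasGradOn Ω w g) (hg : ∀ i, HasGradOn Ω (g i) (h i))
    (hh : ∀ i j, StronglyMeasurable (h i j)) {z : E n} (hz : z ∈ Metric.ball c ρ) {δ : ℝ}
    (hδ : 0 < δ) :
    ENNReal.ofReal (δ ^ 2) * ∫⁻ x in Ω, ‖fderiv ℝ w x z‖ₑ ^ 2 ≤ 6 * l2Sq Ω w +
      ENNReal.ofReal (3 * ((‖c‖ + ρ) ^ 2) ^ 2 * n ^ 2 * δ ^ 4) * ∑ i, ∑ j, l2Sq Ω (h i j) := by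
  have hρ := hΩ.pos
  set R2 : ℝ := (‖c‖ + ρ) ^ 2 with hR2
  have hR2' : 0 ≤ R2 := by positivity
  have hwm : StronglyMeasurable w := hw.1.continuous.stronglyMeasurable
  have hm : ∀ i j, Measurable fun p : E n × ℝ => ‖h i j (p.1 + p.2 • z)‖ₑ := fun i j =>
    ((hh i j).comp_measurable (by fun_prop)).enorm
  have hms : ∀ x i j, Measurable fun s : ℝ => ‖h i j (x + s • z)‖ₑ := fun x i j =>
    ((hh i j).comp_measurable (by fun_prop)).enorm
  have hmx : ∀ (s : ℝ) i j, Measurable fun x : E n => ‖h i j (x + s • z)‖ₑ := fun s i j =>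
    ((hh i j).comp_measurable (by fun_prop)).enorm
  set I : E n → ℝ≥0∞ := fun x => ∫⁻ σ in Set.Ioc 0 δ,
        ENNReal.ofReal R2 * ∑ i, ∑ j, ‖h i j (x + σ • z)‖ₑ with hI
  set J : E n → ℝ≥0∞ := fun x => ∑ i, ∑ j, ∫⁻ σ in Set.Ioc 0 δ, ‖h i j (x + σ • z)‖ₑ ^ 2 with hJ
  have hIJ : ∀ x, I x ^ 2 ≤ ENNReal.ofReal (R2 ^ 2 * n ^ 2 * δ) * J x := by
    intro x
    calc I x ^ 2 ≤ ENNReal.ofReal δ * ∫⁻ σ in Set.Ioc 0 δ,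
          (ENNReal.ofReal R2 * ∑ i, ∑ j, ‖h i j (x + σ • z)‖ₑ) ^ 2 := by
          refine (sq_lintegral_le _ (Measurable.aemeasurable ?_)).trans ?_
          · exact (Finset.measurable_fun_sum _ fun i _ => Finset.measurable_fun_sum _ fun j _ =>
              hms x i j).const_mul _
          · rw [Measure.restrict_apply_univ, Real.volume_Ioc, sub_zero]
      _ ≤ ENNReal.ofReal δ * ∫⁻ σ in Set.Ioc 0 δ, ENNReal.ofReal R2 ^ 2 *
          ((n : ℝ≥0∞) ^ 2 * ∑ i, ∑ j, ‖h i j (x + σ • z)‖ₑ ^ 2) := by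
          gcongr with σ
          rw [mul_pow]
          gcongr
          refine (sum_sq_le_card_mul _ _).trans ?_
          rw [Finset.card_univ, Fintype.card_fin, sq, mul_assoc]
          gcongr
          rw [Finset.mul_sum]
          gcongr with i
          simpa using sum_sq_le_card_mul Finset.univ fun j => ‖h i j (x + σ • z)‖ₑ
      _ = _ := by
          have hm2 : ∀ i j, Measurable fun s : ℝ => ‖h i j (x + s • z)‖ₑ ^ 2 := fun i j =>
            (hms x i j).pow_const 2
          have hm3 : ∀ i, Measurable fun s : ℝ => ∑ j, ‖h i j (x + s • z)‖ₑ ^ 2 := fun i =>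
            Finset.measurable_fun_sum _ fun j _ => hm2 i j
          rw [lintegral_const_mul' _ _ (by simp), lintegral_const_mul' _ _ (by simp),
            lintegral_finsetSum _ fun i _ => hm3 i]
          simp_rw [lintegral_finsetSum _ fun j _ => hm2 _ j]
          rw [ENNReal.ofReal_mul (by positivity), ENNReal.ofReal_mul (by positivity),
            ENNReal.ofReal_pow hR2', ENNReal.ofReal_pow (p := (n : ℝ)) (by positivity),
            ENNReal.ofReal_natCast]
          simp only [hJ]
          ring
  have hJint : ∫⁻ x in Ω, J x ≤ ENNReal.ofReal δ * ∑ i, ∑ j, l2Sq Ω (h i j) := by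
    have hm4 : ∀ i j, Measurable fun x => ∫⁻ σ in Set.Ioc 0 δ, ‖h i j (x + σ • z)‖ₑ ^ 2 :=
      fun i j => ((hm i j).pow_const 2).lintegral_prod_right'
    rw [hJ, lintegral_finsetSum _ fun i _ => Finset.measurable_fun_sum _ fun j _ => hm4 i j]
    simp_rw [lintegral_finsetSum _ fun j _ => hm4 _ j]
    rw [Finset.mul_sum]
    gcongr with i
    rw [Finset.mul_sum]
    gcongr with j
    rw [lintegral_lintegral_swap ((hm i j).pow_const 2).aemeasurable]
    calc _ ≤ ∫⁻ σ in Set.Ioc 0 δ, l2Sq Ω (h i j) := by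
          refine lintegral_mono_ae ?_
          filter_upwards [ae_restrict_mem measurableSet_Ioc] with σ hσ
          exact lintegral_add_le (fun x => ‖h i j x‖ₑ ^ 2)
            fun x hx => hΩ.add_mem x hx σ hσ.1.le z hz
      _ = _ := by
          rw [lintegral_const, Measure.restrict_apply_univ, Real.volume_Ioc, sub_zero, mul_comm]
  have hpt : ∀ x ∈ Ω, ENNReal.ofReal (δ ^ 2) * ‖fderiv ℝ w x z‖ₑ ^ 2 ≤
      3 * (‖w (x + δ • z)‖ₑ ^ 2 + ‖w x‖ₑ ^ 2) +
        ENNReal.ofReal (3 * R2 ^ 2 * n ^ 2 * δ ^ 3) * J x := by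
    intro x hx
    have h1 := HasGradOn.smul_enorm_fderiv_le hΩ hw hg hh hx hz hδ.le
    calc _ = (ENNReal.ofReal δ * ‖fderiv ℝ w x z‖ₑ) ^ 2 := by
          rw [mul_pow, ENNReal.ofReal_pow hδ.le]
      _ ≤ (‖w (x + δ • z)‖ₑ + ‖w x‖ₑ + ENNReal.ofReal δ * I x) ^ 2 := by gcongr
      _ ≤ 3 * (‖w (x + δ • z)‖ₑ ^ 2 + ‖w x‖ₑ ^ 2 + (ENNReal.ofReal δ * I x) ^ 2) :=
          add_add_sq_le_three_mul _ _ _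
      _ ≤ 3 * (‖w (x + δ • z)‖ₑ ^ 2 + ‖w x‖ₑ ^ 2 +
            ENNReal.ofReal δ ^ 2 * (ENNReal.ofReal (R2 ^ 2 * n ^ 2 * δ) * J x)) := by
          rw [mul_pow]
          gcongr
          exact hIJ x
      _ = _ := by
          rw [mul_add 3 _ (_ * _)]
          congr 1
          rw [← mul_assoc, ← mul_assoc, ← ENNReal.ofReal_pow hδ.le,
            ← ENNReal.ofReal_ofNat, ← ENNReal.ofReal_mul (by positivity),
            ← ENNReal.ofReal_mul (by positivity)]
          congr 2; ring
  have hJm : Measurable J := Finset.measurable_fun_sum _ fun i _ => Finset.measurable_fun_sum _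
    fun j _ => ((hm i j).pow_const 2).lintegral_prod_right'
  have hw2 : Measurable fun x => ‖w (x + δ • z)‖ₑ ^ 2 :=
    (hwm.comp_measurable (by fun_prop)).enorm.pow_const 2
  calc _ ≤ ∫⁻ x in Ω, (3 * (‖w (x + δ • z)‖ₑ ^ 2 + ‖w x‖ₑ ^ 2) +
        ENNReal.ofReal (3 * R2 ^ 2 * n ^ 2 * δ ^ 3) * J x) := by
        rw [← lintegral_const_mul' _ _ ENNReal.ofReal_ne_top]
        refine lintegral_mono_ae ?_
        filter_upwards [ae_restrict_mem hΩ.measurableSet] with x hx using hpt x hx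
    _ = 3 * ((∫⁻ x in Ω, ‖w (x + δ • z)‖ₑ ^ 2) + l2Sq Ω w) +
        ENNReal.ofReal (3 * R2 ^ 2 * n ^ 2 * δ ^ 3) * ∫⁻ x in Ω, J x := by
        rw [lintegral_add_right _ (hJm.const_mul _), lintegral_const_mul' _ _ (by simp),
          lintegral_add_left hw2, lintegral_const_mul' _ _ (by simp), l2Sq]
    _ ≤ 3 * (l2Sq Ω w + l2Sq Ω w) + ENNReal.ofReal (3 * R2 ^ 2 * n ^ 2 * δ ^ 3) *
          (ENNReal.ofReal δ * ∑ i, ∑ j, l2Sq Ω (h i j)) := by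
        gcongr
        exact lintegral_add_le (fun x => ‖w x‖ₑ ^ 2) fun x hx => hΩ.add_mem x hx δ hδ.le z hz
    _ = _ := by
        rw [← mul_assoc (ENNReal.ofReal _), ← ENNReal.ofReal_mul (by positivity)]
        congr 1
        · ring
        · congr 2; ring

/-- The Taylor expansion controls derivatives only in directions of the cone; each coordinate
direction is a multiple of the difference of two such directions. -/
theorem HasGradOn.exists_l2Sq_le :
    ∃ C : ℝ, 0 < C ∧ ∀ (w : E n → V) (g : Fin n → E n → V) (h : Fin n → Fin n → E n → V),
      HasGradOn Ω w g → (∀ i, HasGradOn Ω (g i) (h i)) → (∀ i j, StronglyMeasurable (h i j)) →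
      ∀ δ : ℝ, 0 < δ → ∀ i, ENNReal.ofReal (δ ^ 2) * l2Sq Ω (g i) ≤
        ENNReal.ofReal C * (l2Sq Ω w + ENNReal.ofReal (δ ^ 4) * ∑ i, ∑ j, l2Sq Ω (h i j)) := by
  have hρ := hΩ.pos
  set K : ℝ := 3 * ((‖c‖ + ρ) ^ 2) ^ 2 * n ^ 2 with hK
  have hK0 : 0 ≤ K := by positivity
  refine ⟨(2 / ρ) ^ 2 * (2 * (2 * (6 + K))), by positivity, fun w g h hw hg hh δ hδ i => ?_⟩
  -- Both `c` and `c + (ρ/2)eᵢ` lie in `B(c, ρ)`, whence `eᵢ = (2/ρ)(c' - c)`.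
  set c' : E n := c + (ρ / 2) • dirE n i with hc'
  have hc : c ∈ Metric.ball c ρ := Metric.mem_ball_self hρ
  have hcm : c' ∈ Metric.ball c ρ := by
    rw [Metric.mem_ball, dist_eq_norm, hc', add_sub_cancel_left, norm_smul, dirE,
      PiLp.norm_single, Real.norm_of_nonneg (by positivity)]
    simp only [norm_one, mul_one]; linarith
  have hpt : ∀ x ∈ Ω, ‖g i x‖ₑ ^ 2 ≤ ENNReal.ofReal ((2 / ρ) ^ 2) *
      (2 * (‖fderiv ℝ w x c'‖ₑ ^ 2 + ‖fderiv ℝ w x c‖ₑ ^ 2)) := by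
    intro x hx
    have e : g i x = (2 / ρ) • (fderiv ℝ w x c' - fderiv ℝ w x c) := by
      rw [← hw.2 x hx i, hc', map_add, add_sub_cancel_left, map_smul, smul_smul]
      have : 2 / ρ * (ρ / 2) = 1 := by field_simp
      rw [this, one_smul]
    rw [e, enorm_smul, mul_pow, Real.enorm_of_nonneg (by positivity), ENNReal.ofReal_pow
      (by positivity)]
    gcongr
    refine le_trans ?_ (add_sq_le_two_mul _ _)
    gcongr
    exact _root_.enorm_sub_le
  have hfm : ∀ z : E n, Measurable fun x => ‖fderiv ℝ w x z‖ₑ ^ 2 := by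
    intro z
    have : Continuous fun x => fderiv ℝ w x z := by
      have := hw.1.continuous_fderiv (by norm_num)
      fun_prop
    exact this.stronglyMeasurable.enorm.pow_const 2
  set X := l2Sq Ω w + ENNReal.ofReal (δ ^ 4) * ∑ i, ∑ j, l2Sq Ω (h i j) with hX
  have hz : ∀ z ∈ Metric.ball c ρ, ENNReal.ofReal (δ ^ 2) * ∫⁻ x in Ω, ‖fderiv ℝ w x z‖ₑ ^ 2 ≤
      ENNReal.ofReal (6 + K) * X := by
    intro z hz
    refine (HasGradOn.lintegral_fderiv_sq_le hΩ hw hg hh hz hδ).trans ?_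
    rw [hX, mul_add, ← mul_assoc, ← ENNReal.ofReal_mul (by positivity)]
    gcongr
    · rw [← ENNReal.ofReal_ofNat]
      gcongr; linarith
    · linarith
  calc ENNReal.ofReal (δ ^ 2) * l2Sq Ω (g i)
      ≤ ENNReal.ofReal (δ ^ 2) * ∫⁻ x in Ω, ENNReal.ofReal ((2 / ρ) ^ 2) *
      (2 * (‖fderiv ℝ w x c'‖ₑ ^ 2 + ‖fderiv ℝ w x c‖ₑ ^ 2)) := by
        gcongr
        refine lintegral_mono_ae ?_
        filter_upwards [ae_restrict_mem hΩ.measurableSet] with x hx using hpt x hx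
    _ = ENNReal.ofReal ((2 / ρ) ^ 2) * (2 * (
          ENNReal.ofReal (δ ^ 2) * (∫⁻ x in Ω, ‖fderiv ℝ w x c'‖ₑ ^ 2) +
          ENNReal.ofReal (δ ^ 2) * ∫⁻ x in Ω, ‖fderiv ℝ w x c‖ₑ ^ 2)) := by
        rw [lintegral_const_mul' _ _ (by simp), lintegral_const_mul' _ _ (by simp),
          lintegral_add_left (hfm c')]
        ring
    _ ≤ ENNReal.ofReal ((2 / ρ) ^ 2) * (2 * (ENNReal.ofReal (6 + K) * X +
          ENNReal.ofReal (6 + K) * X)) := by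
        have h1 := hz _ hcm
        have h2 := hz _ hc
        have h3 := add_le_add h1 h2
        exact mul_le_mul_right (mul_le_mul_right h3 _) _
    _ = _ := by
        rw [ENNReal.ofReal_mul (by positivity), ENNReal.ofReal_mul (by positivity),
          ENNReal.ofReal_mul (by positivity), ENNReal.ofReal_ofNat]
        ring

/-- Interpolation of the first derivatives between the function and its second derivatives. -/
theorem exists_l2Sq_deriv_le :
    ∃ C : ℝ, 0 < C ∧ ∀ (u : E n → V) (v : Fin n → E n → V) (w : Fin n → Fin n → E n → V),
      StronglyMeasurable u → (∀ i j, StronglyMeasurable (w i j)) →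
      LocallyIntegrable u → (∀ i, LocallyIntegrable (v i)) → (∀ i j, LocallyIntegrable (w i j)) →
      (∀ i, hΩ.IsMollDeriv (dirE n i) u (v i)) →
      (∀ i j, hΩ.IsMollDeriv (dirE n j) (v i) (w i j)) →
      ∀ δ : ℝ, 0 < δ → ∀ i, ENNReal.ofReal (δ ^ 2) * l2Sq Ω (v i) ≤
        ENNReal.ofReal C * (l2Sq Ω u + ENNReal.ofReal (δ ^ 4) * ∑ i, ∑ j, l2Sq Ω (w i j)) := by
  obtain ⟨C, hC, H⟩ := HasGradOn.exists_l2Sq_le hΩ (V := V)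
  refine ⟨C, hC, fun u v w hum hwm hu hv hw h h' δ hδ i => ?_⟩
  have hd : ENNReal.ofReal (δ ^ 2) ≠ 0 := by simp [hδ.ne']
  have hb : ∀ k, l2Sq Ω (hΩ.moll k (v i)) ≤ (ENNReal.ofReal (δ ^ 2))⁻¹ *
      (ENNReal.ofReal C * (l2Sq Ω u + ENNReal.ofReal (δ ^ 4) * ∑ i, ∑ j, l2Sq Ω (w i j))) := by
    intro k
    refine le_inv_mul_of_mul_le hd ENNReal.ofReal_ne_top ?_
    refine (H _ _ (fun i j => hΩ.moll k (w i j)) (HasGradOn.moll hΩ hu h k)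
      (fun i => HasGradOn.moll hΩ (hv i) (h' i) k)
      (fun i j => hΩ.stronglyMeasurable_moll (hw i j) k) δ hδ i).trans ?_
    gcongr with i _ j
    · exact hΩ.l2Sq_moll_le hum k
    · exact hΩ.l2Sq_moll_le (hwm i j) k
  -- The bound is uniform in the mollification parameter, so Fatou's lemma transfers it to the weak
  -- derivative.
  have := l2Sq_le_liminf (fun k => hΩ.stronglyMeasurable_moll (hv i) k)
    ((hΩ.ae_restrict_tendsto_moll (hv i)).mono fun x hx => hx.2) hb
  refine (mul_le_mul_right this _).trans (le_of_eq ?_)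
  rw [← mul_assoc, ENNReal.mul_inv_cancel hd ENNReal.ofReal_ne_top, one_mul]

end ConeDomain

/-! ### Increments of a function as integrals of its weak derivative -/

section Translates

variable {X : Type} [NormedAddCommGroup X] [NormedSpace ℝ X]

/-- The average of `φ` over the segment from `z - w` to `z`. -/
def segAvg {F : Type} [NormedAddCommGroup F] [NormedSpace ℝ F] (φ : X → F) (w z : X) : F :=
  ∫ σ in (0 : ℝ)..1, φ (z - σ • w)

theorem hasFDerivAt_segAvg {F : Type} [NormedAddCommGroup F] [NormedSpace ℝ F] {φ : X → F}
    (hφ : ContDiff ℝ 1 φ) (hc : HasCompactSupport φ) (w z : X) :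
    HasFDerivAt (segAvg φ w) (segAvg (fderiv ℝ φ) w z) z := by
  have hcd : Continuous (fderiv ℝ φ) := hφ.continuous_fderiv (by norm_num)
  obtain ⟨C, hC⟩ := hcd.bounded_above_of_compact_support (hc.fderiv (𝕜 := ℝ))
  have hφc := hφ.continuous
  refine intervalIntegral.hasFDerivAt_integral_of_dominated_of_fderiv_le (bound := fun _ => C)
    (F' := fun z σ => fderiv ℝ φ (z - σ • w)) (s := Set.univ) Filter.univ_mem ?_ ?_ ?_ ?_ ?_ ?_
  · refine Eventually.of_forall fun x => ?_
    have : Continuous fun t : ℝ => φ (x - t • w) := by fun_prop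
    exact this.stronglyMeasurable.aestronglyMeasurable
  · exact Continuous.intervalIntegrable (by fun_prop) _ _
  · have : Continuous fun t : ℝ => fderiv ℝ φ (z - t • w) := by fun_prop
    exact this.stronglyMeasurable.aestronglyMeasurable
  · exact ae_of_all _ fun t _ x _ => hC _
  · exact intervalIntegrable_const
  · refine ae_of_all _ fun t _ x _ => ?_
    have h1 := (hφ.differentiable (by norm_num) (x - t • w)).hasFDerivAt
    exact (hasFDerivAt_comp_sub (t • w)).2 h1

/-- Differentiation commutes with averaging, so the induction passes from `φ` to `fderiv ℝ φ`. The
target space changes at each step, and for this reason it is quantified inside the statement. -/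
theorem contDiff_segAvg (m : ℕ) : ∀ {F : Type} [NormedAddCommGroup F] [NormedSpace ℝ F]
    {φ : X → F}, ContDiff ℝ ∞ φ → HasCompactSupport φ → ∀ w, ContDiff ℝ m (segAvg φ w) := by
  induction m with
  | zero =>
    intro F _ _ φ hφ hc w
    have : Differentiable ℝ (segAvg φ w) := fun z =>
      (hasFDerivAt_segAvg (hφ.of_le (by norm_num)) hc w z).differentiableAt
    exact contDiff_zero.2 this.continuous
  | succ m ih =>
    intro F _ _ φ hφ hc w
    have h := hasFDerivAt_segAvg (hφ.of_le (by norm_num)) hc w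
    push_cast
    rw [contDiff_succ_iff_fderiv]
    refine ⟨fun z => (h z).differentiableAt, by simp, ?_⟩
    have e : fderiv ℝ (segAvg φ w) = segAvg (fderiv ℝ φ) w := by
      ext1 z; exact (h z).fderiv
    rw [e]
    exact ih (hφ.fderiv_right (by norm_num)) (hc.fderiv (𝕜 := ℝ)) w

/-- The integrand is the derivative of `σ ↦ -φ(z - σw)`. Testing a weak derivative with `segAvg φ w`
thus produces a finite difference of `u`. -/
theorem fderiv_segAvg_apply {φ : X → ℝ} (hφ : ContDiff ℝ ∞ φ) (hc : HasCompactSupport φ)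
    (w z : X) : fderiv ℝ (segAvg φ w) z w = φ z - φ (z - w) := by
  rw [(hasFDerivAt_segAvg (hφ.of_le (by norm_num)) hc w z).fderiv]
  have hcd : Continuous (fderiv ℝ φ) := hφ.continuous_fderiv (by norm_num)
  have hci : Continuous fun σ : ℝ => fderiv ℝ φ (z - σ • w) := by fun_prop
  rw [segAvg]
  have e1 := ContinuousLinearMap.intervalIntegral_comp_comm (ContinuousLinearMap.apply ℝ ℝ w)
    (hci.intervalIntegrable (μ := volume) 0 1)
  simp only [ContinuousLinearMap.apply_apply] at e1
  rw [← e1]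
  have hd : ∀ σ : ℝ, HasDerivAt (fun σ : ℝ => -φ (z - σ • w)) (fderiv ℝ φ (z - σ • w) w) σ := by
    intro σ
    have h1 : HasDerivAt (fun σ : ℝ => z - σ • w) (-w) σ := by
      simpa using ((hasDerivAt_id σ).smul_const w).const_sub z
    have h2 := ((hφ.differentiable (by norm_num) (z - σ • w)).hasFDerivAt.comp_hasDerivAt σ h1).neg
    rw [map_neg, neg_neg] at h2
    exact h2
  rw [intervalIntegral.integral_eq_sub_of_hasDerivAt (fun σ _ => hd σ)
    (Continuous.intervalIntegrable (by fun_prop) _ _)]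
  simp
  ring

theorem support_segAvg_subset (φ : X → ℝ) (w : X) : Function.support (segAvg φ w) ⊆
    Set.image (fun p : ℝ × X => p.2 + p.1 • w) (Set.Icc 0 1 ×ˢ tsupport φ) := by
  intro z hz
  by_contra h
  apply hz
  rw [segAvg]
  refine (intervalIntegral.integral_congr (g := fun _ => (0 : ℝ)) fun σ hσ => ?_).trans (by simp)
  rw [Set.uIcc_of_le zero_le_one] at hσ
  refine image_eq_zero_of_notMem_tsupport fun h' => h ⟨(σ, z - σ • w), ⟨hσ, h'⟩, by simp⟩

theorem isCompact_image_segAvg {φ : X → ℝ} (hc : HasCompactSupport φ) (w : X) :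
    IsCompact (Set.image (fun p : ℝ × X => p.2 + p.1 • w) (Set.Icc 0 1 ×ˢ tsupport φ)) :=
  (isCompact_Icc.prod hc).image (by fun_prop)

variable [MeasureSpace X] [BorelSpace X] [FiniteDimensional ℝ X]
  [(volume : Measure X).IsAddHaarMeasure] [SFinite (volume : Measure X)]
  {V : Type*} [NormedAddCommGroup V] [NormedSpace ℝ V]

/-- Only values of `v` on the compact set swept out by translating the support of `φ` along the
segment enter. This justifies exchanging the integral along the segment with the one over space. -/
theorem integrable_smul_comp_add {v : X → V} (hv : LocallyIntegrable v) (hvm : StronglyMeasurable v)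
    {φ : X → ℝ} (hφ : Continuous φ) (hc : HasCompactSupport φ) (w : X) :
    Integrable (fun p : X × ℝ => φ p.1 • v (p.1 + p.2 • w))
      (volume.prod (volume.restrict (Set.Ioc 0 1))) := by
  have hm : StronglyMeasurable (fun p : X × ℝ => φ p.1 • v (p.1 + p.2 • w)) :=
    (hφ.stronglyMeasurable.comp_measurable measurable_fst).smul
      (hvm.comp_measurable (by fun_prop))
  refine ⟨hm.aestronglyMeasurable, ?_⟩
  obtain ⟨C, hC⟩ := hφ.bounded_above_of_compact_support hc
  set K := Set.image (fun p : ℝ × X => p.2 + p.1 • w) (Set.Icc 0 1 ×ˢ tsupport φ) with hK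
  have hKc : IsCompact K := isCompact_image_segAvg hc w
  have hfin : ∫⁻ x in K, ‖v x‖ₑ < ⊤ := (hv.integrableOn_isCompact hKc).2
  rw [HasFiniteIntegral, lintegral_prod_symm _ hm.enorm.aemeasurable]
  calc _ ≤ ∫⁻ _ in Set.Ioc (0 : ℝ) 1, ENNReal.ofReal C * ∫⁻ x in K, ‖v x‖ₑ := by
        refine lintegral_mono_ae ?_
        filter_upwards [ae_restrict_mem measurableSet_Ioc] with σ hσ
        have hpt : ∀ x, ‖φ x • v (x + σ • w)‖ₑ ≤
            ENNReal.ofReal C * (K.indicator (fun y => ‖v y‖ₑ) (x + σ • w)) := by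
          intro x
          by_cases hx : x ∈ tsupport φ
          · rw [Set.indicator_of_mem (hK ▸ ⟨(σ, x), ⟨⟨hσ.1.le, hσ.2⟩, hx⟩, rfl⟩), enorm_smul]
            gcongr
            rw [← ofReal_norm]
            exact ENNReal.ofReal_le_ofReal (hC x)
          · simp [image_eq_zero_of_notMem_tsupport hx]
        calc _ ≤ ∫⁻ x, ENNReal.ofReal C * (K.indicator (fun y => ‖v y‖ₑ) (x + σ • w)) :=
              lintegral_mono hpt
          _ = _ := by
            rw [lintegral_const_mul' _ _ ENNReal.ofReal_ne_top,
              lintegral_add_right_eq_self (K.indicator fun y => ‖v y‖ₑ) (σ • w),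
              lintegral_indicator hKc.measurableSet]
    _ < ⊤ := by
        simp only [lintegral_const, Measure.restrict_apply_univ, Real.volume_Ioc]
        exact ENNReal.mul_lt_top (ENNReal.mul_lt_top (by simp) hfin) (by simp)

omit [NormedSpace ℝ X] [FiniteDimensional ℝ X] [SFinite (volume : Measure X)]
  [NormedSpace ℝ V] in
theorem locallyIntegrable_comp_add {u : X → V} (hu : LocallyIntegrable u) (w : X) :
    LocallyIntegrable fun z => u (z + w) := by
  intro z
  obtain ⟨s, hs, hs'⟩ := hu (z + w)
  refine ⟨(fun z => z + w) ⁻¹' s, (continuous_add_const w).continuousAt.preimage_mem_nhds hs, ?_⟩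
  exact ((measurePreserving_add_right (volume : Measure X) w).integrableOn_comp_preimage
    (Homeomorph.addRight w).measurableEmbedding).2 hs'

/-- Averaging the test function backwards along `w` is adjoint to averaging `v` forwards, by Fubini
and translation invariance. -/
theorem integral_smul_segAvg {v : X → V} (hv : LocallyIntegrable v) (hvm : StronglyMeasurable v)
    [CompleteSpace V] {φ : X → ℝ} (hφ : Continuous φ) (hc : HasCompactSupport φ) (w : X) :
    ∫ z, segAvg φ w z • v z = ∫ z, φ z • ∫ σ in (0 : ℝ)..1, v (z + σ • w) := by
  have hI := integrable_smul_comp_add hv hvm hφ hc w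
  have hI' := integrable_smul_comp_add hv hvm hφ hc w
  have e1 : ∫ z, φ z • ∫ σ in (0 : ℝ)..1, v (z + σ • w) =
      ∫ σ in Set.Ioc (0 : ℝ) 1, ∫ z, φ z • v (z + σ • w) := by
    rw [← integral_integral_swap hI]
    refine integral_congr_ae (ae_of_all _ fun z => ?_)
    simp only [intervalIntegral.integral_of_le zero_le_one]
    rw [integral_smul]
  have e2 : ∀ σ : ℝ, ∫ z, φ z • v (z + σ • w) = ∫ z, φ (z - σ • w) • v z := by
    intro σ
    rw [← integral_add_right_eq_self (fun z => φ (z - σ • w) • v z) (σ • w)]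
    simp
  rw [e1]
  simp_rw [e2]
  have hI2 : Integrable (fun p : X × ℝ => φ (p.1 - p.2 • w) • v p.1)
      (volume.prod (volume.restrict (Set.Ioc 0 1))) := by
    have hmp : MeasurePreserving (fun p : X × ℝ => (p.1 - p.2 • w, p.2))
        (volume.prod (volume.restrict (Set.Ioc 0 1)))
        (volume.prod (volume.restrict (Set.Ioc 0 1))) := by
      have h1 : MeasurePreserving (fun p : ℝ × X => (p.1, p.2 - p.1 • w))
          ((volume.restrict (Set.Ioc 0 1)).prod volume)
          ((volume.restrict (Set.Ioc 0 1)).prod volume) :=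
        (MeasurePreserving.id _).skew_product (g := fun s x => x - s • w) (by
          simp only [Function.uncurry_def]; fun_prop)
          (ae_of_all _ fun s => (measurePreserving_sub_right volume (s • w)).map_eq)
      exact (Measure.measurePreserving_swap.comp h1).comp Measure.measurePreserving_swap
    have := hmp.integrable_comp_of_integrable hI
    simpa [Function.comp_def] using this
  rw [← integral_integral_swap hI2]
  refine integral_congr_ae (ae_of_all _ fun z => ?_)
  simp only [segAvg]
  rw [intervalIntegral.integral_of_le zero_le_one, integral_smul_const]

/-- The fundamental theorem of calculus for weak derivatives, along almost every segment. -/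
theorem HasWeakDeriv.ae_sub_eq [CompleteSpace V] {U : Set X} (hU : IsOpen U) {e : X} {u v : X → V}
    (h : HasWeakDeriv U e u v) (hu : LocallyIntegrable u) (hv : LocallyIntegrable v)
    (hvm : StronglyMeasurable v) (r : ℝ) :
    ∀ᵐ z, (∀ σ ∈ Set.Icc (0 : ℝ) 1, z + σ • (r • e) ∈ U) →
      u (z + r • e) - u z = r • ∫ σ in (0 : ℝ)..1, v (z + σ • (r • e)) := by
  set w := r • e with hw
  set W : Set X := {z | ∀ σ ∈ Set.Icc (0 : ℝ) 1, z + σ • w ∈ U} with hW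
  -- Openness of the set of starting points of admissible segments, from the tube lemma, is what
  -- allows testing on `W`.
  have hWo : IsOpen W := by
    have h1 : W = {z | ∀ σ ∈ Set.Icc (0 : ℝ) 1, (z, σ) ∈ (fun p : X × ℝ => p.1 + p.2 • w) ⁻¹' U} :=
      rfl
    rw [h1, isOpen_iff_mem_nhds]
    intro z hz
    have hO : IsOpen ((fun p : X × ℝ => p.1 + p.2 • w) ⁻¹' U) := hU.preimage (by fun_prop)
    obtain ⟨A, B, hA, hB, hzA, hB', hAB⟩ := generalized_tube_lemma (s := {z})
      (t := Set.Icc (0 : ℝ) 1) isCompact_singleton isCompact_Icc hO (by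
        rintro ⟨a, b⟩ ⟨ha, hb⟩
        rw [Set.mem_singleton_iff] at ha
        subst ha
        exact hz b hb)
    refine mem_of_superset (hA.mem_nhds (hzA rfl)) fun a ha σ hσ => hAB ⟨ha, hB' hσ⟩
  set f : X → V := fun z => (u z - u (z + w)) + r • ∫ σ in (0 : ℝ)..1, v (z + σ • w) with hf
  have hint : ∀ φ : X → ℝ, Continuous φ → HasCompactSupport φ →
      Integrable fun z => φ z • ∫ σ in (0 : ℝ)..1, v (z + σ • w) := by
    intro φ hφ hc
    have := (integrable_smul_comp_add hv hvm hφ hc w).integral_prod_left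
    refine this.congr (ae_of_all _ fun z => ?_)
    simp only [intervalIntegral.integral_of_le zero_le_one]
    rw [integral_smul]
  have hloc : LocallyIntegrable fun z => ∫ σ in (0 : ℝ)..1, v (z + σ • w) := by
    intro z
    -- Integrability against test functions gives local integrability: on the unit ball about `z`
    -- this bump equals 1.
    let b : ContDiffBump z := ⟨1, 2, one_pos, one_lt_two⟩
    refine ⟨Metric.closedBall z 1, Metric.closedBall_mem_nhds z one_pos, ?_⟩
    have h1 := (hint b b.continuous b.hasCompactSupport).integrableOn (s := Metric.closedBall z 1)
    refine h1.congr_fun (fun x hx => ?_) measurableSet_closedBall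
    simp [b.one_of_mem_closedBall hx]
  have hfl : LocallyIntegrable f :=
    (hu.sub (locallyIntegrable_comp_add hu w)).add (hloc.smul r)
  -- For `φ` supported in `W` the averaged function `segAvg φ w` is supported in `U`, so it is an
  -- admissible test function; its derivative along `w` turns the weak derivative identity into `∫ φ
  -- f = 0`.
  have key : ∀ᵐ z, z ∈ W → f z = 0 := by
    refine hWo.ae_eq_zero_of_integral_contDiff_smul_eq_zero (hfl.locallyIntegrableOn W)
      fun φ hφ hc hφW => ?_
    set K := Set.image (fun p : ℝ × X => p.2 + p.1 • w) (Set.Icc 0 1 ×ˢ tsupport φ) with hK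
    have hKc : IsCompact K := isCompact_image_segAvg hc w
    have hsK : tsupport (segAvg φ w) ⊆ K :=
      closure_minimal (support_segAvg_subset φ w) hKc.isClosed
    have hKU : K ⊆ U := by
      rintro _ ⟨⟨σ, z⟩, ⟨hσ, hz⟩, rfl⟩
      exact hφW hz σ hσ
    have hψ : ContDiff ℝ ∞ (segAvg φ w) := contDiff_infty.2 fun m => contDiff_segAvg m hφ hc w
    have hψc : HasCompactSupport (segAvg φ w) := hKc.of_isClosed_subset (isClosed_tsupport _) hsK
    have h0 : ∀ z, z ∉ U → z ∉ tsupport (segAvg φ w) := fun z hz h' => hz (hKU (hsK h'))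
    have h1 := h.2.2 _ hψ hψc (hsK.trans hKU)
    rw [setIntegral_eq_integral_of_forall_compl_eq_zero,
      setIntegral_eq_integral_of_forall_compl_eq_zero] at h1
    rotate_left
    · intro z hz
      rw [image_eq_zero_of_notMem_tsupport (h0 z hz), zero_smul]
    · intro z hz
      have : fderiv ℝ (segAvg φ w) z = 0 := by
        by_contra hne
        exact h0 z hz (support_fderiv_subset ℝ hne)
      rw [this]; simp
    have h2 : ∫ z, (φ z - φ (z - w)) • u z = -(r • ∫ z, segAvg φ w z • v z) := by
      rw [← smul_neg, ← h1, ← integral_smul]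
      refine integral_congr_ae (ae_of_all _ fun z => ?_)
      simp only
      rw [← fderiv_segAvg_apply hφ hc w z, hw, map_smul, smul_assoc]
    have hφu : Integrable fun z => φ z • u z :=
      hu.integrable_smul_left_of_hasCompactSupport hφ.continuous hc
    have hφu' : Integrable fun z => φ z • u (z + w) :=
      (locallyIntegrable_comp_add hu w).integrable_smul_left_of_hasCompactSupport hφ.continuous hc
    have e3 : ∫ z, φ (z - w) • u z = ∫ z, φ z • u (z + w) := by
      rw [← integral_add_right_eq_self (fun z => φ (z - w) • u z) w]
      simp
    have hφu'' : Integrable fun z => φ (z - w) • u z := by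
      have := hφu'.comp_sub_right w
      simpa using this
    rw [integral_smul_segAvg hv hvm hφ.continuous hc w] at h2
    simp only [sub_smul] at h2
    rw [integral_sub hφu hφu'', e3] at h2
    simp only [hf, smul_add, smul_sub]
    have hsm : ∀ z, φ z • r • ∫ σ in (0 : ℝ)..1, v (z + σ • w) =
        r • (φ z • ∫ σ in (0 : ℝ)..1, v (z + σ • w)) := fun z => smul_comm _ _ _
    simp only [hsm]
    rw [integral_add (f := fun z => φ z • u z - φ z • u (z + w))
      (g := fun z => r • φ z • ∫ σ in (0 : ℝ)..1, v (z + σ • w)) (hφu.sub hφu')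
      ((hint φ hφ.continuous hc).smul r), integral_sub hφu hφu', integral_smul, h2]
    simp
  filter_upwards [key] with z hz hzW
  have := hz hzW
  simp only [hf] at this
  rw [add_eq_zero_iff_eq_neg] at this
  rw [← neg_sub, this, neg_neg]

end Translates

/-! ### Weak derivatives tested against mollifiers, and their time slices -/

namespace ConeDomain

variable {n : ℕ} {Ω : Set (E n)} {c : E n} {ρ : ℝ} (hΩ : ConeDomain Ω c ρ)
  {V : Type*} [NormedAddCommGroup V] [NormedSpace ℝ V]

theorem IsMollDeriv.congr {e : E n} {u v u' v' : E n → V} (h : hΩ.IsMollDeriv e u v)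
    (hu : u =ᵐ[volume] u') (hv : v =ᵐ[volume] v') : hΩ.IsMollDeriv e u' v' := by
  intro k x hx
  have h1 : ∫ y, fderiv ℝ (hΩ.kern k) (y - x) e • u' y =
      ∫ y, fderiv ℝ (hΩ.kern k) (y - x) e • u y :=
    integral_congr_ae (hu.mono fun y hy => by simp only [hy])
  have h2 : ∫ y, hΩ.kern k (y - x) • v' y = ∫ y, hΩ.kern k (y - x) • v y :=
    integral_congr_ae (hv.mono fun y hy => by simp only [hy])
  rw [h1, h2, h k x hx]

theorem tsupport_kern_sub_subset (k : ℕ) {x : E n} (hx : x ∈ Ω) :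
    tsupport (fun y => hΩ.kern k (y - x)) ⊆ Ω := by
  intro y hy
  have h1 : y - x ∈ tsupport (hΩ.kern k) := by
    have := tsupport_comp_subset_preimage (hΩ.kern k) (f := fun y => y - x) (by fun_prop) hy
    exact this
  have := hΩ.add_mem_of_mem_tsupport hx h1
  simpa using this

/-- For `x ∈ Ω` the translated kernel is supported in `Ω`, hence is an admissible test function;
extending by zero changes neither integral. -/
theorem _root_.MHD.HasWeakDeriv.isMollDeriv {e : E n} {u v : E n → V} (h : HasWeakDeriv Ω e u v) :
    hΩ.IsMollDeriv e (Ω.indicator u) (Ω.indicator v) := by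
  intro k x hx
  have hc : ContDiff ℝ ∞ (fun y => hΩ.kern k (y - x)) :=
    (hΩ.contDiff_kern k).comp (contDiff_id.sub contDiff_const)
  have h1 := h.2.2 _ hc ((hΩ.hasCompactSupport_kern k).comp_homeomorph (Homeomorph.subRight x))
    (hΩ.tsupport_kern_sub_subset k hx)
  rw [← integral_indicator hΩ.measurableSet, ← integral_indicator hΩ.measurableSet] at h1
  have e1 : ∀ (f : E n → ℝ) (g : E n → V) y, Ω.indicator (fun y => f y • g y) y =
      f y • Ω.indicator g y := fun f g y => by
    by_cases hy : y ∈ Ω <;> simp [hy]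
  simp only [e1, fderiv_comp_sub] at h1
  exact h1

end ConeDomain

section Slices

variable {Ω : Set (E 3)} {c : E 3} {ρ : ℝ} (hΩ : ConeDomain Ω c ρ)
  {V : Type*} [NormedAddCommGroup V] [NormedSpace ℝ V]

/-- A cut-off in `x` alone is enough: `u` vanishes for times outside `(0, T)`, so a time cut-off
equal to 1 there can be inserted freely. -/
theorem integrable_comp_snd_smul {T : ℝ} {u : ℝ × E 3 → V} (hu : LocallyIntegrable u)
    (hu0 : ∀ p ∉ cyl Ω T, u p = 0) {a : E 3 → ℝ} (ha : Continuous a) (hac : HasCompactSupport a) :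
    Integrable fun p => a p.2 • u p := by
  let b : ContDiffBump (0 : ℝ) := ⟨|T| + 1, |T| + 2, by positivity, by linarith⟩
  have h1 : Integrable fun p : ℝ × E 3 => (b p.1 * a p.2) • u p := by
    refine hu.integrable_smul_left_of_hasCompactSupport ?_ ?_
    · exact (b.continuous.comp continuous_fst).mul (ha.comp continuous_snd)
    · refine HasCompactSupport.of_support_subset_isCompact (b.hasCompactSupport.prod hac) ?_
      intro p hp
      rw [Function.mem_support] at hp
      exact ⟨subset_tsupport _ (left_ne_zero_of_mul hp),
        subset_tsupport _ (right_ne_zero_of_mul hp)⟩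
  refine h1.congr (ae_of_all _ fun p => ?_)
  by_cases hp : p ∈ cyl Ω T
  · have : b p.1 = 1 := by
      refine b.one_of_mem_closedBall ?_
      have h2 := hp.1
      rw [Set.mem_Ioo] at h2
      rw [mem_closedBall_zero_iff, Real.norm_eq_abs, abs_of_pos h2.1]
      have := le_abs_self T
      simp only [b]; linarith
    simp [this]
  · simp [hu0 p hp]

/-- Testing with products `η(t) a(x)` and varying `η` forces the slice identity for almost every
`t`. The exceptional null set still depends on `a`. -/
theorem HasWeakDeriv.ae_slice_eq [CompleteSpace V] {T : ℝ} {u v : ℝ × E 3 → V} {i : Fin 3}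
    (h : HasWeakDeriv (cyl Ω T) (dirX i) u v)
    (hu : LocallyIntegrable u) (hv : LocallyIntegrable v)
    (hu0 : ∀ p ∉ cyl Ω T, u p = 0) (hv0 : ∀ p ∉ cyl Ω T, v p = 0) {a : E 3 → ℝ}
    (ha : ContDiff ℝ ∞ a) (hac : HasCompactSupport a) (haΩ : tsupport a ⊆ Ω) :
    ∀ᵐ t ∂volume.restrict (Set.Ioo 0 T),
      ∫ y, fderiv ℝ a y (dirE 3 i) • u (t, y) = -∫ y, a y • v (t, y) := by
  have had : Continuous fun y => fderiv ℝ a y (dirE 3 i) := by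
    have := ha.continuous_fderiv (by norm_num)
    fun_prop
  have hI1 := integrable_comp_snd_smul hu hu0 had (hac.fderiv_apply (𝕜 := ℝ) _)
  have hI2 := integrable_comp_snd_smul hv hv0 ha.continuous hac
  set H : ℝ → V := fun t => (∫ y, fderiv ℝ a y (dirE 3 i) • u (t, y)) + ∫ y, a y • v (t, y) with hH
  have hHi : Integrable H := hI1.integral_prod_left.add hI2.integral_prod_left
  have key : ∀ᵐ t, t ∈ Set.Ioo 0 T → H t = 0 := by
    refine isOpen_Ioo.ae_eq_zero_of_integral_contDiff_smul_eq_zero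
      (hHi.locallyIntegrable.locallyIntegrableOn _) fun η hη hηc hηT => ?_
    set ψ : ℝ × E 3 → ℝ := fun p => η p.1 * a p.2 with hψ
    have hψs : tsupport ψ ⊆ tsupport η ×ˢ tsupport a := by
      refine closure_minimal ?_ ((isClosed_tsupport _).prod (isClosed_tsupport _))
      intro p hp
      rw [Function.mem_support] at hp
      exact ⟨subset_tsupport _ (left_ne_zero_of_mul hp),
        subset_tsupport _ (right_ne_zero_of_mul hp)⟩
    have hψd : ∀ p, fderiv ℝ ψ p (dirX i) = η p.1 * fderiv ℝ a p.2 (dirE 3 i) := by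
      intro p
      have h1 : HasFDerivAt (fun p : ℝ × E 3 => η p.1)
          ((fderiv ℝ η p.1).comp (ContinuousLinearMap.fst ℝ ℝ (E 3))) p :=
        (hη.differentiable (by norm_num) p.1).hasFDerivAt.comp p hasFDerivAt_fst
      have h2 : HasFDerivAt (fun p : ℝ × E 3 => a p.2)
          ((fderiv ℝ a p.2).comp (ContinuousLinearMap.snd ℝ ℝ (E 3))) p :=
        (ha.differentiable (by norm_num) p.2).hasFDerivAt.comp p hasFDerivAt_snd
      have h3 : HasFDerivAt ψ _ p := h1.mul h2
      rw [h3.fderiv]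
      simp [dirX, dirE]
    have h1 := h.2.2 ψ ((hη.comp contDiff_fst).mul (ha.comp contDiff_snd))
      (HasCompactSupport.of_support_subset_isCompact (hηc.prod hac)
        ((subset_tsupport _).trans hψs))
      (hψs.trans (Set.prod_mono hηT haΩ))
    rw [setIntegral_eq_integral_of_forall_compl_eq_zero (fun p hp => by rw [hu0 p hp, smul_zero]),
      setIntegral_eq_integral_of_forall_compl_eq_zero (fun p hp => by rw [hv0 p hp, smul_zero])]
      at h1
    have hb : ∃ C, ∀ t, ‖η t‖ ≤ C := hη.continuous.bounded_above_of_compact_support hηc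
    obtain ⟨C, hC⟩ := hb
    have hJ1 : Integrable fun p : ℝ × E 3 => η p.1 • (fderiv ℝ a p.2 (dirE 3 i) • u p) :=
      hI1.bdd_smul C (hη.continuous.comp continuous_fst).aestronglyMeasurable
        (ae_of_all _ fun p => hC p.1)
    have hJ2 : Integrable fun p : ℝ × E 3 => η p.1 • (a p.2 • v p) :=
      hI2.bdd_smul C (hη.continuous.comp continuous_fst).aestronglyMeasurable
        (ae_of_all _ fun p => hC p.1)
    have e1 : ∫ p, fderiv ℝ ψ p (dirX i) • u p =
        ∫ t, η t • ∫ y, fderiv ℝ a y (dirE 3 i) • u (t, y) := by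
      simp_rw [← integral_smul]
      rw [Measure.volume_eq_prod, ← integral_prod _ hJ1]
      refine integral_congr_ae (ae_of_all _ fun p => ?_)
      simp only [hψd, mul_smul]
    have e2 : ∫ p, ψ p • v p = ∫ t, η t • ∫ y, a y • v (t, y) := by
      simp_rw [← integral_smul]
      rw [Measure.volume_eq_prod, ← integral_prod _ hJ2]
      refine integral_congr_ae (ae_of_all _ fun p => ?_)
      simp only [hψ, mul_smul]
    rw [e1, e2] at h1
    have hK1 : Integrable fun t => η t • ∫ y, fderiv ℝ a y (dirE 3 i) • u (t, y) :=
      hI1.integral_prod_left.bdd_smul C hη.continuous.aestronglyMeasurable (ae_of_all _ hC)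
    have hK2 : Integrable fun t => η t • ∫ y, a y • v (t, y) :=
      hI2.integral_prod_left.bdd_smul C hη.continuous.aestronglyMeasurable (ae_of_all _ hC)
    simp only [hH, smul_add]
    rw [integral_add hK1 hK2, h1, neg_add_cancel]
  rw [ae_restrict_iff' measurableSet_Ioo]
  filter_upwards [key] with t ht hT
  exact eq_neg_of_add_eq_zero_left (ht hT)

/-- Weak derivatives on the space-time cylinder restrict to almost every time slice. -/
theorem HasWeakDeriv.ae_isMollDeriv [CompleteSpace V] {T : ℝ} {u v : ℝ × E 3 → V} {i : Fin 3}
    (h : HasWeakDeriv (cyl Ω T) (dirX i) u v)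
    (hu : LocallyIntegrable u) (hv : LocallyIntegrable v)
    (hu0 : ∀ p ∉ cyl Ω T, u p = 0) (hv0 : ∀ p ∉ cyl Ω T, v p = 0)
    (hus : ∀ᵐ t ∂volume.restrict (Set.Ioo 0 T), LocallyIntegrable fun x => u (t, x))
    (hvs : ∀ᵐ t ∂volume.restrict (Set.Ioo 0 T), LocallyIntegrable fun x => v (t, x)) :
    ∀ᵐ t ∂volume.restrict (Set.Ioo 0 T),
      hΩ.IsMollDeriv (dirE 3 i) (fun x => u (t, x)) (fun x => v (t, x)) := by
  -- The null set of bad times depends on `k` and `x`. It is made uniform by restricting `x` to a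
  -- countable dense set and then using that both sides are continuous in `x`.
  obtain ⟨D, hDc, hDd⟩ := TopologicalSpace.exists_countable_dense (E 3)
  have h1 : ∀ k : ℕ, ∀ x ∈ D, ∀ᵐ t ∂volume.restrict (Set.Ioo 0 T), x ∈ Ω →
      ∫ y, fderiv ℝ (hΩ.kern k) (y - x) (dirE 3 i) • u (t, y) =
        -∫ y, hΩ.kern k (y - x) • v (t, y) := by
    intro k x _
    by_cases hx : x ∈ Ω
    · have := h.ae_slice_eq hu hv hu0 hv0
        (a := fun y => hΩ.kern k (y - x)) ((hΩ.contDiff_kern k).comp (contDiff_id.sub contDiff_const))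
        ((hΩ.hasCompactSupport_kern k).comp_homeomorph (Homeomorph.subRight x))
        (hΩ.tsupport_kern_sub_subset k hx)
      filter_upwards [this] with t ht _
      simpa only [fderiv_comp_sub] using ht
    · exact ae_of_all _ fun t h => absurd h hx
  have h2 : ∀ᵐ t ∂volume.restrict (Set.Ioo 0 T), ∀ k : ℕ, ∀ x ∈ D, x ∈ Ω →
      ∫ y, fderiv ℝ (hΩ.kern k) (y - x) (dirE 3 i) • u (t, y) =
        -∫ y, hΩ.kern k (y - x) • v (t, y) :=
    ae_all_iff.2 fun k => (ae_ball_iff hDc).2 fun x hx => h1 k x hx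
  filter_upwards [h2, hus, hvs] with t ht hut hvt
  intro k x hx
  have hA : Continuous fun x => ∫ y, fderiv ℝ (hΩ.kern k) (y - x) (dirE 3 i) • u (t, y) := by
    have h3 := hΩ.contDiff_moll hut k
    have h4 : Continuous fun x => -fderiv ℝ (hΩ.moll k fun x => u (t, x)) x (dirE 3 i) := by
      have := h3.continuous_fderiv (by norm_num)
      fun_prop
    refine h4.congr fun x => ?_
    rw [hΩ.fderiv_moll hut, neg_neg]
  have hB : Continuous fun x => -∫ y, hΩ.kern k (y - x) • v (t, y) :=
    (hΩ.contDiff_moll hvt k).continuous.neg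
  have hcl : IsClosed {x | ∫ y, fderiv ℝ (hΩ.kern k) (y - x) (dirE 3 i) • u (t, y) =
        -∫ y, hΩ.kern k (y - x) • v (t, y)} := isClosed_eq hA hB
  have hsub : closure (Ω ∩ D) ⊆ {x | ∫ y, fderiv ℝ (hΩ.kern k) (y - x) (dirE 3 i) • u (t, y) =
        -∫ y, hΩ.kern k (y - x) • v (t, y)} :=
    closure_minimal (fun x hx => ht k x hx.2 hx.1) hcl
  exact hsub (hDd.open_subset_closure_inter hΩ.isOpen hx)

end Slices

/-! ### Extracting weak derivatives from the Sobolev norms -/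

section Unfold

variable {X V : Type*} [NormedAddCommGroup X] [NormedSpace ℝ X] [MeasureSpace X]
  [NormedAddCommGroup V] [NormedSpace ℝ V] {n : ℕ} {b : Fin n → X} {s : ℝ} {U : Set X} {u : X → V}

theorem floor_add_natCast_of_lt_one (hs : 0 < s) (hs1 : s < 1) (k : ℕ) : ⌊s + k⌋₊ = k := by
  rw [Nat.floor_add_natCast hs.le, Nat.floor_eq_zero.2 hs1, zero_add]

theorem ceil_add_natCast_of_lt_one (hs : 0 < s) (hs1 : s < 1) (k : ℕ) : ⌈s + k⌉₊ = k + 1 := by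
  rw [Nat.ceil_add_natCast hs.le, show ⌈s⌉₊ = 1 by
    rw [Nat.ceil_eq_iff one_ne_zero]; simp [hs, hs1.le]]
  ring

theorem fract_add_natCast_of_lt_one (hs : 0 < s) (hs1 : s < 1) (k : ℕ) :
    Int.fract (s + k) = s := by
  rw [Int.fract_add_natCast, Int.fract_eq_self.2 ⟨hs.le, hs1⟩]

/-- Below order 1 the jet consists of `u` alone, so every competitor in the infimum has the same
value. -/
theorem le_sobolevSq (hs : 0 < s) (hs1 : s < 1) :
    l2Sq U u + slobodetskiiSq n s U u ≤ sobolevSq b s U u := by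
  unfold sobolevSq
  refine le_iInf₂ fun D hD => ?_
  have h1 := floor_add_natCast_of_lt_one hs hs1 0
  have h2 := ceil_add_natCast_of_lt_one hs hs1 0
  have h3 := fract_add_natCast_of_lt_one hs hs1 0
  simp only [Nat.cast_zero, add_zero, zero_add] at h1 h2 h3
  rw [h1, h2, h3]
  simp [multiIdx, hD.1, hs.ne']

/-- Measurability enters only to exhibit a competitor; without it the infimum could be over the
empty family. -/
theorem sobolevSq_eq (hs : 0 < s) (hs1 : s < 1) (hu : AEStronglyMeasurable u (volume.restrict U)) :
    sobolevSq b s U u = l2Sq U u + slobodetskiiSq n s U u := by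
  refine le_antisymm ?_ (le_sobolevSq hs hs1)
  have h1 := floor_add_natCast_of_lt_one hs hs1 0
  have h2 := ceil_add_natCast_of_lt_one hs hs1 0
  have h3 := fract_add_natCast_of_lt_one hs hs1 0
  simp only [Nat.cast_zero, add_zero, zero_add] at h1 h2 h3
  unfold sobolevSq
  -- The constant family is a valid jet: since `⌊s⌋₊ = 0`, no derivative condition is imposed on it.
  refine (iInf₂_le (fun _ => u) ⟨rfl, fun _ _ => hu, fun α i hα => ?_⟩).trans ?_
  · rw [h1, h2, h3]
    simp [multiIdx, hs.ne']
  · rw [h1] at hα; exact absurd hα (by simp)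

theorem single_mem_multiIdx (i : Fin n) : (Pi.single i 1 : Fin n → ℕ) ∈ multiIdx n 1 := by
  simp [multiIdx]

theorem single_add_single_mem_multiIdx (i j : Fin n) :
    (Pi.single i 1 + Pi.single j 1 : Fin n → ℕ) ∈ multiIdx n 2 := by
  simp [multiIdx, Finset.sum_add_distrib]

/-- The norm is an infimum over jets, so a strict upper bound `P` selects one jet whose terms are
all at most `P`. -/
theorem exists_weakDeriv_of_sobolevSq_lt (hs : 0 < s) (hs1 : s < 1) {P : ℝ≥0∞}
    (h : sobolevSq b (s + 1) U u < P) : l2Sq U u ≤ P ∧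
    ∃ v : Fin n → X → V, ∀ i, HasWeakDeriv U (b i) u (v i) ∧
      l2Sq U (v i) + slobodetskiiSq n s U (v i) ≤ P := by
  have h1 := floor_add_natCast_of_lt_one hs hs1 1
  have h2 := ceil_add_natCast_of_lt_one hs hs1 1
  have h3 := fract_add_natCast_of_lt_one hs hs1 1
  simp only [Nat.cast_one] at h1 h2 h3
  unfold sobolevSq at h
  obtain ⟨D, h⟩ := iInf_lt_iff.1 h
  obtain ⟨hD, h⟩ := iInf_lt_iff.1 h
  rw [h1] at hD
  rw [h1, h2, h3] at h
  simp only [if_neg hs.ne', Finset.sum_range_succ, Finset.sum_range_zero, zero_add] at h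
  have h0 : ∑ α ∈ multiIdx n 0, l2Sq U (D α) = l2Sq U u := by simp [multiIdx, hD.1]
  rw [h0] at h
  refine ⟨le_trans (by rw [add_assoc]; exact le_self_add) h.le, fun i => D (Pi.single i 1),
    fun i => ⟨?_, ?_⟩⟩
  · have := hD.2.2 0 i (by simp)
    rwa [zero_add, hD.1] at this
  · refine le_trans ?_ h.le
    gcongr
    · refine le_trans ?_ le_add_self
      exact Finset.single_le_sum (f := fun α => l2Sq U (D α)) (fun _ _ => zero_le)
        (single_mem_multiIdx i)
    · exact Finset.single_le_sum (f := fun α => slobodetskiiSq n s U (D α)) (fun _ _ => zero_le)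
        (single_mem_multiIdx i)

theorem exists_weakDeriv_two_of_sobolevSq_lt_top (hs : 0 < s) (hs1 : s < 1)
    (h : sobolevSq b (s + 2) U u < ⊤) :
    ∃ (v : Fin n → X → V) (w : Fin n → Fin n → X → V), ∀ i, HasWeakDeriv U (b i) u (v i) ∧
      l2Sq U (v i) < ⊤ ∧ ∀ j, HasWeakDeriv U (b j) (v i) (w i j) ∧
      l2Sq U (w i j) + slobodetskiiSq n s U (w i j) < ⊤ := by
  have h1 := floor_add_natCast_of_lt_one hs hs1 2
  have h2 := ceil_add_natCast_of_lt_one hs hs1 2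
  have h3 := fract_add_natCast_of_lt_one hs hs1 2
  simp only [Nat.cast_ofNat] at h1 h2 h3
  unfold sobolevSq at h
  obtain ⟨D, h⟩ := iInf_lt_iff.1 h
  obtain ⟨hD, h⟩ := iInf_lt_iff.1 h
  rw [h1] at hD
  rw [h1, h2, h3] at h
  simp only [if_neg hs.ne', Finset.sum_range_succ, Finset.sum_range_zero, zero_add] at h
  rw [ENNReal.add_lt_top, ENNReal.add_lt_top, ENNReal.add_lt_top] at h
  obtain ⟨⟨⟨-, ha⟩, hb⟩, hc⟩ := h
  refine ⟨fun i => D (Pi.single i 1), fun i j => D (Pi.single i 1 + Pi.single j 1),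
    fun i => ⟨?_, ?_, fun j => ⟨?_, ?_⟩⟩⟩
  · have := hD.2.2 0 i (by simp)
    rwa [zero_add, hD.1] at this
  · exact (ENNReal.sum_lt_top.1 ha) _ (single_mem_multiIdx i)
  · exact hD.2.2 (Pi.single i 1) j (by simp)
  · exact ENNReal.add_lt_top.2 ⟨(ENNReal.sum_lt_top.1 hb) _ (single_add_single_mem_multiIdx i j),
      (ENNReal.sum_lt_top.1 hc) _ (single_add_single_mem_multiIdx i j)⟩

end Unfold

/-! ### The surface is Lipschitz and the fluid domain has the cone property -/

theorem l2Sq_congr {X V : Type*} [NormedAddCommGroup X] [NormedSpace ℝ X] [MeasureSpace X]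
    [NormedAddCommGroup V] [NormedSpace ℝ V] {U : Set X} {u v : X → V} (h : u =ᵐ[volume.restrict U] v) : l2Sq U u = l2Sq U v :=
  lintegral_congr_ae (h.mono fun x hx => by simp only [hx])

theorem slobodetskiiSq_congr {X V : Type*} [NormedAddCommGroup X] [NormedSpace ℝ X] [MeasureSpace X]
    [NormedAddCommGroup V] [NormedSpace ℝ V] {n : ℕ} {θ : ℝ} {U : Set X}
    {u v : X → V} (h : u =ᵐ[volume.restrict U] v) :
    slobodetskiiSq n θ U u = slobodetskiiSq n θ U v := by
  refine lintegral_congr_ae (h.mono fun x hx => ?_)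
  refine lintegral_congr_ae (h.mono fun y hy => ?_)
  simp only [hx, hy]

theorem coneDomain_univ (n : ℕ) : ConeDomain (Set.univ : Set (E n)) 0 1 :=
  ⟨one_pos, isOpen_univ, fun _ _ _ _ _ _ => trivial⟩

/-- The plane is trivially a cone domain, so the `L^∞` embedding with `n = 2` applies to each first
derivative of `h`; bounded derivatives then give the Lipschitz estimate. -/
theorem IsSobolevSurface.exists_lipschitz {l : ℝ} (hl : 1 / 2 < l) (hl' : l < 1) {h : E 2 → ℝ}
    (hh : IsSobolevSurface (l + 3 / 2) h) : ∃ L : ℝ, 0 ≤ L ∧ ∀ x y, |h x - h y| ≤ L * ‖x - y‖ := by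
  have hU := coneDomain_univ 2
  -- With this `θ` the gradient has smoothness `1 + θ`, and `0 < θ < 1` are exactly the embedding
  -- conditions for `n = 2`.
  set θ := l - 1 / 2 with hθ
  have hfin := hh.2
  rw [show l + 3 / 2 = θ + 2 by rw [hθ]; ring] at hfin
  obtain ⟨v, w, hvw⟩ := exists_weakDeriv_two_of_sobolevSq_lt_top (by linarith) (by linarith) hfin
  have hvl : ∀ i, LocallyIntegrable (v i) := fun i =>
    locallyIntegrableOn_univ.1 (hvw i).1.2.1
  have hwl : ∀ i j, LocallyIntegrable (w i j) := fun i j =>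
    locallyIntegrableOn_univ.1 ((hvw i).2.2 j).1.2.1
  have hhl : LocallyIntegrable h := hh.1.locallyIntegrable
  have hvm := fun i => (hvl i).aestronglyMeasurable
  have hwm := fun i j => (hwl i j).aestronglyMeasurable
  have hv1 : ∀ i, v i =ᵐ[volume] (hvm i).mk := fun i => (hvm i).ae_eq_mk
  have hw1 : ∀ i j, w i j =ᵐ[volume] (hwm i j).mk := fun i j => (hwm i j).ae_eq_mk
  have hMh : ∀ i, hU.IsMollDeriv (dirE 2 i) h (v i) := fun i => by
    simpa using (hvw i).1.isMollDeriv hU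
  have hMv : ∀ i j, hU.IsMollDeriv (dirE 2 j) (hvm i).mk (hwm i j).mk := fun i j => by
    have : hU.IsMollDeriv (dirE 2 j) (v i) (w i j) := by
      simpa using ((hvw i).2.2 j).1.isMollDeriv hU
    exact ConeDomain.IsMollDeriv.congr hU this (hv1 i) (hw1 i j)
  obtain ⟨C, hC, H⟩ := hU.exists_ae_enorm_sq_le (V := ℝ) (θ := θ) (by linarith)
    (by push_cast; linarith) (by push_cast; linarith)
  set S : Fin 2 → ℝ≥0∞ := fun i => ENNReal.ofReal C * (l2Sq Set.univ (v i) +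
        ∑ j, (l2Sq Set.univ (w i j) + slobodetskiiSq 2 θ Set.univ (w i j))) with hS
  have hSt : ∀ i, S i < ⊤ := fun i => ENNReal.mul_lt_top (by simp)
    (ENNReal.add_lt_top.2 ⟨(hvw i).2.1, ENNReal.sum_lt_top.2 fun j _ => ((hvw i).2.2 j).2⟩)
  set B : ℝ≥0∞ := ∑ i, S i ^ (1 / 2 : ℝ) with hB
  have hBt : B < ⊤ := ENNReal.sum_lt_top.2 fun i _ =>
    ENNReal.rpow_lt_top_of_nonneg (by norm_num) (hSt i).ne
  have hbd : ∀ i, ∀ᵐ x ∂volume.restrict (Set.univ : Set (E 2)), ‖v i x‖ₑ ≤ B := by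
    intro i
    have h1 := H _ _ (hvm i).stronglyMeasurable_mk (fun j => (hwm i j).stronglyMeasurable_mk)
      ((hvl i).congr (hv1 i)) (fun j => (hwl i j).congr (hw1 i j)) (hMv i)
    have e1 : l2Sq Set.univ (hvm i).mk = l2Sq Set.univ (v i) :=
      l2Sq_congr (ae_restrict_of_ae (hv1 i).symm)
    have e2 : ∀ j, l2Sq Set.univ (hwm i j).mk = l2Sq Set.univ (w i j) := fun j =>
      l2Sq_congr (ae_restrict_of_ae (hw1 i j).symm)
    have e3 : ∀ j, slobodetskiiSq 2 θ Set.univ (hwm i j).mk =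
        slobodetskiiSq 2 θ Set.univ (w i j) := fun j =>
      slobodetskiiSq_congr (ae_restrict_of_ae (hw1 i j).symm)
    simp only [e1, e2, e3] at h1
    filter_upwards [h1, ae_restrict_of_ae (hv1 i)] with x hx hx'
    rw [hx']
    refine (le_rpow_half_of_sq_le hx).trans ?_
    exact Finset.single_le_sum (f := fun i => S i ^ (1 / 2 : ℝ)) (fun _ _ => zero_le)
      (Finset.mem_univ i)
  have h2 := hU.ae_enorm_sub_le_of_bound hhl hMh hbd
  simp only [Measure.restrict_univ] at h2
  set K : ℝ := 4 * ((2 : ℕ) : ℝ) * (‖(0 : E 2)‖ + 1) / 1 with hK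
  have hK0 : 0 ≤ K := by positivity
  have hcont : ∀ f g : E 2 → E 2, Continuous f → Continuous g →
      IsClosed {x | ‖h (f x) - h (g x)‖ₑ ≤ ENNReal.ofReal (K * ‖f x - g x‖) * B} := by
    intro f g hf hg
    have hc := hh.1
    refine isClosed_le (by fun_prop) ?_
    exact (ENNReal.continuous_mul_const hBt.ne).comp
      (ENNReal.continuous_ofReal.comp (by fun_prop))
  -- The almost everywhere bound is a closed condition on the continuous `h`, and sets of full
  -- measure are dense; it is extended first in `y`, then in `x`.
  have h3 : ∀ᵐ x : E 2, ∀ y, ‖h x - h y‖ₑ ≤ ENNReal.ofReal (K * ‖x - y‖) * B := by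
    filter_upwards [h2] with x hx y
    have hd := Measure.dense_of_ae hx
    have := (hcont (fun _ => x) id continuous_const continuous_id).closure_subset_iff.2
      (subset_refl _)
    have h4 := hd y
    exact this h4
  have h4 : ∀ x y, ‖h x - h y‖ₑ ≤ ENNReal.ofReal (K * ‖x - y‖) * B := by
    intro x y
    have hd := Measure.dense_of_ae h3
    have hsub : closure {x | ∀ y, ‖h x - h y‖ₑ ≤ ENNReal.ofReal (K * ‖x - y‖) * B} ⊆
        {x | ‖h x - h y‖ₑ ≤ ENNReal.ofReal (K * ‖x - y‖) * B} :=
      closure_minimal (fun x hx => hx y) (hcont id (fun _ => y) continuous_id continuous_const)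
    exact hsub (hd x)
  refine ⟨K * B.toReal, by positivity, fun x y => ?_⟩
  have h5 := ENNReal.toReal_mono (ENNReal.mul_ne_top ENNReal.ofReal_ne_top hBt.ne) (h4 x y)
  rw [ENNReal.toReal_mul, ENNReal.toReal_ofReal (by positivity), toReal_enorm,
    Real.norm_eq_abs] at h5
  linarith

/-- The axis is `-e₃` and `ρ = 1/(2L + 2)`. Moving by `σz` lowers the point by at least `σ(1 - ρ)`,
while the surface height changes by at most `2Lρσ`, and `2Lρ + ρ < 1`. -/
theorem exists_coneDomain_fluidDomain {h : E 2 → ℝ} (hc : Continuous h) {L : ℝ} (hL : 0 ≤ L)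
    (hh : ∀ x y, |h x - h y| ≤ L * ‖x - y‖) : ∃ c ρ, ConeDomain (fluidDomain h) c ρ := by
  have hρ : 0 < 1 / (2 * L + 2) := by positivity
  refine ⟨EuclideanSpace.single 2 (-1), 1 / (2 * L + 2), hρ, ?_, ?_⟩
  · refine isOpen_lt (by fun_prop) ?_
    exact hc.comp (by fun_prop)
  · intro x hx σ hσ z hz
    rw [Metric.mem_ball, dist_eq_norm] at hz
    have hz' : ∀ i, |z i - (EuclideanSpace.single 2 (-1) : E 3) i| < 1 / (2 * L + 2) := fun i =>
      lt_of_le_of_lt (PiLp.norm_apply_le (z - EuclideanSpace.single 2 (-1)) i) hz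
    have h0 := hz' 0
    have h1 := hz' 1
    have h2 := hz' 2
    simp only [PiLp.single_apply] at h0 h1 h2
    rw [if_neg (by decide), sub_zero] at h0 h1
    norm_num at h0 h1 h2
    simp only [fluidDomain, Set.mem_ofPred_eq, PiLp.add_apply, PiLp.smul_apply, smul_eq_mul] at hx ⊢
    have hd := hh !₂[x 0, x 1] !₂[x 0 + σ * z 0, x 1 + σ * z 1]
    have hn : ‖(!₂[x 0, x 1] : E 2) - !₂[x 0 + σ * z 0, x 1 + σ * z 1]‖ ≤
        σ * (|z 0| + |z 1|) := by
      rw [EuclideanSpace.norm_eq, Fin.sum_univ_two]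
      apply Real.sqrt_le_iff.2
      refine ⟨by positivity, ?_⟩
      simp only [WithLp.ofLp_sub, Pi.sub_apply, Matrix.cons_val_zero, Matrix.cons_val_one,
        Real.norm_eq_abs, sq_abs, Matrix.cons_val_fin_one]
      nlinarith [mul_nonneg (abs_nonneg (z 0)) (abs_nonneg (z 1)), sq_abs (z 0), sq_abs (z 1),
        sq_nonneg σ, mul_nonneg (sq_nonneg σ) (mul_nonneg (abs_nonneg (z 0)) (abs_nonneg (z 1)))]
    set r := (2 * L + 2)⁻¹ with hr
    have hr1 : r * (2 * L + 2) = 1 := inv_mul_cancel₀ (by positivity)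
    have hr0 : 0 < r := by positivity
    have h3 := (abs_le.1 hd).2
    have h4 := (abs_lt.1 h2).2
    have h5 : L * ‖(!₂[x 0, x 1] : E 2) - !₂[x 0 + σ * z 0, x 1 + σ * z 1]‖ ≤
        L * (σ * (2 * r)) := by
      refine mul_le_mul_of_nonneg_left (hn.trans ?_) hL
      refine mul_le_mul_of_nonneg_left ?_ hσ
      linarith
    have h6 : σ * z 2 ≤ σ * (r - 1) := mul_le_mul_of_nonneg_left (by linarith) hσ
    have h7 : L * (σ * (2 * r)) + σ * (r - 1) ≤ 0 := by
      have : L * (σ * (2 * r)) + σ * (r - 1) = σ * (r * (2 * L + 2) - r - 1) := by ring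
      rw [this, hr1]
      nlinarith
    linarith

/-! ### Strongly measurable representatives on the space-time cylinder -/

theorem HasWeakDeriv.congr {X V : Type*} [NormedAddCommGroup X] [NormedSpace ℝ X] [MeasureSpace X]
    [OpensMeasurableSpace X]
    [NormedAddCommGroup V] [NormedSpace ℝ V] {U : Set X} {e : X} {u v u' v' : X → V}
    (h : HasWeakDeriv U e u v) (hu : u =ᵐ[volume.restrict U] u')
    (hv : v =ᵐ[volume.restrict U] v') : HasWeakDeriv U e u' v' := by
  have hl : ∀ {f g : X → V}, f =ᵐ[volume.restrict U] g → LocallyIntegrableOn f U volume →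
      LocallyIntegrableOn g U volume := by
    intro f g hfg hf x hx
    obtain ⟨s, hs, hs'⟩ := hf x hx
    refine ⟨s ∩ U, inter_mem hs self_mem_nhdsWithin, ?_⟩
    refine (hs'.mono_set Set.inter_subset_left).congr ?_
    exact ae_mono (Measure.restrict_mono_set _ Set.inter_subset_right) hfg
  refine ⟨hl hu h.1, hl hv h.2.1, fun φ hφ hc hs => ?_⟩
  have h1 := h.2.2 φ hφ hc hs
  rw [integral_congr_ae (hu.mono fun x hx => by simp only [hx] :
      (fun x => (fderiv ℝ φ x e) • u x) =ᵐ[volume.restrict U] fun x => (fderiv ℝ φ x e) • u' x),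
    integral_congr_ae (hv.mono fun x hx => by simp only [hx] :
      (fun x => φ x • v x) =ᵐ[volume.restrict U] fun x => φ x • v' x)] at h1
  exact h1

theorem locallyIntegrable_of_l2 {X V : Type*} [NormedAddCommGroup X] [MeasureSpace X]
    [NormedAddCommGroup V] [IsLocallyFiniteMeasure (volume : Measure X)]
    {u : X → V} (hu : AEStronglyMeasurable u volume) (h : ∫⁻ x, ‖u x‖ₑ ^ 2 < ⊤) :
    LocallyIntegrable u := by
  have : MemLp u 2 volume := by
    refine ⟨hu, ?_⟩
    rw [eLpNorm_lt_top_iff_lintegral_rpow_enorm_lt_top (by norm_num) (by norm_num)]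
    simpa using h
  exact this.locallyIntegrable (by norm_num)

theorem lintegral_indicator_enorm_sq {X V : Type*} [MeasurableSpace X] {μ : Measure X}
    [NormedAddCommGroup V] {U : Set X} (hU : MeasurableSet U) (u : X → V) :
    ∫⁻ x, ‖U.indicator u x‖ₑ ^ 2 ∂μ = ∫⁻ x in U, ‖u x‖ₑ ^ 2 ∂μ := by
  rw [← lintegral_indicator hU]
  refine lintegral_congr fun x => ?_
  by_cases hx : x ∈ U <;> simp [hx]

section Ext

variable {V : Type*} [NormedAddCommGroup V] [NormedSpace ℝ V] {Ω : Set (E 3)} {T : ℝ}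
  {u : ℝ × E 3 → V}

open Classical in
/-- A strongly measurable version of `u` on the cylinder, extended by `0`. -/
def cylExt (Ω : Set (E 3)) (T : ℝ) (u : ℝ × E 3 → V) : ℝ × E 3 → V :=
  (cyl Ω T).indicator
    (if h : AEStronglyMeasurable u (volume.restrict (cyl Ω T)) then h.mk u else 0)

theorem measurableSet_cyl (hΩ : MeasurableSet Ω) : MeasurableSet (cyl Ω T) :=
  measurableSet_Ioo.prod hΩ

theorem isOpen_cyl (hΩ : IsOpen Ω) : IsOpen (cyl Ω T) := isOpen_Ioo.prod hΩ

omit [NormedSpace ℝ V] in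
theorem cylExt_eq_zero {p : ℝ × E 3} (hp : p ∉ cyl Ω T) : cylExt Ω T u p = 0 :=
  Set.indicator_of_notMem hp _

omit [NormedSpace ℝ V] in
theorem stronglyMeasurable_cylExt (hΩ : MeasurableSet Ω) : StronglyMeasurable (cylExt Ω T u) := by
  refine StronglyMeasurable.indicator ?_ (measurableSet_cyl hΩ)
  split_ifs with h
  · exact h.stronglyMeasurable_mk
  · exact stronglyMeasurable_zero

omit [NormedSpace ℝ V] in
theorem ae_eq_cylExt (hΩ : MeasurableSet Ω)
    (h : AEStronglyMeasurable u (volume.restrict (cyl Ω T))) :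
    u =ᵐ[volume.restrict (cyl Ω T)] cylExt Ω T u := by
  filter_upwards [h.ae_eq_mk, ae_restrict_mem (measurableSet_cyl hΩ)] with p hp hpc
  rw [cylExt, Set.indicator_of_mem hpc, dif_pos h, hp]

theorem lintegral_cylExt (hΩ : MeasurableSet Ω)
    (h : AEStronglyMeasurable u (volume.restrict (cyl Ω T))) :
    ∫⁻ p, ‖cylExt Ω T u p‖ₑ ^ 2 = l2Sq (cyl Ω T) u := by
  rw [l2Sq_congr (ae_eq_cylExt hΩ h), l2Sq, ← lintegral_indicator (measurableSet_cyl hΩ)]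
  refine lintegral_congr fun p => ?_
  by_cases hp : p ∈ cyl Ω T
  · simp [hp]
  · simp [hp, cylExt_eq_zero hp]

theorem locallyIntegrable_cylExt (hΩ : MeasurableSet Ω)
    (h : AEStronglyMeasurable u (volume.restrict (cyl Ω T))) (h2 : l2Sq (cyl Ω T) u < ⊤) :
    LocallyIntegrable (cylExt Ω T u) :=
  locallyIntegrable_of_l2 (stronglyMeasurable_cylExt hΩ).aestronglyMeasurable
    (by rwa [lintegral_cylExt hΩ h])

omit [NormedSpace ℝ V] in
theorem measurable_l2_slice {v : ℝ × E 3 → V} (hv : StronglyMeasurable v) :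
    Measurable fun t => l2Sq Ω fun x => v (t, x) :=
  (hv.enorm.pow_const 2).lintegral_prod_right'

theorem lintegral_l2_slice (hΩ : MeasurableSet Ω)
    (h : AEStronglyMeasurable u (volume.restrict (cyl Ω T))) :
    ∫⁻ t in Set.Ioo 0 T, l2Sq Ω (fun x => cylExt Ω T u (t, x)) = l2Sq (cyl Ω T) u := by
  rw [l2Sq_congr (ae_eq_cylExt hΩ h)]
  unfold l2Sq cyl
  rw [Measure.volume_eq_prod, ← Measure.prod_restrict,
    lintegral_prod _ ((stronglyMeasurable_cylExt hΩ).enorm.pow_const 2).aemeasurable]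

theorem ae_locallyIntegrable_slice (hΩ : MeasurableSet Ω)
    (h : AEStronglyMeasurable u (volume.restrict (cyl Ω T))) (h2 : l2Sq (cyl Ω T) u < ⊤) :
    ∀ᵐ t ∂volume.restrict (Set.Ioo 0 T), LocallyIntegrable fun x => cylExt Ω T u (t, x) := by
  rw [← lintegral_cylExt hΩ h, Measure.volume_eq_prod,
    lintegral_prod _ ((stronglyMeasurable_cylExt hΩ).enorm.pow_const 2).aemeasurable] at h2
  filter_upwards [ae_restrict_of_ae (ae_lt_top
    ((stronglyMeasurable_cylExt hΩ).enorm.pow_const 2).lintegral_prod_right' h2.ne)] with t ht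
  exact locallyIntegrable_of_l2 ((stronglyMeasurable_cylExt hΩ).comp_measurable
    measurable_prodMk_left).aestronglyMeasurable ht

omit [NormedSpace ℝ V] in
theorem ae_slice_eq_cylExt (hΩ : MeasurableSet Ω)
    (h : AEStronglyMeasurable u (volume.restrict (cyl Ω T))) :
    ∀ᵐ t ∂volume.restrict (Set.Ioo 0 T),
      (fun x => u (t, x)) =ᵐ[volume.restrict Ω] fun x => cylExt Ω T u (t, x) := by
  have h1 := ae_eq_cylExt hΩ h
  unfold cyl at h1
  rw [Measure.volume_eq_prod, ← Measure.prod_restrict] at h1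
  exact Measure.ae_ae_of_ae_prod h1

end Ext

/-! ### Time increments in `L²(Ω)` -/

section Time

instance : (volume : Measure (ℝ × E 3)).IsAddHaarMeasure := by
  rw [Measure.volume_eq_prod]; infer_instance

variable {V : Type*} [NormedAddCommGroup V] [NormedSpace ℝ V] [CompleteSpace V] {Ω : Set (E 3)}
  {T : ℝ} {u v : ℝ × E 3 → V}

theorem lintegral_comp_add_mul (a : ℝ → ℝ≥0∞) (ha : Measurable a) (s : ℝ) {r : ℝ} (hr : r ≠ 0) :
    ∫⁻ σ, a (s + σ * r) = ENNReal.ofReal |r|⁻¹ * ∫⁻ t, a t := by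
  calc ∫⁻ σ, a (s + σ * r) = ∫⁻ p, a (s + p) ∂Measure.map (r • ·) volume := by
        rw [lintegral_map (f := fun p => a (s + p)) (ha.comp (measurable_const_add s))
          (measurable_const_smul r)]
        simp only [smul_eq_mul, mul_comm]
    _ = ENNReal.ofReal |r|⁻¹ * ∫⁻ p, a (s + p) := by
        rw [Measure.map_addHaar_smul _ hr, lintegral_smul_measure, smul_eq_mul]
        simp [abs_inv]
    _ = _ := by rw [lintegral_add_left_eq_self a s]

/-- The increment is `r` times the average of the time derivative over the segment, which stays in
the cylinder because `(0, T)` is convex; Cauchy–Schwarz follows. -/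
theorem HasWeakDeriv.ae_lintegral_sub_sq_le (hΩ : IsOpen Ω)
    (h : HasWeakDeriv (cyl Ω T) dirT u v) (hu : LocallyIntegrable u) (hv : LocallyIntegrable v)
    (hvm : StronglyMeasurable v) (r : ℝ) :
    ∀ᵐ s, s ∈ Set.Ioo 0 T → s + r ∈ Set.Ioo 0 T →
      ∫⁻ x in Ω, ‖u (s + r, x) - u (s, x)‖ₑ ^ 2 ≤ ENNReal.ofReal (r ^ 2) *
        ∫⁻ σ in Set.Ioc (0 : ℝ) 1, l2Sq Ω fun x => v (s + σ * r, x) := by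
  have h1 := h.ae_sub_eq (isOpen_cyl hΩ) hu hv hvm r
  rw [Measure.volume_eq_prod] at h1
  filter_upwards [Measure.ae_ae_of_ae_prod h1] with s hs hs0 hsr
  have hm : Measurable fun p : E 3 × ℝ => ‖v (s + p.2 * r, p.1)‖ₑ ^ 2 :=
    (hvm.comp_measurable (by fun_prop)).enorm.pow_const 2
  calc ∫⁻ x in Ω, ‖u (s + r, x) - u (s, x)‖ₑ ^ 2
      ≤ ∫⁻ x in Ω, ENNReal.ofReal (r ^ 2) *
          ∫⁻ σ in Set.Ioc (0 : ℝ) 1, ‖v (s + σ * r, x)‖ₑ ^ 2 := by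
        refine lintegral_mono_ae ?_
        filter_upwards [ae_restrict_of_ae hs, ae_restrict_mem hΩ.measurableSet] with x hx hxΩ
        have e : ∀ σ : ℝ, (s, x) + σ • r • dirT = (s + σ * r, x) := by
          intro σ; simp [dirT]
        have e1 : (s, x) + r • dirT = (s + r, x) := by simp [dirT]
        simp only [e, e1] at hx
        have hx' := hx fun σ hσ => ⟨(convex_Ioo 0 T).add_smul_mem hs0 hsr hσ, hxΩ⟩
        rw [hx', enorm_smul, mul_pow]
        gcongr
        · rw [Real.enorm_eq_ofReal_abs, ← ENNReal.ofReal_pow (abs_nonneg _), sq_abs]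
        · rw [intervalIntegral.integral_of_le zero_le_one]
          calc _ ≤ (∫⁻ σ in Set.Ioc (0 : ℝ) 1, ‖v (s + σ * r, x)‖ₑ) ^ 2 := by
                gcongr; exact enorm_integral_le_lintegral_enorm _
            _ ≤ _ := by
                refine (sq_lintegral_le _ ?_).trans (by simp)
                exact (hvm.comp_measurable (by fun_prop)).enorm.aemeasurable
    _ = _ := by
        rw [lintegral_const_mul' _ _ ENNReal.ofReal_ne_top,
          lintegral_lintegral_swap hm.aemeasurable]
        rfl

/-- At a fixed time, enlarging the segment to the whole line and substituting `t = s + σr` costs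
`|r|⁻¹`, so one of the two powers of `r` is lost. -/
theorem HasWeakDeriv.ae_lintegral_sub_sq_le_abs (hΩ : IsOpen Ω)
    (h : HasWeakDeriv (cyl Ω T) dirT u v) (hu : LocallyIntegrable u) (hv : LocallyIntegrable v)
    (hvm : StronglyMeasurable v) (r : ℝ) :
    ∀ᵐ s, s ∈ Set.Ioo 0 T → s + r ∈ Set.Ioo 0 T →
      ∫⁻ x in Ω, ‖u (s + r, x) - u (s, x)‖ₑ ^ 2 ≤ ENNReal.ofReal |r| * ∫⁻ p, ‖v p‖ₑ ^ 2 := by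
  filter_upwards [h.ae_lintegral_sub_sq_le hΩ hu hv hvm r] with s hs hs0 hsr
  refine (hs hs0 hsr).trans ?_
  rcases eq_or_ne r 0 with rfl | hr
  · simp
  have hm : Measurable fun t => l2Sq Ω fun x => v (t, x) := measurable_l2_slice hvm
  calc _ ≤ ENNReal.ofReal (r ^ 2) * ∫⁻ σ, l2Sq Ω fun x => v (s + σ * r, x) :=
        mul_le_mul_right (setLIntegral_le_lintegral _ _) _
    _ = ENNReal.ofReal (r ^ 2) * (ENNReal.ofReal |r|⁻¹ * ∫⁻ t, l2Sq Ω fun x => v (t, x)) := by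
        rw [lintegral_comp_add_mul (fun t => l2Sq Ω fun x => v (t, x)) hm s hr]
    _ = ENNReal.ofReal |r| * ∫⁻ t, l2Sq Ω fun x => v (t, x) := by
        rw [← mul_assoc, ← ENNReal.ofReal_mul (by positivity)]
        congr 2
        rw [← sq_abs, sq, mul_assoc, mul_inv_cancel₀ (abs_pos.2 hr).ne', mul_one]
    _ ≤ _ := by
        rw [Measure.volume_eq_prod, lintegral_prod _ (hvm.enorm.pow_const 2).aemeasurable]
        exact mul_le_mul_right (lintegral_mono fun t => setLIntegral_le_lintegral _ _) _

/-- After integration in `s` as well, translation invariance removes the dependence on `σ` at no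
cost, so the full factor `r²` survives. -/
theorem HasWeakDeriv.lintegral_lintegral_sub_sq_le (hΩ : IsOpen Ω)
    (h : HasWeakDeriv (cyl Ω T) dirT u v) (hu : LocallyIntegrable u) (hv : LocallyIntegrable v)
    (hvm : StronglyMeasurable v) (r : ℝ) :
    ∫⁻ s in {s | s ∈ Set.Ioo 0 T ∧ s + r ∈ Set.Ioo 0 T},
      ∫⁻ x in Ω, ‖u (s + r, x) - u (s, x)‖ₑ ^ 2 ≤
        ENNReal.ofReal (r ^ 2) * ∫⁻ p, ‖v p‖ₑ ^ 2 := by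
  have hS : MeasurableSet {s | s ∈ Set.Ioo 0 T ∧ s + r ∈ Set.Ioo 0 T} :=
    measurableSet_Ioo.inter (measurableSet_Ioo.preimage (measurable_add_const r))
  have hm : Measurable fun t => l2Sq Ω fun x => v (t, x) := measurable_l2_slice hvm
  have hm2 : Measurable fun p : ℝ × ℝ => l2Sq Ω fun x => v (p.1 + p.2 * r, x) :=
    hm.comp (f := fun p : ℝ × ℝ => p.1 + p.2 * r) (by fun_prop)
  calc _ ≤ ∫⁻ s in {s | s ∈ Set.Ioo 0 T ∧ s + r ∈ Set.Ioo 0 T}, ENNReal.ofReal (r ^ 2) *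
        ∫⁻ σ in Set.Ioc (0 : ℝ) 1, l2Sq Ω fun x => v (s + σ * r, x) := by
        refine lintegral_mono_ae ?_
        filter_upwards [ae_restrict_of_ae (h.ae_lintegral_sub_sq_le hΩ hu hv hvm r),
          ae_restrict_mem hS] with s hs hs' using hs hs'.1 hs'.2
    _ ≤ ∫⁻ s, ENNReal.ofReal (r ^ 2) *
        ∫⁻ σ in Set.Ioc (0 : ℝ) 1, l2Sq Ω fun x => v (s + σ * r, x) :=
        setLIntegral_le_lintegral _ _
    _ = ENNReal.ofReal (r ^ 2) * ∫⁻ t, l2Sq Ω fun x => v (t, x) := by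
        rw [lintegral_const_mul' _ _ ENNReal.ofReal_ne_top, lintegral_lintegral_swap
          hm2.aemeasurable]
        congr 1
        calc _ = ∫⁻ σ in Set.Ioc (0 : ℝ) 1, ∫⁻ t, l2Sq Ω fun x => v (t, x) := by
              refine lintegral_congr fun σ => ?_
              exact lintegral_add_right_eq_self (fun t => l2Sq Ω fun x => v (t, x)) (σ * r)
          _ = _ := by simp
    _ ≤ _ := by
        rw [Measure.volume_eq_prod, lintegral_prod _ (hvm.enorm.pow_const 2).aemeasurable]
        exact mul_le_mul_right (lintegral_mono fun t => setLIntegral_le_lintegral _ _) _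

end Time

/-! ### Estimates for one function of `H^{l+2,l/2+1}(Q_T)` -/

section Unfold

variable {V : Type*} [NormedAddCommGroup V] [NormedSpace ℝ V] {Ω : Set (E 3)} {T l : ℝ}
  {u : ℝ × E 3 → V}

theorem lintegral_slices_le_lSq (hΩ : MeasurableSet Ω) (hl : 0 < l) (hl' : l < 1)
    (h : AEStronglyMeasurable u (volume.restrict (cyl Ω T))) :
    ∫⁻ t in Set.Ioo 0 T, (l2Sq Ω (fun x => cylExt Ω T u (t, x)) +
      slobodetskiiSq 3 l Ω (fun x => cylExt Ω T u (t, x))) ≤ lSq l Ω T u := by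
  refine le_trans ?_ (le_self_add.trans le_self_add)
  refine lintegral_mono_ae ?_
  filter_upwards [ae_slice_eq_cylExt hΩ h] with t ht
  rw [← l2Sq_congr ht, ← slobodetskiiSq_congr ht]
  exact le_sobolevSq hl hl'

theorem l2Sq_cyl_le_lSq (hΩ : MeasurableSet Ω) (hl : 0 < l) (hl' : l < 1)
    (h : AEStronglyMeasurable u (volume.restrict (cyl Ω T))) :
    l2Sq (cyl Ω T) u ≤ lSq l Ω T u := by
  rw [← lintegral_l2_slice hΩ h]
  exact (lintegral_mono fun t => le_self_add).trans (lintegral_slices_le_lSq hΩ hl hl' h)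

/-- A strict bound on the infimum selects one time derivative and one spatial jet, so that a single
choice of derivatives serves all later estimates. -/
theorem exists_of_l2plusSq_lt {P : ℝ≥0∞} (h : l2plusSq l Ω T u < P) :
    ∃ (ut : ℝ × E 3 → V) (g : Fin 3 → ℝ × E 3 → V) (w : Fin 3 → Fin 3 → ℝ × E 3 → V),
      HasWeakDeriv (cyl Ω T) dirT u ut ∧ (∀ i, HasWeakDeriv (cyl Ω T) (dirX i) u (g i)) ∧
      (∀ i j, HasWeakDeriv (cyl Ω T) (dirX j) (g i) (w i j)) ∧ lSq l Ω T ut ≤ P ∧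
      l2Sq (cyl Ω T) u ≤ P ∧ (∀ i, l2Sq (cyl Ω T) (g i) ≤ P) ∧ ∀ i j, lSq l Ω T (w i j) ≤ P := by
  unfold l2plusSq at h
  obtain ⟨ut, h⟩ := iInf_lt_iff.1 h
  obtain ⟨hut, h⟩ := iInf_lt_iff.1 h
  obtain ⟨D, h⟩ := iInf_lt_iff.1 h
  obtain ⟨hD, h⟩ := iInf_lt_iff.1 h
  have h3 : ∀ k < 2, ∀ s ∈ multiIdx 3 k, l2Sq (cyl Ω T) (D s) ≤ P := by
    intro k hk s hs
    refine le_trans ?_ (le_add_self.trans h.le)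
    refine le_trans ?_ (Finset.single_le_sum (fun _ _ => zero_le) (Finset.mem_range.2 hk))
    exact Finset.single_le_sum (f := fun s => l2Sq (cyl Ω T) (D s)) (fun _ _ => zero_le) hs
  refine ⟨ut, fun i => D (Pi.single i 1), fun i j => D (Pi.single i 1 + Pi.single j 1), hut,
    fun i => ?_, fun i j => ?_, ?_, ?_, fun i => h3 1 (by norm_num) _ (single_mem_multiIdx i),
    fun i j => ?_⟩
  · have := hD.2.2 0 i (by simp)
    rwa [zero_add, hD.1] at this
  · exact hD.2.2 _ j (by simp)
  · exact (le_self_add.trans le_self_add).trans h.le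
  · have := h3 0 (by norm_num) 0 (by simp [multiIdx])
    rwa [hD.1] at this
  · refine le_trans ?_ (le_self_add.trans h.le)
    refine le_trans ?_ le_add_self
    exact Finset.single_le_sum (f := fun s => lSq l Ω T (D s)) (fun _ _ => zero_le)
      (single_add_single_mem_multiIdx i j)

end Unfold

/-- The estimates for a function `F` with `‖F‖² < P` in `H^{l+2,l/2+1}` and its spatial gradient
`g` that enter in the product estimate. -/
structure HData {V : Type*} [NormedAddCommGroup V] (Ω : Set (E 3)) (l T r₀ C : ℝ) (P : ℝ≥0∞)
    (F : ℝ × E 3 → V) (g : Fin 3 → ℝ × E 3 → V) (b : ℝ → ℝ≥0∞) : Prop where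
  meas : StronglyMeasurable F
  meas_grad : ∀ i, StronglyMeasurable (g i)
  meas_b : Measurable b
  lintegral_b : ∫⁻ t in Set.Ioo 0 T, b t ≤ ENNReal.ofReal C * P
  sup : ∀ᵐ t ∂volume.restrict (Set.Ioo 0 T), ∀ᵐ x ∂volume.restrict Ω,
    ‖F (t, x)‖ₑ ^ 2 ≤ ENNReal.ofReal C * P
  holder : ∀ᵐ t ∂volume.restrict (Set.Ioo 0 T), ∀ᵐ x ∂volume.restrict Ω,
    ∀ᵐ y ∂volume.restrict Ω, ‖x - y‖ ≤ r₀ →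
      ‖F (t, x) - F (t, y)‖ₑ ^ 2 ≤ ENNReal.ofReal (C * ‖x - y‖ ^ (2 * l - 1)) * P
  lip : ∀ᵐ t ∂volume.restrict (Set.Ioo 0 T), ∀ᵐ x ∂volume.restrict Ω,
    ∀ᵐ y ∂volume.restrict Ω,
      ‖F (t, x) - F (t, y)‖ₑ ^ 2 ≤ ENNReal.ofReal (C * ‖x - y‖ ^ 2) * b t
  sup_grad : ∀ i, ∀ᵐ t ∂volume.restrict (Set.Ioo 0 T), ∀ᵐ x ∂volume.restrict Ω,
    ‖g i (t, x)‖ₑ ^ 2 ≤ b t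
  sobolev_grad : ∀ i, ∀ᵐ t ∂volume.restrict (Set.Ioo 0 T),
    ∫⁻ x in Ω, ‖g i (t, x)‖ₑ ^ 2 ≤ P ∧ ∫⁻ x in Ω, ∫⁻ y in Ω,
      ‖g i (t, x) - g i (t, y)‖ₑ ^ 2 / ENNReal.ofReal (‖x - y‖ ^ (3 + 2 * l)) ≤ P
  time : ∀ r : ℝ, ∀ᵐ s, s ∈ Set.Ioo 0 T → s + r ∈ Set.Ioo 0 T →
    ∫⁻ x in Ω, ‖F (s + r, x) - F (s, x)‖ₑ ^ 2 ≤ ENNReal.ofReal |r| * P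
  lintegral_time : ∀ r : ℝ, ∫⁻ s in {s | s ∈ Set.Ioo 0 T ∧ s + r ∈ Set.Ioo 0 T},
    ∫⁻ x in Ω, ‖F (s + r, x) - F (s, x)‖ₑ ^ 2 ≤ ENNReal.ofReal (r ^ 2) * P
  interp : ∀ r : ℝ, r ≠ 0 → ∀ i, ∀ᵐ s, s ∈ Set.Ioo 0 T → s + r ∈ Set.Ioo 0 T →
    ENNReal.ofReal |r| * ∫⁻ x in Ω, ‖g i (s + r, x) - g i (s, x)‖ₑ ^ 2 ≤
      ENNReal.ofReal C * ((∫⁻ x in Ω, ‖F (s + r, x) - F (s, x)‖ₑ ^ 2) +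
        ENNReal.ofReal (r ^ 2) * (b (s + r) + b s))

namespace ConeDomain

variable {V : Type*} [NormedAddCommGroup V] [NormedSpace ℝ V] [CompleteSpace V] {Ω : Set (E 3)}
  {c : E 3} {ρ : ℝ} (hΩ : ConeDomain Ω c ρ) {l : ℝ}
include hΩ

/-- The slice data: `u(t)`, its gradient and its second derivatives. -/
theorem exists_slice_bounds (hl : 1 / 2 < l) (hl' : l < 1) :
    ∃ C : ℝ, 0 < C ∧ ∀ (u : E 3 → V) (v : Fin 3 → E 3 → V) (w : Fin 3 → Fin 3 → E 3 → V),
      StronglyMeasurable u → (∀ i, StronglyMeasurable (v i)) →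
      (∀ i j, StronglyMeasurable (w i j)) → LocallyIntegrable u →
      (∀ i, LocallyIntegrable (v i)) → (∀ i j, LocallyIntegrable (w i j)) →
      (∀ i, hΩ.IsMollDeriv (dirE 3 i) u (v i)) →
      (∀ i j, hΩ.IsMollDeriv (dirE 3 j) (v i) (w i j)) → ∀ P : ℝ≥0∞, l2Sq Ω u ≤ P →
      (∀ i, l2Sq Ω (v i) + slobodetskiiSq 3 l Ω (v i) ≤ P) → ∀ b : ℝ≥0∞,
      b = ∑ i, (l2Sq Ω (v i) + ∑ j, (l2Sq Ω (w i j) + slobodetskiiSq 3 l Ω (w i j))) →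
      (∀ᵐ x ∂volume.restrict Ω, ‖u x‖ₑ ^ 2 ≤ ENNReal.ofReal C * P) ∧
      (∀ᵐ x ∂volume.restrict Ω, ∀ᵐ y ∂volume.restrict Ω, ‖x - y‖ ≤ ρ / 2 →
        ‖u x - u y‖ₑ ^ 2 ≤ ENNReal.ofReal (C * ‖x - y‖ ^ (2 * l - 1)) * P) ∧
      (∀ᵐ x ∂volume.restrict Ω, ∀ᵐ y ∂volume.restrict Ω,
        ‖u x - u y‖ₑ ^ 2 ≤ ENNReal.ofReal (C * ‖x - y‖ ^ 2) * b) ∧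
      ∀ i, ∀ᵐ x ∂volume.restrict Ω, ‖v i x‖ₑ ^ 2 ≤ ENNReal.ofReal C * b := by
  obtain ⟨C₁, hC₁, H₁⟩ := hΩ.exists_ae_enorm_sq_le (V := V) (θ := l) (by linarith)
    (by norm_num; linarith) (by norm_num; linarith)
  obtain ⟨C₂, hC₂, H₂⟩ := hΩ.exists_ae_enorm_sub_sq_le (V := V) (θ := l) (by linarith)
    (by norm_num; linarith) (by norm_num; linarith)
  have hρ := hΩ.pos
  set K : ℝ := 4 * (3 : ℕ) * (‖c‖ + ρ) / ρ with hK
  have hK0 : 0 ≤ K := by positivity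
  refine ⟨4 * C₁ + 3 * C₂ + K ^ 2 * C₁, by positivity,
    fun u v w hum hvm hwm hu hv hw h h' P hP hvP b hb => ⟨?_, ?_, ?_, ?_⟩⟩
  · filter_upwards [H₁ u v hum hvm hu hv h] with x hx
    refine hx.trans ?_
    calc _ ≤ ENNReal.ofReal C₁ * (P + ∑ i : Fin 3, P) := by
          gcongr with i; exact hvP i
      _ = ENNReal.ofReal (4 * C₁) * P := by
          rw [ENNReal.ofReal_mul (by norm_num)]
          simp only [Finset.sum_const, Finset.card_univ, Fintype.card_fin, nsmul_eq_mul]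
          norm_num
          ring
      _ ≤ _ := by gcongr; nlinarith [sq_nonneg K, mul_nonneg (sq_nonneg K) hC₁.le]
  · filter_upwards [H₂ u v hvm hu hv h] with x hx
    filter_upwards [hx] with y hy hxy
    refine (hy hxy).trans ?_
    rw [show 2 * (1 - (((3 : ℕ) : ℝ) / 2 - l)) = 2 * l - 1 by norm_num; ring]
    calc _ ≤ ENNReal.ofReal (C₂ * ‖x - y‖ ^ (2 * l - 1)) * ∑ i : Fin 3, P := by
          gcongr with i; exact hvP i
      _ = ENNReal.ofReal (3 * C₂ * ‖x - y‖ ^ (2 * l - 1)) * P := by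
          rw [mul_assoc 3, ENNReal.ofReal_mul (p := 3) (by norm_num),
            show ENNReal.ofReal 3 = 3 by simp]
          simp only [Finset.sum_const, Finset.card_univ, Fintype.card_fin, nsmul_eq_mul,
            Nat.cast_ofNat]
          ring
      _ ≤ _ := by
          gcongr
          nlinarith [sq_nonneg K, mul_nonneg (sq_nonneg K) hC₁.le]
  -- Both remaining bounds rest on the `L^∞` embedding applied to the first derivatives, whose
  -- gradients are the second derivatives in `b`.
  all_goals
    have hg : ∀ i, ∀ᵐ x ∂volume.restrict Ω, ‖v i x‖ₑ ^ 2 ≤ ENNReal.ofReal C₁ * b := by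
      intro i
      filter_upwards [H₁ (v i) (w i) (hvm i) (hwm i) (hv i) (hw i) (h' i)] with x hx
      refine hx.trans ?_
      rw [hb]
      gcongr
      exact Finset.single_le_sum (f := fun i => l2Sq Ω (v i) + ∑ j, (l2Sq Ω (w i j) +
        slobodetskiiSq 3 l Ω (w i j))) (fun _ _ => zero_le) (Finset.mem_univ i)
  · filter_upwards [hΩ.ae_enorm_sub_le_of_bound hu h
      (fun i => (hg i).mono fun x hx => le_rpow_half_of_sq_le hx)] with x hx
    filter_upwards [hx] with y hy
    calc _ ≤ (ENNReal.ofReal (K * ‖x - y‖) * (ENNReal.ofReal C₁ * b) ^ (1 / 2 : ℝ)) ^ 2 := by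
          gcongr
      _ = ENNReal.ofReal (K ^ 2 * C₁ * ‖x - y‖ ^ 2) * b := by
          rw [mul_pow, rpow_half_sq, ← ENNReal.ofReal_pow (by positivity), ← mul_assoc,
            ← ENNReal.ofReal_mul (by positivity)]
          congr 2; ring
      _ ≤ _ := by gcongr; nlinarith
  · intro i
    filter_upwards [hg i] with x hx
    refine hx.trans ?_
    gcongr
    nlinarith [mul_nonneg (sq_nonneg K) hC₁.le]

/-- Interpolation for differences of two slices. -/
theorem exists_l2Sq_sub_deriv_le :
    ∃ C : ℝ, 0 < C ∧ ∀ (u u' : E 3 → V) (v v' : Fin 3 → E 3 → V) (w w' : Fin 3 → Fin 3 → E 3 → V),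
      StronglyMeasurable u → StronglyMeasurable u' → (∀ i j, StronglyMeasurable (w i j)) →
      (∀ i j, StronglyMeasurable (w' i j)) →
      LocallyIntegrable u → LocallyIntegrable u' → (∀ i, LocallyIntegrable (v i)) →
      (∀ i, LocallyIntegrable (v' i)) → (∀ i j, LocallyIntegrable (w i j)) →
      (∀ i j, LocallyIntegrable (w' i j)) →
      (∀ i, hΩ.IsMollDeriv (dirE 3 i) u (v i)) → (∀ i, hΩ.IsMollDeriv (dirE 3 i) u' (v' i)) →
      (∀ i j, hΩ.IsMollDeriv (dirE 3 j) (v i) (w i j)) →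
      (∀ i j, hΩ.IsMollDeriv (dirE 3 j) (v' i) (w' i j)) → ∀ r : ℝ, r ≠ 0 → ∀ i,
      ENNReal.ofReal |r| * ∫⁻ x in Ω, ‖v i x - v' i x‖ₑ ^ 2 ≤
        ENNReal.ofReal C * ((∫⁻ x in Ω, ‖u x - u' x‖ₑ ^ 2) + ENNReal.ofReal (r ^ 2) *
          ((∑ i, ∑ j, l2Sq Ω (w i j)) + ∑ i, ∑ j, l2Sq Ω (w' i j))) := by
  obtain ⟨C, hC, H⟩ := hΩ.exists_l2Sq_deriv_le (V := V)
  refine ⟨2 * C, by positivity, fun u u' v v' w w' hum hum' hwm hwm' hu hu' hv hv' hw hw' h₁ h₁'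
    h₂ h₂' r hr i => ?_⟩
  have hr0 : 0 < |r| := abs_pos.2 hr
  -- The interpolation parameter is `δ = √|r|`, so that `δ² = |r|` and `δ⁴ = r²`.
  have h3 := H (u - u') (fun i => v i - v' i) (fun i j => w i j - w' i j) (hum.sub hum')
    (fun i j => (hwm i j).sub (hwm' i j)) (hu.sub hu') (fun i => (hv i).sub (hv' i))
    (fun i j => (hw i j).sub (hw' i j)) (fun i => (h₁ i).sub hΩ (h₁' i) hu hu' (hv i) (hv' i))
    (fun i j => (h₂ i j).sub hΩ (h₂' i j) (hv i) (hv' i) (hw i j) (hw' i j)) (√|r|)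
    (Real.sqrt_pos.2 hr0) i
  rw [Real.sq_sqrt hr0.le, show √|r| ^ 4 = r ^ 2 by
    rw [show √|r| ^ 4 = (√|r| ^ 2) ^ 2 by ring, Real.sq_sqrt hr0.le, sq_abs]] at h3
  have h4 : ∀ i j, l2Sq Ω (w i j - w' i j) ≤ 2 * (l2Sq Ω (w i j) + l2Sq Ω (w' i j)) := by
    intro i j
    unfold l2Sq
    rw [← lintegral_add_left ((hwm i j).enorm.pow_const 2), ← lintegral_const_mul' _ _ (by simp)]
    refine lintegral_mono fun x => ?_
    refine le_trans ?_ (add_sq_le_two_mul _ _)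
    gcongr
    exact _root_.enorm_sub_le
  calc _ ≤ _ := h3
    _ ≤ ENNReal.ofReal C * (2 * l2Sq Ω (u - u') + ENNReal.ofReal (r ^ 2) *
          ∑ i, ∑ j, 2 * (l2Sq Ω (w i j) + l2Sq Ω (w' i j))) := by
        gcongr with i _ j _
        · rw [two_mul]; exact le_self_add
        · exact h4 i j
    _ = _ := by
        rw [ENNReal.ofReal_mul (by norm_num)]
        simp only [← Finset.mul_sum, Finset.sum_add_distrib]
        rw [show ENNReal.ofReal 2 = 2 by simp]
        simp only [l2Sq, Pi.sub_apply]
        ring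

/-- This gathers all that the product estimate needs, for strongly measurable representatives
vanishing off the cylinder. The strict bound by `P` makes near-optimal weak derivatives available,
and the constant depends on neither `T` nor `F`. -/
theorem exists_hData (hl : 1 / 2 < l) (hl' : l < 1) :
    ∃ C : ℝ, 0 < C ∧ ∀ (T : ℝ) (F : ℝ × E 3 → V) (P : ℝ≥0∞), P ≠ ⊤ → hSq l Ω T F < P →
      ∃ (F' : ℝ × E 3 → V) (g : Fin 3 → ℝ × E 3 → V) (b : ℝ → ℝ≥0∞),
        F =ᵐ[volume.restrict (cyl Ω T)] F' ∧
        (∀ i, HasWeakDeriv (cyl Ω T) (dirX i) F' (g i)) ∧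
        HData Ω l T (ρ / 2) C P F' g b := by
  obtain ⟨C₁, hC₁, H₁⟩ := hΩ.exists_slice_bounds (V := V) hl hl'
  obtain ⟨C₂, hC₂, H₂⟩ := hΩ.exists_l2Sq_sub_deriv_le (V := V)
  have hl0 : 0 < l := by linarith
  have hm := hΩ.measurableSet
  -- The final `b` is `M` times the sum `B` below: it must dominate `C₁ B` for the gradient bound
  -- and `B` itself for the Lipschitz and interpolation bounds.
  set M : ℝ := max 1 C₁ with hM
  have hM1 : 1 ≤ M := le_max_left _ _
  have hMC : C₁ ≤ M := le_max_right _ _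
  refine ⟨C₁ + C₂ + 12 * M, by positivity, fun T F P hP hF => ?_⟩
  set C := C₁ + C₂ + 12 * M with hC
  obtain ⟨ut, g₀, w₀, hut, hg₀, hw₀, hutP, hFP, hgP, hwP⟩ :=
    exists_of_l2plusSq_lt (le_self_add.trans_lt hF)
  have hcm : MeasurableSet (cyl Ω T) := measurableSet_cyl hm
  have aF : AEStronglyMeasurable F (volume.restrict (cyl Ω T)) := hut.1.aestronglyMeasurable
  have aut : AEStronglyMeasurable ut (volume.restrict (cyl Ω T)) := hut.2.1.aestronglyMeasurable
  have ag : ∀ i, AEStronglyMeasurable (g₀ i) (volume.restrict (cyl Ω T)) := fun i =>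
    (hg₀ i).2.1.aestronglyMeasurable
  have aw : ∀ i j, AEStronglyMeasurable (w₀ i j) (volume.restrict (cyl Ω T)) := fun i j =>
    (hw₀ i j).2.1.aestronglyMeasurable
  have hutP' : l2Sq (cyl Ω T) ut ≤ P := (l2Sq_cyl_le_lSq hm hl0 hl' aut).trans hutP
  have hwP' : ∀ i j, l2Sq (cyl Ω T) (w₀ i j) ≤ P := fun i j =>
    (l2Sq_cyl_le_lSq hm hl0 hl' (aw i j)).trans (hwP i j)
  have hPt : P < ⊤ := lt_top_iff_ne_top.2 hP
  set F' := cylExt Ω T F with hF'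
  set g : Fin 3 → ℝ × E 3 → V := fun i => cylExt Ω T (g₀ i) with hg
  set w : Fin 3 → Fin 3 → ℝ × E 3 → V := fun i j => cylExt Ω T (w₀ i j) with hw
  set v := cylExt Ω T ut with hv
  have sF : StronglyMeasurable F' := stronglyMeasurable_cylExt hm
  have sg : ∀ i, StronglyMeasurable (g i) := fun i => stronglyMeasurable_cylExt hm
  have sw : ∀ i j, StronglyMeasurable (w i j) := fun i j => stronglyMeasurable_cylExt hm
  have sv : StronglyMeasurable v := stronglyMeasurable_cylExt hm
  have iF := locallyIntegrable_cylExt hm aF (hFP.trans_lt hPt)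
  have ig := fun i => locallyIntegrable_cylExt hm (ag i) ((hgP i).trans_lt hPt)
  have iw := fun i j => locallyIntegrable_cylExt hm (aw i j) ((hwP' i j).trans_lt hPt)
  have iv := locallyIntegrable_cylExt hm aut (hutP'.trans_lt hPt)
  have dF : ∀ i, HasWeakDeriv (cyl Ω T) (dirX i) F' (g i) := fun i =>
    (hg₀ i).congr (ae_eq_cylExt hm aF) (ae_eq_cylExt hm (ag i))
  have dg : ∀ i j, HasWeakDeriv (cyl Ω T) (dirX j) (g i) (w i j) := fun i j =>
    (hw₀ i j).congr (ae_eq_cylExt hm (ag i)) (ae_eq_cylExt hm (aw i j))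
  have dt : HasWeakDeriv (cyl Ω T) dirT F' v :=
    hut.congr (ae_eq_cylExt hm aF) (ae_eq_cylExt hm aut)
  have isF := ae_locallyIntegrable_slice hm aF (hFP.trans_lt hPt)
  have isg : ∀ᵐ t ∂volume.restrict (Set.Ioo 0 T), ∀ i, LocallyIntegrable fun x => g i (t, x) :=
    ae_all_iff.2 fun i => ae_locallyIntegrable_slice hm (ag i) ((hgP i).trans_lt hPt)
  have isw : ∀ᵐ t ∂volume.restrict (Set.Ioo 0 T), ∀ i j,
      LocallyIntegrable fun x => w i j (t, x) := ae_all_iff.2 fun i => ae_all_iff.2 fun j =>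
    ae_locallyIntegrable_slice hm (aw i j) ((hwP' i j).trans_lt hPt)
  have msF : ∀ᵐ t ∂volume.restrict (Set.Ioo 0 T), ∀ i,
      hΩ.IsMollDeriv (dirE 3 i) (fun x => F' (t, x)) (fun x => g i (t, x)) :=
    ae_all_iff.2 fun i => (dF i).ae_isMollDeriv hΩ iF (ig i) (fun _ => cylExt_eq_zero)
      (fun _ => cylExt_eq_zero) isF (ae_all_iff.1 isg i)
  have msg : ∀ᵐ t ∂volume.restrict (Set.Ioo 0 T), ∀ i j,
      hΩ.IsMollDeriv (dirE 3 j) (fun x => g i (t, x)) (fun x => w i j (t, x)) :=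
    ae_all_iff.2 fun i => ae_all_iff.2 fun j => (dg i j).ae_isMollDeriv hΩ (ig i) (iw i j)
      (fun _ => cylExt_eq_zero) (fun _ => cylExt_eq_zero) (ae_all_iff.1 isg i)
      (isw.mono fun t ht => ht i j)
  -- The essential supremum supplies weak derivatives of each slice separately, chosen independently
  -- of the space-time gradient. Uniqueness against mollifiers identifies them with the slices of
  -- `g`, so the bound in `W_2^l` transfers.
  have hS : ∀ᵐ t ∂volume.restrict (Set.Ioo 0 T), l2Sq Ω (fun x => F' (t, x)) ≤ P ∧
      ∀ i, l2Sq Ω (fun x => g i (t, x)) + slobodetskiiSq 3 l Ω (fun x => g i (t, x)) ≤ P := by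
    filter_upwards [ENNReal.ae_le_essSup fun t => sobolevSq (dirE 3) (l + 1) Ω
      (fun x => F (t, x)), ae_slice_eq_cylExt hm aF, isg, msF] with t h1 h2 h3 h4
    obtain ⟨h5, z, hz⟩ := exists_weakDeriv_of_sobolevSq_lt hl0 hl'
      (h1.trans_lt (le_add_self.trans_lt hF))
    refine ⟨by rwa [← l2Sq_congr h2], fun i => ?_⟩
    obtain ⟨h6, h7⟩ := hz i
    have h8 := (h6.congr h2 EventuallyEq.rfl).isMollDeriv hΩ
    rw [show Ω.indicator (fun x => F' (t, x)) = fun x => F' (t, x) by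
      funext x
      by_cases hx : x ∈ Ω
      · simp [hx]
      · rw [Set.indicator_of_notMem hx]
        exact (cylExt_eq_zero fun h => hx h.2).symm] at h8
    have h9 : LocallyIntegrable (Ω.indicator (z i)) := by
      refine locallyIntegrable_of_l2 ?_ ?_
      · rw [aestronglyMeasurable_indicator_iff hm]
        exact h6.2.1.aestronglyMeasurable
      · rw [lintegral_indicator_enorm_sq hm]
        exact (le_self_add.trans h7).trans_lt hPt
    have h10 := (h4 i).unique hΩ h8 (h3 i) h9
    have h11 : (fun x => g i (t, x)) =ᵐ[volume.restrict Ω] z i := by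
      filter_upwards [h10, ae_restrict_mem hm] with x hx hxΩ
      rw [hx, Set.indicator_of_mem hxΩ]
    rwa [l2Sq_congr h11, slobodetskiiSq_congr h11]
  set B : ℝ → ℝ≥0∞ := fun t => ∑ i, (l2Sq Ω (fun x => g i (t, x)) +
    ∑ j, (l2Sq Ω (fun x => w i j (t, x)) + slobodetskiiSq 3 l Ω (fun x => w i j (t, x)))) with hB
  have hsl : ∀ i j, Measurable fun t => slobodetskiiSq 3 l Ω (fun x => w i j (t, x)) := by
    intro i j
    unfold slobodetskiiSq
    refine Measurable.lintegral_prod_right' (f := fun p : ℝ × E 3 => ∫⁻ y in Ω,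
      ‖w i j (p.1, p.2) - w i j (p.1, y)‖ₑ ^ 2 /
        ENNReal.ofReal (‖p.2 - y‖ ^ (((3 : ℕ) : ℝ) + 2 * l))) ?_
    refine Measurable.lintegral_prod_right' (f := fun q : (ℝ × E 3) × E 3 =>
      ‖w i j (q.1.1, q.1.2) - w i j (q.1.1, q.2)‖ₑ ^ 2 /
        ENNReal.ofReal (‖q.1.2 - q.2‖ ^ (((3 : ℕ) : ℝ) + 2 * l))) ?_
    exact Measurable.div (Measurable.pow_const (((sw i j).comp_measurable (by fun_prop)).sub
      ((sw i j).comp_measurable (by fun_prop))).enorm 2) (by fun_prop)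
  have hA : ∀ i j, Measurable fun t =>
      l2Sq Ω (fun x => w i j (t, x)) + slobodetskiiSq 3 l Ω (fun x => w i j (t, x)) :=
    fun i j => (measurable_l2_slice (sw i j)).add (hsl i j)
  have hA' : ∀ i, Measurable fun t => l2Sq Ω (fun x => g i (t, x)) + ∑ j,
      (l2Sq Ω (fun x => w i j (t, x)) + slobodetskiiSq 3 l Ω (fun x => w i j (t, x))) :=
    fun i => (measurable_l2_slice (sg i)).add (Finset.measurable_fun_sum _ fun j _ => hA i j)
  have hBm : Measurable B := Finset.measurable_fun_sum _ fun i _ => hA' i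
  -- Each of the three directions contributes one gradient term and three second-derivative terms,
  -- each at most `P`: `3 · (1 + 3) = 12`.
  have hBi : ∫⁻ t in Set.Ioo 0 T, B t ≤ 12 * P := by
    have h1 : ∀ i, ∫⁻ t in Set.Ioo 0 T, (l2Sq Ω (fun x => g i (t, x)) + ∑ j,
        (l2Sq Ω (fun x => w i j (t, x)) + slobodetskiiSq 3 l Ω (fun x => w i j (t, x)))) ≤
        P + ∑ j : Fin 3, P := by
      intro i
      rw [lintegral_add_left (measurable_l2_slice (sg i)), lintegral_finsetSum _ fun j _ =>
        hA i j]
      refine add_le_add ?_ (Finset.sum_le_sum fun j _ => ?_)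
      · exact (lintegral_l2_slice hm (ag i)).trans_le (hgP i)
      · exact (lintegral_slices_le_lSq hm hl0 hl' (aw i j)).trans (hwP i j)
    simp only [hB]
    rw [lintegral_finsetSum _ fun i _ => hA' i]
    refine (Finset.sum_le_sum fun i _ => h1 i).trans (le_of_eq ?_)
    simp only [Finset.sum_const, Finset.card_univ, Fintype.card_fin, nsmul_eq_mul, Nat.cast_ofNat]
    ring
  have hkey := (isF.and (isg.and (isw.and (msF.and (msg.and hS))))).mono fun t ht =>
    H₁ (fun x => F' (t, x)) (fun i x => g i (t, x)) (fun i j x => w i j (t, x))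
      (sF.comp_measurable measurable_prodMk_left)
      (fun i => (sg i).comp_measurable measurable_prodMk_left)
      (fun i j => (sw i j).comp_measurable measurable_prodMk_left) ht.1 ht.2.1 ht.2.2.1 ht.2.2.2.1
      ht.2.2.2.2.1 P ht.2.2.2.2.2.1 ht.2.2.2.2.2.2 (B t) rfl
  have hBb : ∀ t, B t ≤ ENNReal.ofReal M * B t := fun t => by
    conv_lhs => rw [← one_mul (B t), ← ENNReal.ofReal_one]
    gcongr
  have hv2 : ∫⁻ p, ‖v p‖ₑ ^ 2 ≤ P := (lintegral_cylExt hm aut).trans_le hutP'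
  refine ⟨F', g, fun t => ENNReal.ofReal M * B t, ae_eq_cylExt hm aF, dF, sF, sg,
    hBm.const_mul _, ?_, ?_, ?_, ?_, ?_, ?_, ?_, ?_, ?_⟩
  · rw [lintegral_const_mul' _ _ ENNReal.ofReal_ne_top]
    calc _ ≤ ENNReal.ofReal M * (12 * P) := by gcongr
      _ = ENNReal.ofReal (12 * M) * P := by
        rw [ENNReal.ofReal_mul (by norm_num), show ENNReal.ofReal 12 = 12 by simp]
        ring
      _ ≤ _ := by gcongr; linarith
  · filter_upwards [hkey] with t ht
    filter_upwards [ht.1] with x hx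
    refine hx.trans ?_
    gcongr; linarith
  · filter_upwards [hkey] with t ht
    filter_upwards [ht.2.1] with x hx
    filter_upwards [hx] with y hy hxy
    refine (hy hxy).trans ?_
    gcongr; linarith
  · filter_upwards [hkey] with t ht
    filter_upwards [ht.2.2.1] with x hx
    filter_upwards [hx] with y hy
    refine hy.trans ?_
    refine mul_le_mul' (ENNReal.ofReal_le_ofReal ?_) (hBb t)
    gcongr; linarith
  · intro i
    filter_upwards [hkey] with t ht
    filter_upwards [ht.2.2.2 i] with x hx
    refine hx.trans ?_
    gcongr
  · intro i
    filter_upwards [hS] with t ht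
    refine ⟨le_self_add.trans (ht.2 i), le_add_self.trans (ht.2 i)⟩
  · intro r
    filter_upwards [dt.ae_lintegral_sub_sq_le_abs hΩ.isOpen iF iv sv r] with s hs hs0 hsr
    refine (hs hs0 hsr).trans ?_
    gcongr
  · intro r
    refine (dt.lintegral_lintegral_sub_sq_le hΩ.isOpen iF iv sv r).trans ?_
    gcongr
  · intro r hr i
    -- Both `s` and `s + r` must be good times; translation preserves null sets.
    have hgood := (ae_restrict_iff' measurableSet_Ioo).1
      (isF.and (isg.and (isw.and (msF.and msg))))
    have hgood' := (measurePreserving_add_right volume r).quasiMeasurePreserving.ae hgood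
    filter_upwards [hgood, hgood'] with s h1 h2 hs0 hsr
    obtain ⟨a1, a2, a3, a4, a5⟩ := h1 hs0
    obtain ⟨b1, b2, b3, b4, b5⟩ := h2 hsr
    have hwB : ∀ t, ∑ i, ∑ j, l2Sq Ω (fun x => w i j (t, x)) ≤ ENNReal.ofReal M * B t := by
      refine fun t => le_trans ?_ (hBb t)
      refine Finset.sum_le_sum fun i _ => le_trans ?_ le_add_self
      exact Finset.sum_le_sum fun j _ => le_self_add
    refine (H₂ _ _ (fun i x => g i (s + r, x)) (fun i x => g i (s, x))
      (fun i j x => w i j (s + r, x)) (fun i j x => w i j (s, x))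
      (sF.comp_measurable measurable_prodMk_left) (sF.comp_measurable measurable_prodMk_left)
      (fun i j => (sw i j).comp_measurable measurable_prodMk_left)
      (fun i j => (sw i j).comp_measurable measurable_prodMk_left) b1 a1 b2 a2 b3 a3 b4 a4 b5 a5
      r hr i).trans ?_
    exact mul_le_mul' (ENNReal.ofReal_le_ofReal (by linarith))
      (add_le_add le_rfl (mul_le_mul_right (add_le_add (hwB _) (hwB _)) _))

end ConeDomain

/-- `p` is a product of `F` and `γ`, as far as pointwise bounds are concerned. -/
structure IsProductBounded {Z V W : Type*} [NormedAddCommGroup V] [NormedAddCommGroup W]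
    (F : Z → V) (γ : Fin 3 → Z → V) (p : Z → W) : Prop where
  sq_le : ∀ z, ‖p z‖ₑ ^ 2 ≤ 6 * (‖F z‖ₑ ^ 2 * ∑ i, ‖γ i z‖ₑ ^ 2)
  sub_sq_le : ∀ z z', ‖p z - p z'‖ₑ ^ 2 ≤ 6 * (‖F z‖ₑ ^ 2 * ∑ i, ‖γ i z - γ i z'‖ₑ ^ 2 +
    ‖F z - F z'‖ₑ ^ 2 * ∑ i, ‖γ i z'‖ₑ ^ 2)

theorem IsProductBounded.comp {Z Z' V W : Type*} [NormedAddCommGroup V] [NormedAddCommGroup W]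
    {F : Z → V} {γ : Fin 3 → Z → V} {p : Z → W} (h : IsProductBounded F γ p) (φ : Z' → Z) :
    IsProductBounded (fun z => F (φ z)) (fun i z => γ i (φ z)) (fun z => p (φ z)) :=
  ⟨fun _ => h.sq_le _, fun _ _ => h.sub_sq_le _ _⟩

/-! ### Geometric means, kernels and double integrals -/

/-- Writing `Z = Z^{1-l} Z^l` and using one bound in each factor gives a weighted geometric mean of
`a` and `c`. Replacing `X` and `Y` by `X + Y` keeps the result linear in them, which matters because
one will be an integrable function of time. -/
theorem le_interpolation {l : ℝ} (hl : 0 ≤ l) (hl' : l ≤ 1) {Z a c X Y : ℝ≥0∞} (h : Z ≤ a * X)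
    (h' : Z ≤ c * Y) : Z ≤ a ^ (1 - l) * c ^ l * (X + Y) := by
  have h1 : (0 : ℝ) ≤ 1 - l := by linarith
  calc Z = Z ^ (1 - l) * Z ^ l := by
        rw [← ENNReal.rpow_add_of_nonneg _ _ h1 hl, sub_add_cancel, ENNReal.rpow_one]
    _ ≤ (a * (X + Y)) ^ (1 - l) * (c * (X + Y)) ^ l := by
        gcongr
        · exact h.trans (mul_le_mul_right le_self_add _)
        · exact h'.trans (mul_le_mul_right le_add_self _)
    _ = a ^ (1 - l) * c ^ l * ((X + Y) ^ (1 - l) * (X + Y) ^ l) := by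
        rw [ENNReal.mul_rpow_of_nonneg _ _ h1, ENNReal.mul_rpow_of_nonneg _ _ hl]
        ring
    _ = _ := by
        rw [← ENNReal.rpow_add_of_nonneg _ _ h1 hl, sub_add_cancel, ENNReal.rpow_one]

theorem lintegral_rpow_neg_ball_lt_top {α r : ℝ} (hα : α < 3) :
    ∫⁻ w : E 3, (Metric.closedBall (0 : E 3) r).indicator
      (fun w => ENNReal.ofReal (‖w‖ ^ (-α))) w < ⊤ := by
  rw [lintegral_indicator Metric.isClosed_closedBall.measurableSet]
  have h1 : IntegrableOn (fun w : E 3 => ‖w‖ ^ (-α)) (Metric.ball 0 (r + 1)) := by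
    refine integrableOn_ball_of_norm_le_rpow (C := 1) (α := α) (by simp) (by simpa using hα)
      (Eventually.of_forall fun x => ?_) ?_
    · rw [one_mul, Real.norm_of_nonneg (by positivity)]
    · exact (Measurable.aestronglyMeasurable (by fun_prop))
  have h2 := (h1.mono_set (Metric.closedBall_subset_ball (lt_add_one r))).2
  rw [hasFiniteIntegral_iff_ofReal (Eventually.of_forall fun x => by positivity)] at h2
  exact h2

theorem lintegral_rpow_neg_compl_ball_lt_top {α r : ℝ} (hr : 0 < r) (hα : 3 < α) :
    ∫⁻ w : E 3, (Metric.closedBall (0 : E 3) r)ᶜ.indicator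
      (fun w => ENNReal.ofReal (‖w‖ ^ (-α))) w < ⊤ := by
  have h1 : ∀ w : E 3, (Metric.closedBall (0 : E 3) r)ᶜ.indicator
      (fun w => ENNReal.ofReal (‖w‖ ^ (-α))) w ≤
        ENNReal.ofReal ((1 / r + 1) ^ α) * ENNReal.ofReal ((1 + ‖w‖) ^ (-α)) := by
    intro w
    by_cases hw : w ∈ (Metric.closedBall (0 : E 3) r)ᶜ
    · have hw' : r < ‖w‖ := by simpa using hw
      have hw0 : 0 < ‖w‖ := hr.trans hw'
      rw [Set.indicator_of_mem hw, ← ENNReal.ofReal_mul (by positivity)]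
      refine ENNReal.ofReal_le_ofReal ?_
      rw [Real.rpow_neg hw0.le, Real.rpow_neg (by positivity), ← div_eq_mul_inv, inv_eq_one_div,
        div_le_div_iff₀ (by positivity) (by positivity), one_mul,
        ← Real.mul_rpow (by positivity) hw0.le]
      refine Real.rpow_le_rpow (by positivity) ?_ (by linarith)
      have : 1 ≤ 1 / r * ‖w‖ := by rw [one_div, ← div_eq_inv_mul, one_le_div hr]; exact hw'.le
      nlinarith
    · rw [Set.indicator_of_notMem hw]; exact zero_le
  refine (lintegral_mono h1).trans_lt ?_
  rw [lintegral_const_mul' _ _ ENNReal.ofReal_ne_top]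
  exact ENNReal.mul_lt_top ENNReal.ofReal_lt_top (finite_integral_one_add_norm (by simpa using hα))

/-- Young's inequality in `L¹`: integrating first in `x` turns the kernel into its total mass. -/
theorem lintegral_lintegral_sub_mul_le {U : Set (E 3)} {k S : E 3 → ℝ≥0∞} (hk : Measurable k)
    (hS : Measurable S) :
    ∫⁻ x in U, ∫⁻ y in U, k (x - y) * S y ≤ (∫⁻ w, k w) * ∫⁻ y in U, S y := by
  have hm : Measurable fun q : E 3 × E 3 => k (q.1 - q.2) * S q.2 :=
    (hk.comp (measurable_fst.sub measurable_snd)).mul (hS.comp measurable_snd)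
  rw [lintegral_lintegral_swap hm.aemeasurable, ← lintegral_const_mul _ hS]
  refine lintegral_mono fun y => ?_
  have hky : Measurable fun x => k (x - y) := hk.comp (measurable_id.sub_const y)
  rw [lintegral_mul_const _ hky]
  refine mul_le_mul_left ?_ _
  refine (setLIntegral_le_lintegral _ _).trans ?_
  rw [lintegral_sub_right_eq_self k y]

/-- No measurability of `K` is required, since splitting the integral of a sum needs only one
measurable summand. -/
theorem lintegral_lintegral_add_sum {X ι : Type*} [MeasurableSpace X] [Fintype ι] {μ : Measure X}
    [SFinite μ] {J : ι → X → X → ℝ≥0∞} (hJ : ∀ i, Measurable fun z : X × X => J i z.1 z.2)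
    {A : ℝ≥0∞} (hA : A ≠ ⊤) (K : X → X → ℝ≥0∞) :
    ∫⁻ x, ∫⁻ y, 6 * (A * ∑ i, J i x y + K x y) ∂μ ∂μ =
      6 * (A * (∑ i, ∫⁻ x, ∫⁻ y, J i x y ∂μ ∂μ) + ∫⁻ x, ∫⁻ y, K x y ∂μ ∂μ) := by
  have hJx : ∀ i x, Measurable fun y => J i x y := fun i x => (hJ i).comp measurable_prodMk_left
  have hJi : ∀ i, Measurable fun x => ∫⁻ y, J i x y ∂μ := fun i => (hJ i).lintegral_prod_right'
  have e1 : ∀ x, ∫⁻ y, 6 * (A * ∑ i, J i x y + K x y) ∂μ =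
      6 * (A * (∑ i, ∫⁻ y, J i x y ∂μ) + ∫⁻ y, K x y ∂μ) := by
    intro x
    rw [lintegral_const_mul' _ _ (by simp), lintegral_add_left
      ((Finset.measurable_fun_sum _ fun i _ => hJx i x).const_mul _),
      lintegral_const_mul' _ _ hA, lintegral_finsetSum _ fun i _ => hJx i x]
  simp only [e1]
  rw [lintegral_const_mul' _ _ (by simp), lintegral_add_left
    ((Finset.measurable_fun_sum _ fun i _ => hJi i).const_mul _),
    lintegral_const_mul' _ _ hA, lintegral_finsetSum _ fun i _ => hJi i]

/-! ### The `L²` norm and the spatial seminorm of the product -/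

section Space

variable {V W : Type*} [NormedAddCommGroup V] [NormedAddCommGroup W] {Ω : Set (E 3)}
  {l T r₀ C : ℝ} {P Q : ℝ≥0∞} {F G : ℝ × E 3 → V} {g γ : Fin 3 → ℝ × E 3 → V} {b d : ℝ → ℝ≥0∞}
  {p : ℝ × E 3 → W}

theorem HData.ae_sum_sq_le (hG : HData Ω l T r₀ C Q G γ d) :
    ∀ᵐ t ∂volume.restrict (Set.Ioo 0 T), ∫⁻ x in Ω, ∑ i, ‖γ i (t, x)‖ₑ ^ 2 ≤ 3 * Q := by
  filter_upwards [ae_all_iff.2 hG.sobolev_grad] with t ht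
  have hm : ∀ i, Measurable fun x => ‖γ i (t, x)‖ₑ ^ 2 := fun i =>
    ((hG.meas_grad i).comp_measurable measurable_prodMk_left).enorm.pow_const 2
  rw [lintegral_finsetSum _ fun i _ => hm i]
  refine (Finset.sum_le_sum fun i _ => (ht i).1).trans (le_of_eq ?_)
  simp

theorem HData.lintegral_sq_le (hF : HData Ω l T r₀ C P F g b) (hG : HData Ω l T r₀ C Q G γ d)
    (hp : IsProductBounded F γ p) (hP : P ≠ ⊤) :
    ∫⁻ t in Set.Ioo 0 T, ∫⁻ x in Ω, ‖p (t, x)‖ₑ ^ 2 ≤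
      ENNReal.ofReal (18 * C * T) * (P * Q) := by
  -- For `T ≤ 0` the time interval is empty.
  rcases le_or_gt T 0 with hT | hT
  · simp [hT]
  calc _ ≤ ∫⁻ t in Set.Ioo 0 T, 6 * (ENNReal.ofReal C * P * (3 * Q)) := by
        refine lintegral_mono_ae ?_
        filter_upwards [hF.sup, hG.ae_sum_sq_le] with t h1 h2
        calc _ ≤ ∫⁻ x in Ω, 6 * (ENNReal.ofReal C * P * ∑ i, ‖γ i (t, x)‖ₑ ^ 2) := by
              refine lintegral_mono_ae ?_
              filter_upwards [h1] with x hx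
              refine (hp.sq_le _).trans ?_
              gcongr
          _ ≤ _ := by
              rw [lintegral_const_mul' _ _ (by simp), lintegral_const_mul' _ _
                (ENNReal.mul_ne_top ENNReal.ofReal_ne_top hP)]
              gcongr
    _ = _ := by
        rw [lintegral_const, Measure.restrict_apply_univ, Real.volume_Ioo, sub_zero,
          ENNReal.ofReal_mul' hT.le, ENNReal.ofReal_mul (by norm_num),
          show ENNReal.ofReal 18 = 18 by simp]
        ring

/-- The kernel that bounds `|F(x) - F(y)|² / |x - y|^(3 + 2l)` for small `|x - y|`. -/
def nearKernel (l r₀ : ℝ) : E 3 → ℝ≥0∞ :=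
  (Metric.closedBall (0 : E 3) r₀).indicator
    fun w => ENNReal.ofReal (‖w‖ ^ (-(3 - (2 * l - 1) * (1 - l))))

/-- The kernel that bounds `1 / |x - y|^(3 + 2l)` for large `|x - y|`. -/
def farKernel (l r₀ : ℝ) : E 3 → ℝ≥0∞ :=
  (Metric.closedBall (0 : E 3) r₀)ᶜ.indicator fun w => ENNReal.ofReal (‖w‖ ^ (-(3 + 2 * l)))

theorem measurable_nearKernel : Measurable (nearKernel l r₀) :=
  Measurable.indicator (by fun_prop) Metric.isClosed_closedBall.measurableSet

theorem measurable_farKernel : Measurable (farKernel l r₀) :=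
  Measurable.indicator (by fun_prop) Metric.isClosed_closedBall.measurableSet.compl

/-- For `r ≤ r₀` the Hölder bound with weight `1 - l` and the Lipschitz bound with weight `l` give
the power `(2l - 1)(1 - l) + 2l`, leaving an integrable singularity after division. For `r > r₀`
only the bound on `|F|` is used. -/
theorem HData.ae_sub_sq_div_le (hF : HData Ω l T r₀ C P F g b) (hl : 1 / 2 < l) (hl' : l < 1)
    (hT : 0 < T) (hC : 0 < C) :
    ∀ᵐ t ∂volume.restrict (Set.Ioo 0 T), ∀ᵐ x ∂volume.restrict Ω, ∀ᵐ y ∂volume.restrict Ω,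
      ‖F (t, x) - F (t, y)‖ₑ ^ 2 / ENNReal.ofReal (‖x - y‖ ^ (((3 : ℕ) : ℝ) + 2 * l)) ≤
        nearKernel l r₀ (x - y) * (ENNReal.ofReal (T ^ (-l) * C) * (P + ENNReal.ofReal T * b t)) +
          farKernel l r₀ (x - y) * (4 * (ENNReal.ofReal C * P)) := by
  filter_upwards [hF.sup, hF.holder, hF.lip] with t h1 h2 h3
  filter_upwards [h1, h2, h3] with x hx1 hx2 hx3
  filter_upwards [h1, hx2, hx3] with y hy1 hy2 hy3
  rcases eq_or_ne x y with rfl | hxy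
  · simp
  have hr0 : 0 < ‖x - y‖ := norm_pos_iff.2 (sub_ne_zero.2 hxy)
  set r := ‖x - y‖ with hr
  have hdiv : ∀ Z : ℝ≥0∞, Z / ENNReal.ofReal (r ^ (((3 : ℕ) : ℝ) + 2 * l)) =
      ENNReal.ofReal (r ^ (-(3 + 2 * l))) * Z := by
    intro Z
    rw [Real.rpow_neg hr0.le, ENNReal.ofReal_inv_of_pos (by positivity), div_eq_mul_inv, mul_comm]
    norm_num
  rw [hdiv]
  rcases le_or_gt r r₀ with hrr | hrr
  · refine le_trans ?_ le_self_add
    have hmem : x - y ∈ Metric.closedBall (0 : E 3) r₀ := by simpa using hrr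
    rw [nearKernel, Set.indicator_of_mem hmem]
    have h4 : ‖F (t, x) - F (t, y)‖ₑ ^ 2 ≤ ENNReal.ofReal (r ^ (2 * l - 1)) *
        (ENNReal.ofReal C * P) := by
      refine (hy2 hrr).trans (le_of_eq ?_)
      rw [ENNReal.ofReal_mul hC.le]; ring
    -- Scaling `b t` by `T` gives it the same size as `P` after averaging over `(0, T)`; the
    -- compensating `T⁻¹` becomes `T^{-l}` under interpolation.
    have h5 : ‖F (t, x) - F (t, y)‖ₑ ^ 2 ≤ ENNReal.ofReal (r ^ 2 * T⁻¹) *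
        (ENNReal.ofReal C * (ENNReal.ofReal T * b t)) := by
      refine hy3.trans (le_of_eq ?_)
      rw [← mul_assoc, ← mul_assoc, ← ENNReal.ofReal_mul (by positivity),
        ← ENNReal.ofReal_mul (by positivity)]
      congr 2; field_simp
    have h6 := le_interpolation (by linarith) hl'.le h4 h5
    calc _ ≤ ENNReal.ofReal (r ^ (-(3 + 2 * l))) * _ := mul_le_mul_right h6 _
      _ = _ := by
        rw [ENNReal.ofReal_rpow_of_nonneg (by positivity) (by linarith),
          ENNReal.ofReal_rpow_of_nonneg (by positivity) (by linarith), ← mul_add,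
          ← mul_assoc, ← mul_assoc, ← mul_assoc, ← ENNReal.ofReal_mul (by positivity),
          ← ENNReal.ofReal_mul (by positivity), ← mul_assoc, ← ENNReal.ofReal_mul (by positivity),
          ← ENNReal.ofReal_mul (by positivity)]
        congr 2
        rw [Real.mul_rpow (by positivity) (by positivity), ← Real.rpow_natCast,
          ← Real.rpow_mul hr0.le, ← Real.rpow_mul hr0.le, Real.inv_rpow hT.le, ← Real.rpow_neg hT.le]
        have : r ^ (-(3 - (2 * l - 1) * (1 - l))) = r ^ (-(3 + 2 * l)) *
            (r ^ ((2 * l - 1) * (1 - l)) * r ^ (((2 : ℕ) : ℝ) * l)) := by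
          rw [← Real.rpow_add hr0, ← Real.rpow_add hr0]
          congr 1; push_cast; ring
        rw [this]; ring
  · refine le_trans ?_ le_add_self
    have hmem : x - y ∈ (Metric.closedBall (0 : E 3) r₀)ᶜ := by simpa using hrr
    rw [farKernel, Set.indicator_of_mem hmem]
    refine mul_le_mul_right ?_ _
    calc _ ≤ (‖F (t, x)‖ₑ + ‖F (t, y)‖ₑ) ^ 2 := by gcongr; exact _root_.enorm_sub_le
      _ ≤ 2 * (‖F (t, x)‖ₑ ^ 2 + ‖F (t, y)‖ₑ ^ 2) := add_sq_le_two_mul _ _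
      _ ≤ 2 * (ENNReal.ofReal C * P + ENNReal.ofReal C * P) := by gcongr
      _ = _ := by ring

/-- Once the weighted increment of `f` is bounded by a function of `x - y`, the second term of the
product splitting is a convolution-type integral and costs only the mass of `k`. -/
theorem IsProductBounded.slobodetskiiSq_le [NormedSpace ℝ V] [NormedSpace ℝ W] {f : E 3 → V} {a : Fin 3 → E 3 → V}
    {q : E 3 → W} (h : IsProductBounded f a q) (ha : ∀ i, StronglyMeasurable (a i)) {θ : ℝ}
    {A : ℝ≥0∞} (hA : A ≠ ⊤) {k : E 3 → ℝ≥0∞} (hk : Measurable k)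
    (hf : ∀ᵐ x ∂volume.restrict Ω, ‖f x‖ₑ ^ 2 ≤ A)
    (hfk : ∀ᵐ x ∂volume.restrict Ω, ∀ᵐ y ∂volume.restrict Ω,
      ‖f x - f y‖ₑ ^ 2 / ENNReal.ofReal (‖x - y‖ ^ (((3 : ℕ) : ℝ) + 2 * θ)) ≤ k (x - y)) :
    slobodetskiiSq 3 θ Ω q ≤ 6 * (A * ∑ i, slobodetskiiSq 3 θ Ω (a i) +
      (∫⁻ w, k w) * ∫⁻ y in Ω, ∑ i, ‖a i y‖ₑ ^ 2) := by
  have hSm : Measurable fun y => ∑ i, ‖a i y‖ₑ ^ 2 :=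
    Finset.measurable_fun_sum _ fun i _ => (ha i).enorm.pow_const 2
  have hJm : ∀ i, Measurable fun z : E 3 × E 3 => ‖a i z.1 - a i z.2‖ₑ ^ 2 /
      ENNReal.ofReal (‖z.1 - z.2‖ ^ (((3 : ℕ) : ℝ) + 2 * θ)) := fun i =>
    measurable_slobodetskii_integrand (ha i) θ measurable_fst measurable_snd
  refine le_trans ?_ ((lintegral_lintegral_add_sum (μ := volume.restrict Ω) (J := fun i x y =>
    ‖a i x - a i y‖ₑ ^ 2 / ENNReal.ofReal (‖x - y‖ ^ (((3 : ℕ) : ℝ) + 2 * θ))) hJm hA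
    fun x y => k (x - y) * ∑ i, ‖a i y‖ₑ ^ 2).trans_le (mul_le_mul_right (add_le_add le_rfl
      (lintegral_lintegral_sub_mul_le hk hSm)) _))
  refine lintegral_mono_ae ?_
  filter_upwards [hf, hfk] with x hx1 hx2
  refine lintegral_mono_ae ?_
  filter_upwards [hx2] with y hy
  refine (ENNReal.div_le_div_right (h.sub_sq_le x y) _).trans ?_
  rw [div_eq_mul_inv, mul_assoc, add_mul, mul_right_comm (‖f x - f y‖ₑ ^ 2), mul_assoc,
    Finset.sum_mul]
  refine mul_le_mul_right (add_le_add (mul_le_mul' hx1 le_rfl) (mul_le_mul' ?_ le_rfl)) _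
  exact hy

/-- In time, `∫ T^{-l}(P + T b(t)) dt` is of order `T^{1-l} P`; every other term is constant in `t`
and contributes `T`. -/
theorem HData.lintegral_slobodetskii_space_le [NormedSpace ℝ V] [NormedSpace ℝ W]
    (hF : HData Ω l T r₀ C P F g b) (hG : HData Ω l T r₀ C Q G γ d) (hp : IsProductBounded F γ p)
    (hl : 1 / 2 < l) (hl' : l < 1) (hT : 0 < T) (hC : 0 < C) (hP : P ≠ ⊤) (hQ : Q ≠ ⊤)
    {K : ℝ} (hK : 0 ≤ K) (hKn : ∫⁻ w, nearKernel l r₀ w ≤ ENNReal.ofReal K)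
    (hKf : ∫⁻ w, farKernel l r₀ w ≤ ENNReal.ofReal K) :
    ∫⁻ t in Set.Ioo 0 T, slobodetskiiSq 3 l Ω (fun x => p (t, x)) ≤
      ENNReal.ofReal (18 * C * ((1 + C) * K * T ^ (1 - l) + (1 + 4 * K) * T)) * (P * Q) := by
  have hCP : ENNReal.ofReal C * P ≠ ⊤ := ENNReal.mul_ne_top ENNReal.ofReal_ne_top hP
  have key : ∀ᵐ t ∂volume.restrict (Set.Ioo 0 T), slobodetskiiSq 3 l Ω (fun x => p (t, x)) ≤
      6 * (ENNReal.ofReal C * P * (3 * Q) + (ENNReal.ofReal K * (ENNReal.ofReal (T ^ (-l) * C) *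
        (P + ENNReal.ofReal T * b t)) + ENNReal.ofReal K * (4 * (ENNReal.ofReal C * P))) *
          (3 * Q)) := by
    filter_upwards [hF.sup, hF.ae_sub_sq_div_le hl hl' hT hC, hG.ae_sum_sq_le,
      ae_all_iff.2 hG.sobolev_grad] with t h1 h2 h3 h4
    have hker : Measurable fun w => nearKernel l r₀ w *
        (ENNReal.ofReal (T ^ (-l) * C) * (P + ENNReal.ofReal T * b t)) +
          farKernel l r₀ w * (4 * (ENNReal.ofReal C * P)) :=
      (measurable_nearKernel.mul_const _).add (measurable_farKernel.mul_const _)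
    refine ((hp.comp fun x => (t, x)).slobodetskiiSq_le (fun i =>
      (hG.meas_grad i).comp_measurable measurable_prodMk_left) hCP hker h1 h2).trans ?_
    refine mul_le_mul_right (add_le_add (mul_le_mul_right ?_ _) (mul_le_mul' ?_ h3)) _
    · refine (Finset.sum_le_sum fun i _ => ?_).trans (le_of_eq (a := ∑ i : Fin 3, Q) ?_)
      · unfold slobodetskiiSq; exact_mod_cast (h4 i).2
      · simp
    · rw [lintegral_add_left (measurable_nearKernel.mul_const _),
        lintegral_mul_const _ measurable_nearKernel,
        lintegral_mul_const _ measurable_farKernel]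
      exact add_le_add (mul_le_mul_left hKn _) (mul_le_mul_left hKf _)
  have h3Q : 3 * Q ≠ ⊤ := ENNReal.mul_ne_top (by simp) hQ
  calc _ ≤ _ := lintegral_mono_ae key
    _ = 6 * (ENNReal.ofReal C * P * (3 * Q) * ENNReal.ofReal T + (ENNReal.ofReal K *
        (ENNReal.ofReal (T ^ (-l) * C) * (P * ENNReal.ofReal T + ENNReal.ofReal T *
          ∫⁻ t in Set.Ioo 0 T, b t)) + ENNReal.ofReal K * (4 * (ENNReal.ofReal C * P)) *
            ENNReal.ofReal T) * (3 * Q)) := by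
        rw [lintegral_const_mul' _ _ (by simp), lintegral_add_left measurable_const,
          lintegral_const, lintegral_mul_const' _ _ h3Q, lintegral_add_right _ measurable_const,
          lintegral_const_mul' _ _ ENNReal.ofReal_ne_top,
          lintegral_const_mul' _ _ ENNReal.ofReal_ne_top, lintegral_add_left measurable_const,
          lintegral_const_mul' _ _ ENNReal.ofReal_ne_top]
        simp only [lintegral_const, Measure.restrict_apply_univ, Real.volume_Ioo, sub_zero]
    _ ≤ 6 * (ENNReal.ofReal C * P * (3 * Q) * ENNReal.ofReal T + (ENNReal.ofReal K *
        (ENNReal.ofReal (T ^ (-l) * C) * (P * ENNReal.ofReal T + ENNReal.ofReal T *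
          (ENNReal.ofReal C * P))) + ENNReal.ofReal K * (4 * (ENNReal.ofReal C * P)) *
            ENNReal.ofReal T) * (3 * Q)) := by
        gcongr
        exact hF.lintegral_b
    _ = _ := by
        rw [Real.rpow_sub hT, Real.rpow_one, Real.rpow_neg hT.le]
        have hTl : 0 < T ^ l := by positivity
        rw [show 18 * C * ((1 + C) * K * (T / T ^ l) + (1 + 4 * K) * T) =
          6 * (C * 3 * T + (K * ((T ^ l)⁻¹ * C * (T + T * C)) + K * (4 * C) * T) * 3) by
            field_simp; ring]
        simp (disch := positivity) only [ENNReal.ofReal_mul, ENNReal.ofReal_add,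
          ENNReal.ofReal_ofNat]
        ring

end Space

/-! ### The time seminorm of the product -/

theorem setLIntegral_setLIntegral_eq_shift {I : Set ℝ} (hI : MeasurableSet I) {H : ℝ × ℝ → ℝ≥0∞}
    (hH : Measurable H) :
    ∫⁻ t in I, ∫⁻ s in I, H (t, s) = ∫⁻ r, ∫⁻ s in {s | s ∈ I ∧ s + r ∈ I}, H (s + r, s) := by
  have hS : ∀ r, MeasurableSet {s | s + r ∈ I} := fun r => measurable_add_const r hI
  have hm : Measurable fun q : ℝ × ℝ => I.indicator (fun t => H (t, q.1)) (q.1 + q.2) := by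
    have : (fun q : ℝ × ℝ => I.indicator (fun t => H (t, q.1)) (q.1 + q.2)) =
        ((fun q : ℝ × ℝ => q.1 + q.2) ⁻¹' I).indicator fun q => H (q.1 + q.2, q.1) := by
      funext q
      by_cases hq : q.1 + q.2 ∈ I
      · rw [Set.indicator_of_mem hq, Set.indicator_of_mem (by exact hq)]
      · rw [Set.indicator_of_notMem hq, Set.indicator_of_notMem (by exact hq)]
    rw [this]
    exact Measurable.indicator (hH.comp (by fun_prop)) (measurable_add hI)
  calc ∫⁻ t in I, ∫⁻ s in I, H (t, s) = ∫⁻ s in I, ∫⁻ t in I, H (t, s) :=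
        lintegral_lintegral_swap hH.aemeasurable
    _ = ∫⁻ s in I, ∫⁻ r, I.indicator (fun t => H (t, s)) (s + r) := by
        refine lintegral_congr fun s => ?_
        rw [lintegral_add_left_eq_self (I.indicator fun t => H (t, s)) s, lintegral_indicator hI]
    _ = ∫⁻ r, ∫⁻ s in I, I.indicator (fun t => H (t, s)) (s + r) :=
        lintegral_lintegral_swap hm.aemeasurable
    _ = _ := by
        refine lintegral_congr fun r => ?_
        rw [show {s | s ∈ I ∧ s + r ∈ I} = {s | s + r ∈ I} ∩ I from Set.inter_comm _ _,
          ← Measure.restrict_restrict (hS r), ← lintegral_indicator (hS r)]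
        refine lintegral_congr fun s => ?_
        by_cases hs : s + r ∈ I
        · rw [Set.indicator_of_mem hs, Set.indicator_of_mem (by exact hs)]
        · rw [Set.indicator_of_notMem hs, Set.indicator_of_notMem (by exact hs)]

theorem setLIntegral_abs_rpow_neg_le {l T : ℝ} (hl' : l < 1) (hT : 0 < T) :
    ∫⁻ r in Set.Ioo (-T) T, ENNReal.ofReal (|r| ^ (-l)) ≤
      ENNReal.ofReal (2 / (1 - l) * T ^ (1 - l)) := by
  have h1 : ∫⁻ r in Set.Ioc 0 T, ENNReal.ofReal (|r| ^ (-l)) =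
      ENNReal.ofReal (T ^ (1 - l) / (1 - l)) := by
    rw [← lintegral_Ioc_rpow_neg hl' hT]
    refine setLIntegral_congr_fun measurableSet_Ioc fun r hr => ?_
    simp only [abs_of_pos hr.1]
  have h2 : ∫⁻ r in Neg.neg ⁻¹' Set.Ioc 0 T, ENNReal.ofReal (|r| ^ (-l)) =
      ENNReal.ofReal (T ^ (1 - l) / (1 - l)) := by
    rw [← h1, ← (Measure.measurePreserving_neg (volume : Measure ℝ)).setLIntegral_comp_preimage
      measurableSet_Ioc (by fun_prop)]
    simp only [abs_neg]
  have h3 : Set.Ioo (-T) T ⊆ (Neg.neg ⁻¹' Set.Ioc 0 T ∪ Set.Ioc 0 T) ∪ {0} := by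
    intro r hr
    rcases lt_trichotomy r 0 with h | h | h
    · exact Or.inl (Or.inl ⟨by linarith, by linarith [hr.1]⟩)
    · exact Or.inr h
    · exact Or.inl (Or.inr ⟨h, hr.2.le⟩)
  refine (lintegral_mono_set h3).trans ((lintegral_union_le _ _ _).trans ?_)
  rw [setLIntegral_measure_zero _ _ Real.volume_singleton, add_zero]
  refine (lintegral_union_le _ _ _).trans (le_of_eq ?_)
  have h1l : 0 < 1 - l := by linarith
  rw [h1, h2, ← ENNReal.ofReal_add (by positivity) (by positivity)]
  congr 1; ring

section Time

variable {V W : Type*} [NormedAddCommGroup V] [NormedAddCommGroup W] {Ω : Set (E 3)}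
  {l T r₀ C : ℝ} {P Q : ℝ≥0∞} {F G : ℝ × E 3 → V} {g γ : Fin 3 → ℝ × E 3 → V} {b d : ℝ → ℝ≥0∞}
  {p : ℝ × E 3 → W}

/-- In the splitting, `F` is taken in sup norm at time `s + r` and the increment of `∇G` in `L²`, by
interpolation. Conversely `∇G` is taken in sup norm at time `s` and the increment of `F` in `L²`,
with its factor `|r|`. -/
theorem HData.ae_lintegral_time_sub_sq_le (hF : HData Ω l T r₀ C P F g b)
    (hG : HData Ω l T r₀ C Q G γ d) (hp : IsProductBounded F γ p) (hP : P ≠ ⊤)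
    {r : ℝ} (hr : r ≠ 0) :
    ∀ᵐ s, s ∈ Set.Ioo 0 T → s + r ∈ Set.Ioo 0 T →
      ∫⁻ x in Ω, ‖p (s + r, x) - p (s, x)‖ₑ ^ 2 ≤
        6 * (ENNReal.ofReal C * P * (3 * ((ENNReal.ofReal |r|)⁻¹ * (ENNReal.ofReal C *
          ((∫⁻ x in Ω, ‖G (s + r, x) - G (s, x)‖ₑ ^ 2) +
            ENNReal.ofReal (r ^ 2) * (d (s + r) + d s))))) +
          ENNReal.ofReal |r| * P * (3 * d s)) := by
  have h1 := (ae_restrict_iff' measurableSet_Ioo).1 hF.sup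
  have h2 := (ae_restrict_iff' measurableSet_Ioo).1 (ae_all_iff.2 hG.sup_grad)
  have h1' := (measurePreserving_add_right volume r).quasiMeasurePreserving.ae h1
  filter_upwards [h1', h2, hF.time r, ae_all_iff.2 (hG.interp r hr)] with s hs1 hs2 hs3 hs4 hs0 hsr
  have hCP : ENNReal.ofReal C * P ≠ ⊤ := ENNReal.mul_ne_top ENNReal.ofReal_ne_top hP
  have hr0 : ENNReal.ofReal |r| ≠ 0 := by simpa using hr
  have hγm : ∀ i, Measurable fun x => ‖γ i (s + r, x) - γ i (s, x)‖ₑ ^ 2 := fun i =>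
    (((hG.meas_grad i).comp_measurable measurable_prodMk_left).sub
      ((hG.meas_grad i).comp_measurable measurable_prodMk_left)).enorm.pow_const 2
  have hFm : Measurable fun x => ‖F (s + r, x) - F (s, x)‖ₑ ^ 2 :=
    ((hF.meas.comp_measurable measurable_prodMk_left).sub
      (hF.meas.comp_measurable measurable_prodMk_left)).enorm.pow_const 2
  have hSm : Measurable fun x => ∑ i, ‖γ i (s + r, x) - γ i (s, x)‖ₑ ^ 2 :=
    Finset.measurable_fun_sum _ fun i _ => hγm i
  calc _ ≤ ∫⁻ x in Ω, 6 * (ENNReal.ofReal C * P * ∑ i, ‖γ i (s + r, x) - γ i (s, x)‖ₑ ^ 2 +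
        ‖F (s + r, x) - F (s, x)‖ₑ ^ 2 * (3 * d s)) := by
        refine lintegral_mono_ae ?_
        filter_upwards [hs1 hsr, ae_all_iff.2 (hs2 hs0)] with x hx1 hx2
        refine (hp.sub_sq_le _ _).trans ?_
        refine mul_le_mul_right (add_le_add (mul_le_mul_left hx1 _) (mul_le_mul_right ?_ _)) _
        refine (Finset.sum_le_sum fun i _ => hx2 i).trans (le_of_eq ?_)
        simp
    _ = 6 * (ENNReal.ofReal C * P * (∑ i, ∫⁻ x in Ω, ‖γ i (s + r, x) - γ i (s, x)‖ₑ ^ 2) +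
        (∫⁻ x in Ω, ‖F (s + r, x) - F (s, x)‖ₑ ^ 2) * (3 * d s)) := by
        rw [lintegral_const_mul' _ _ (by simp), lintegral_add_left (hSm.const_mul _),
          lintegral_const_mul' _ _ hCP, lintegral_finsetSum _ fun i _ => hγm i,
          lintegral_mul_const _ hFm]
    _ ≤ _ := by
        refine mul_le_mul_right (add_le_add (mul_le_mul_right ?_ _)
          (mul_le_mul_left (hs3 hs0 hsr) _)) _
        refine (Finset.sum_le_sum fun i _ =>
          le_inv_mul_of_mul_le hr0 ENNReal.ofReal_ne_top (hs4 i hs0 hsr)).trans (le_of_eq ?_)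
        simp

/-- Integration in `s` upgrades the increments of `G` to `r²`, and this cancels the `|r|⁻¹` from
interpolation; the other term is already linear in `|r|`, since `d` is integrable. -/
theorem HData.lintegral_time_sub_sq_le (hF : HData Ω l T r₀ C P F g b)
    (hG : HData Ω l T r₀ C Q G γ d) (hp : IsProductBounded F γ p) (hP : P ≠ ⊤) (hC : 0 < C)
    {r : ℝ} (hr : r ≠ 0) :
    ∫⁻ s in {s | s ∈ Set.Ioo 0 T ∧ s + r ∈ Set.Ioo 0 T},
      ∫⁻ x in Ω, ‖p (s + r, x) - p (s, x)‖ₑ ^ 2 ≤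
        ENNReal.ofReal |r| * (ENNReal.ofReal (18 * C ^ 2 * (1 + 2 * C) + 18 * C) * (P * Q)) := by
  set S := {s | s ∈ Set.Ioo 0 T ∧ s + r ∈ Set.Ioo 0 T} with hSdef
  have hS : MeasurableSet S :=
    measurableSet_Ioo.inter (measurableSet_Ioo.preimage (measurable_add_const r))
  have hr0 : 0 < |r| := abs_pos.2 hr
  have hinv : (ENNReal.ofReal |r|)⁻¹ = ENNReal.ofReal |r|⁻¹ := (ENNReal.ofReal_inv_of_pos hr0).symm
  have hCP : ENNReal.ofReal C * P ≠ ⊤ := ENNReal.mul_ne_top ENNReal.ofReal_ne_top hP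
  have hrP : ENNReal.ofReal |r| * P ≠ ⊤ := ENNReal.mul_ne_top ENNReal.ofReal_ne_top hP
  have hdr : Measurable fun s => d (s + r) := hG.meas_b.comp (measurable_add_const r)
  have hGm : Measurable fun s => ∫⁻ x in Ω, ‖G (s + r, x) - G (s, x)‖ₑ ^ 2 := by
    refine Measurable.lintegral_prod_right' (f := fun q : ℝ × E 3 =>
      ‖G (q.1 + r, q.2) - G (q.1, q.2)‖ₑ ^ 2) ?_
    exact ((hG.meas.comp_measurable (by fun_prop)).sub
      (hG.meas.comp_measurable (by fun_prop))).enorm.pow_const 2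
  have hd1 : ∫⁻ s in S, d s ≤ ENNReal.ofReal C * Q :=
    (lintegral_mono_set fun s hs => hs.1).trans hG.lintegral_b
  have hd2 : ∫⁻ s in S, d (s + r) ≤ ENNReal.ofReal C * Q := by
    refine le_trans ?_ hG.lintegral_b
    rw [← (measurePreserving_add_right volume r).setLIntegral_comp_preimage measurableSet_Ioo
      hG.meas_b]
    exact lintegral_mono_set fun s hs => hs.2
  calc _ ≤ ∫⁻ s in S, 6 * (ENNReal.ofReal C * P * (3 * ((ENNReal.ofReal |r|)⁻¹ * (ENNReal.ofReal C *
          ((∫⁻ x in Ω, ‖G (s + r, x) - G (s, x)‖ₑ ^ 2) +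
            ENNReal.ofReal (r ^ 2) * (d (s + r) + d s))))) +
          ENNReal.ofReal |r| * P * (3 * d s)) := by
        refine lintegral_mono_ae ?_
        filter_upwards [ae_restrict_mem hS,
          ae_restrict_of_ae (hF.ae_lintegral_time_sub_sq_le hG hp hP hr)] with s hs h
          using h hs.1 hs.2
    _ = 6 * (ENNReal.ofReal C * P * (3 * ((ENNReal.ofReal |r|)⁻¹ * (ENNReal.ofReal C *
          ((∫⁻ s in S, ∫⁻ x in Ω, ‖G (s + r, x) - G (s, x)‖ₑ ^ 2) +
            ENNReal.ofReal (r ^ 2) * ((∫⁻ s in S, d (s + r)) + ∫⁻ s in S, d s))))) +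
          ENNReal.ofReal |r| * P * (3 * ∫⁻ s in S, d s)) := by
        rw [lintegral_const_mul' _ _ (by simp), lintegral_add_right _
          ((hG.meas_b.const_mul _).const_mul _), lintegral_const_mul' _ _ hCP,
          lintegral_const_mul' _ _ (by simp), lintegral_const_mul' _ _ (by simpa using hr),
          lintegral_const_mul' _ _ ENNReal.ofReal_ne_top, lintegral_add_left hGm,
          lintegral_const_mul' _ _ ENNReal.ofReal_ne_top, lintegral_add_left hdr,
          lintegral_const_mul' _ _ hrP, lintegral_const_mul' _ _ (by simp)]
    _ ≤ 6 * (ENNReal.ofReal C * P * (3 * ((ENNReal.ofReal |r|)⁻¹ * (ENNReal.ofReal C *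
          (ENNReal.ofReal (r ^ 2) * Q +
            ENNReal.ofReal (r ^ 2) * (ENNReal.ofReal C * Q + ENNReal.ofReal C * Q))))) +
          ENNReal.ofReal |r| * P * (3 * (ENNReal.ofReal C * Q))) := by
        gcongr
        exact hG.lintegral_time r
    _ = _ := by
        have h3 : (ENNReal.ofReal |r|)⁻¹ * ENNReal.ofReal (r ^ 2) = ENNReal.ofReal |r| := by
          rw [hinv, ← ENNReal.ofReal_mul (by positivity), ← sq_abs, sq, ← mul_assoc,
            inv_mul_cancel₀ hr0.ne', one_mul]
        calc _ = 6 * (ENNReal.ofReal C * P * (3 * (((ENNReal.ofReal |r|)⁻¹ *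
              ENNReal.ofReal (r ^ 2)) * (ENNReal.ofReal C *
              (Q + (ENNReal.ofReal C * Q + ENNReal.ofReal C * Q))))) +
              ENNReal.ofReal |r| * P * (3 * (ENNReal.ofReal C * Q))) := by ring
          _ = _ := by
            rw [h3]
            simp (disch := positivity) only [ENNReal.ofReal_mul, ENNReal.ofReal_add,
              ENNReal.ofReal_ofNat, ENNReal.ofReal_pow, ENNReal.ofReal_one]
            ring

/-- Tonelli moves the `x` integral inside and `t = s + r` isolates the lag; the remaining weight
`|r|·|r|^{-1-l}` is integrable over `|r| < T` because `l < 1`. -/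
theorem HData.lintegral_slobodetskii_time_le [NormedSpace ℝ V] [NormedSpace ℝ W]
    (hF : HData Ω l T r₀ C P F g b)
    (hG : HData Ω l T r₀ C Q G γ d) (hpm : StronglyMeasurable p) (hp : IsProductBounded F γ p)
    (hl' : l < 1) (hT : 0 < T) (hC : 0 < C) (hP : P ≠ ⊤) (hQ : Q ≠ ⊤) :
    ∫⁻ x in Ω, slobodetskiiSq 1 (l / 2) (Set.Ioo 0 T) (fun t => p (t, x)) ≤
      ENNReal.ofReal (2 / (1 - l) * (18 * C ^ 2 * (1 + 2 * C) + 18 * C) * T ^ (1 - l)) *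
        (P * Q) := by
  set κ := ENNReal.ofReal (18 * C ^ 2 * (1 + 2 * C) + 18 * C) * (P * Q) with hκ
  have hκt : κ ≠ ⊤ := ENNReal.mul_ne_top ENNReal.ofReal_ne_top (ENNReal.mul_ne_top hP hQ)
  have hfm : Measurable fun q : (E 3 × ℝ) × ℝ => ‖p (q.1.2, q.1.1) - p (q.2, q.1.1)‖ₑ ^ 2 /
      ENNReal.ofReal (‖q.1.2 - q.2‖ ^ (((1 : ℕ) : ℝ) + 2 * (l / 2))) :=
    Measurable.div (((hpm.comp_measurable (by fun_prop)).sub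
      (hpm.comp_measurable (by fun_prop))).enorm.pow_const 2) (by fun_prop)
  have hfm' : Measurable fun q : (ℝ × ℝ) × E 3 => ‖p (q.1.1, q.2) - p (q.1.2, q.2)‖ₑ ^ 2 :=
    ((hpm.comp_measurable (by fun_prop)).sub
      (hpm.comp_measurable (by fun_prop))).enorm.pow_const 2
  have hHm : Measurable fun q : ℝ × ℝ => (∫⁻ x in Ω, ‖p (q.1, x) - p (q.2, x)‖ₑ ^ 2) /
      ENNReal.ofReal (‖q.1 - q.2‖ ^ (((1 : ℕ) : ℝ) + 2 * (l / 2))) :=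
    Measurable.div hfm'.lintegral_prod_right' (by fun_prop)
  have hsw : ∀ t, Measurable fun q : E 3 × ℝ => ‖p (t, q.1) - p (q.2, q.1)‖ₑ ^ 2 /
      ENNReal.ofReal (‖t - q.2‖ ^ (((1 : ℕ) : ℝ) + 2 * (l / 2))) := fun t =>
    hfm.comp (g := fun q : (E 3 × ℝ) × ℝ => ‖p (q.1.2, q.1.1) - p (q.2, q.1.1)‖ₑ ^ 2 /
      ENNReal.ofReal (‖q.1.2 - q.2‖ ^ (((1 : ℕ) : ℝ) + 2 * (l / 2))))
      (f := fun q : E 3 × ℝ => ((q.1, t), q.2)) (by fun_prop)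
  have hsx : ∀ t s, Measurable fun x => ‖p (t, x) - p (s, x)‖ₑ ^ 2 := fun t s =>
    ((hpm.comp_measurable measurable_prodMk_left).sub
      (hpm.comp_measurable measurable_prodMk_left)).enorm.pow_const 2
  unfold slobodetskiiSq
  calc _ = ∫⁻ t in Set.Ioo 0 T, ∫⁻ x in Ω, ∫⁻ s in Set.Ioo 0 T, ‖p (t, x) - p (s, x)‖ₑ ^ 2 /
        ENNReal.ofReal (‖t - s‖ ^ (((1 : ℕ) : ℝ) + 2 * (l / 2))) :=
        lintegral_lintegral_swap hfm.lintegral_prod_right'.aemeasurable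
    _ = ∫⁻ t in Set.Ioo 0 T, ∫⁻ s in Set.Ioo 0 T, (∫⁻ x in Ω, ‖p (t, x) - p (s, x)‖ₑ ^ 2) /
        ENNReal.ofReal (‖t - s‖ ^ (((1 : ℕ) : ℝ) + 2 * (l / 2))) := by
        refine lintegral_congr fun t => ?_
        rw [lintegral_lintegral_swap (hsw t).aemeasurable]
        refine lintegral_congr fun s => ?_
        simp only [div_eq_mul_inv]
        rw [lintegral_mul_const _ (hsx t s)]
    _ = ∫⁻ r, ∫⁻ s in {s | s ∈ Set.Ioo 0 T ∧ s + r ∈ Set.Ioo 0 T},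
        (∫⁻ x in Ω, ‖p (s + r, x) - p (s, x)‖ₑ ^ 2) /
        ENNReal.ofReal (‖s + r - s‖ ^ (((1 : ℕ) : ℝ) + 2 * (l / 2))) :=
        setLIntegral_setLIntegral_eq_shift measurableSet_Ioo hHm
    _ ≤ ∫⁻ r, (Set.Ioo (-T) T).indicator (fun r => ENNReal.ofReal (|r| ^ (-l))) r * κ := by
        refine lintegral_mono_ae ?_
        have h0 : ∀ᵐ r : ℝ, r ≠ 0 := by
          rw [ae_iff]; simp
        filter_upwards [h0] with r hr
        have hr0 : 0 < |r| := abs_pos.2 hr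
        by_cases hrT : r ∈ Set.Ioo (-T) T
        · rw [Set.indicator_of_mem hrT]
          have e : ((1 : ℕ) : ℝ) + 2 * (l / 2) = 1 + l := by push_cast; ring
          have hw : ENNReal.ofReal (|r| ^ (1 + l)) ≠ 0 := by
            rw [ne_eq, ENNReal.ofReal_eq_zero, not_le]; positivity
          simp only [add_sub_cancel_left, Real.norm_eq_abs, e]
          simp only [div_eq_mul_inv]
          rw [lintegral_mul_const' _ _ (ENNReal.inv_ne_top.2 hw)]
          refine (mul_le_mul_left (hF.lintegral_time_sub_sq_le hG hp hP hC hr) _).trans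
            (le_of_eq ?_)
          rw [← hκ, mul_right_comm, ← ENNReal.ofReal_inv_of_pos (by positivity),
            ← ENNReal.ofReal_mul hr0.le, ← Real.rpow_neg hr0.le]
          congr 2
          nth_rewrite 1 [← Real.rpow_one |r|]
          rw [← Real.rpow_add hr0]
          congr 1; ring
        -- No two times in `(0, T)` differ by `T` or more, so large lags contribute nothing.
        · have : {s | s ∈ Set.Ioo 0 T ∧ s + r ∈ Set.Ioo 0 T} = ∅ := by
            rw [Set.eq_empty_iff_forall_notMem]
            rintro s ⟨hs, hs'⟩
            exact hrT ⟨by linarith [hs.2, hs'.1], by linarith [hs.1, hs'.2]⟩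
          rw [this, Measure.restrict_empty, lintegral_zero_measure]
          exact zero_le
    _ = (∫⁻ r in Set.Ioo (-T) T, ENNReal.ofReal (|r| ^ (-l))) * κ := by
        rw [lintegral_mul_const' _ _ hκt, lintegral_indicator measurableSet_Ioo]
    _ ≤ ENNReal.ofReal (2 / (1 - l) * T ^ (1 - l)) * κ :=
        mul_le_mul_left (setLIntegral_abs_rpow_neg_le hl' hT) _
    _ = _ := by
        have h1l : 0 < 1 - l := by linarith
        rw [hκ, ← mul_assoc, ← ENNReal.ofReal_mul (by positivity)]
        congr 2; ring

end Time

/-! ### Uniqueness of weak derivatives, bilinear products and the final estimate -/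

theorem HasWeakDeriv.ae_unique {X V : Type*} [NormedAddCommGroup X] [NormedSpace ℝ X]
    [FiniteDimensional ℝ X] [MeasureSpace X] [BorelSpace X] [NormedAddCommGroup V]
    [NormedSpace ℝ V] [CompleteSpace V] {U : Set X} (hU : IsOpen U) {e : X} {u v v' : X → V}
    (h : HasWeakDeriv U e u v) (h' : HasWeakDeriv U e u v') : v =ᵐ[volume.restrict U] v' := by
  have hL : LocallyIntegrableOn (v - v') U volume := h.2.1.sub h'.2.1
  have := hU.ae_eq_zero_of_integral_contDiff_smul_eq_zero hL fun φ hφ hc hs => by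
    have hint : ∀ {f : X → V}, LocallyIntegrableOn f U volume →
        IntegrableOn (fun x => φ x • f x) U := fun {f} hf => by
      have h1 : IntegrableOn (fun x => φ x • f x) (tsupport φ) :=
        (hf.integrableOn_compact_subset hs hc).continuousOn_smul hφ.continuous.continuousOn hc
      have h2 : Integrable (fun x => φ x • f x) :=
        (integrableOn_iff_integrable_of_support_subset fun x hx => subset_tsupport φ
          (by contrapose! hx; simp [Function.notMem_support.1 hx])).1 h1
      exact h2.integrableOn
    have h3 : ∫ x in U, φ x • v x = ∫ x in U, φ x • v' x := by
      have h4 := h.2.2 φ hφ hc hs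
      rw [h'.2.2 φ hφ hc hs] at h4
      exact (neg_injective h4).symm
    have h5 : ∫ x, φ x • (v - v') x = ∫ x in U, φ x • (v - v') x := by
      refine (setIntegral_eq_integral_of_forall_compl_eq_zero fun x hx => ?_).symm
      rw [image_eq_zero_of_notMem_tsupport fun hx' => hx (hs hx'), zero_smul]
    rw [h5]
    simp only [Pi.sub_apply, smul_sub]
    rw [integral_sub (hint h.2.1) (hint h'.2.1), h3, sub_self]
  rw [EventuallyEq, ae_restrict_iff' hU.measurableSet]
  filter_upwards [this] with x hx hxU
  exact sub_eq_zero.1 (hx hxU)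

/-- The `L²` norm occurs three times: in the spatial norm, in the time norm, and with weight
`T^{-l}`. Almost every slice of `q` in either variable agrees with that of `p`, by Fubini. -/
theorem lSq_le_of_ae_eq {V : Type*} [NormedAddCommGroup V] [NormedSpace ℝ V] {Ω : Set (E 3)}
    {l T : ℝ} (hl : 0 < l) (hl' : l < 1) {q p : ℝ × E 3 → V}
    (hpm : StronglyMeasurable p) (hq : q =ᵐ[volume.restrict (cyl Ω T)] p) :
    lSq l Ω T q ≤ (∫⁻ t in Set.Ioo 0 T, slobodetskiiSq 3 l Ω (fun x => p (t, x))) +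
      (∫⁻ x in Ω, slobodetskiiSq 1 (l / 2) (Set.Ioo 0 T) (fun t => p (t, x))) +
      (2 + ENNReal.ofReal (T ^ (-l))) * ∫⁻ t in Set.Ioo 0 T, ∫⁻ x in Ω, ‖p (t, x)‖ₑ ^ 2 := by
  have hq2 := hq
  unfold cyl at hq2
  rw [Measure.volume_eq_prod, ← Measure.prod_restrict] at hq2
  have h1 : ∀ᵐ t ∂volume.restrict (Set.Ioo 0 T),
      (fun x => q (t, x)) =ᵐ[volume.restrict Ω] fun x => p (t, x) := Measure.ae_ae_of_ae_prod hq2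
  have h2 : ∀ᵐ x ∂volume.restrict Ω,
      (fun t => q (t, x)) =ᵐ[volume.restrict (Set.Ioo 0 T)] fun t => p (t, x) := by
    rw [← Measure.prod_swap] at hq2
    exact Measure.ae_ae_of_ae_prod (ae_of_ae_map measurable_swap.aemeasurable hq2)
  have hm2 : Measurable fun z : ℝ × E 3 => ‖p z‖ₑ ^ 2 := hpm.enorm.pow_const 2
  have e1 : ∫⁻ t in Set.Ioo 0 T, sobolevSq (dirE 3) l Ω (fun x => q (t, x)) =
      (∫⁻ t in Set.Ioo 0 T, ∫⁻ x in Ω, ‖p (t, x)‖ₑ ^ 2) +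
        ∫⁻ t in Set.Ioo 0 T, slobodetskiiSq 3 l Ω (fun x => p (t, x)) := by
    rw [← lintegral_add_left hm2.lintegral_prod_right']
    refine lintegral_congr_ae ?_
    filter_upwards [h1] with t ht
    rw [sobolevSq_eq hl hl' ((hpm.comp_measurable
      measurable_prodMk_left).aestronglyMeasurable.congr ht.symm), l2Sq_congr ht,
      slobodetskiiSq_congr ht]
    rfl
  have e2 : ∫⁻ x in Ω, sobolevSq dirR (l / 2) (Set.Ioo 0 T) (fun t => q (t, x)) =
      (∫⁻ t in Set.Ioo 0 T, ∫⁻ x in Ω, ‖p (t, x)‖ₑ ^ 2) +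
        ∫⁻ x in Ω, slobodetskiiSq 1 (l / 2) (Set.Ioo 0 T) (fun t => p (t, x)) := by
    rw [lintegral_lintegral_swap (f := fun t x => ‖p (t, x)‖ₑ ^ 2) hm2.aemeasurable,
      ← lintegral_add_left hm2.lintegral_prod_left']
    refine lintegral_congr_ae ?_
    filter_upwards [h2] with t ht
    rw [sobolevSq_eq (by linarith) (by linarith) ((hpm.comp_measurable
      measurable_prodMk_right).aestronglyMeasurable.congr ht.symm), l2Sq_congr ht,
      slobodetskiiSq_congr ht]
    rfl
  have e3 : l2Sq (cyl Ω T) q = ∫⁻ t in Set.Ioo 0 T, ∫⁻ x in Ω, ‖p (t, x)‖ₑ ^ 2 := by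
    rw [l2Sq_congr hq]
    unfold l2Sq cyl
    rw [Measure.volume_eq_prod, ← Measure.prod_restrict, lintegral_prod _ hm2.aemeasurable]
  unfold lSq anisoSq
  rw [e1, e2, e3]
  apply le_of_eq
  ring

/-- A bilinear product of a vector with a triple of vectors, bounded in the natural norms. -/
structure IsBoundedProduct {V W : Type*} [NormedAddCommGroup V] [NormedAddCommGroup W]
    (B : V → (Fin 3 → V) → W) : Prop where
  continuous : Continuous fun z : V × (Fin 3 → V) => B z.1 z.2
  sub_eq : ∀ f f' a a', B f a - B f' a' = B f (a - a') + B (f - f') a'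
  sq_le : ∀ f a, ‖B f a‖ₑ ^ 2 ≤ 3 * (‖f‖ₑ ^ 2 * ∑ i, ‖a i‖ₑ ^ 2)

theorem IsBoundedProduct.isProductBounded {Z V W : Type*} [NormedAddCommGroup V]
    [NormedAddCommGroup W] {B : V → (Fin 3 → V) → W} (h : IsBoundedProduct B) (F : Z → V)
    (γ : Fin 3 → Z → V) : IsProductBounded F γ fun z => B (F z) fun i => γ i z where
  sq_le z := (h.sq_le _ _).trans (by gcongr; norm_num)
  sub_sq_le z z' := by
    rw [h.sub_eq]
    calc _ ≤ (‖B (F z) ((fun i => γ i z) - fun i => γ i z')‖ₑ +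
          ‖B (F z - F z') fun i => γ i z'‖ₑ) ^ 2 := by gcongr; exact enorm_add_le _ _
      _ ≤ 2 * (‖B (F z) ((fun i => γ i z) - fun i => γ i z')‖ₑ ^ 2 +
          ‖B (F z - F z') fun i => γ i z'‖ₑ ^ 2) := add_sq_le_two_mul _ _
      _ ≤ 2 * (3 * (‖F z‖ₑ ^ 2 * ∑ i, ‖γ i z - γ i z'‖ₑ ^ 2) +
          3 * (‖F z - F z'‖ₑ ^ 2 * ∑ i, ‖γ i z'‖ₑ ^ 2)) :=
          mul_le_mul_right (add_le_add (h.sq_le _ _) (h.sq_le _ _)) _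
      _ = _ := by ring

theorem enorm_apply_le (f : E 3) (a : Fin 3) : ‖f a‖ₑ ≤ ‖f‖ₑ :=
  enorm_le_iff_norm_le.2 (PiLp.norm_apply_le f a)

theorem isBoundedProduct_smul (a i : Fin 3) :
    IsBoundedProduct fun (f : E 3) (v : Fin 3 → E 3) => f a • v i where
  continuous := by fun_prop
  sub_eq f f' v v' := by simp only [Pi.sub_apply, PiLp.sub_apply]; module
  sq_le f v := by
    rw [enorm_smul, mul_pow]
    calc _ ≤ ‖f‖ₑ ^ 2 * ∑ i, ‖v i‖ₑ ^ 2 := by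
          gcongr
          · exact enorm_apply_le f a
          · exact Finset.single_le_sum (f := fun i => ‖v i‖ₑ ^ 2) (fun _ _ => zero_le)
              (Finset.mem_univ i)
      _ ≤ _ := le_mul_of_one_le_left zero_le (by norm_num)

theorem isBoundedProduct_sum :
    IsBoundedProduct fun (f : E 3) (v : Fin 3 → E 3) => ∑ i, f i • v i where
  continuous := by fun_prop
  sub_eq f f' v v' := by
    rw [← Finset.sum_sub_distrib, ← Finset.sum_add_distrib]
    refine Finset.sum_congr rfl fun i _ => ?_
    simp only [Pi.sub_apply, PiLp.sub_apply]; module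
  sq_le f v := by
    calc _ ≤ (∑ i, ‖f i • v i‖ₑ) ^ 2 := by gcongr; exact enorm_sum_le _ _
      _ ≤ 3 * ∑ i, ‖f i • v i‖ₑ ^ 2 := by
          simpa using sum_sq_le_card_mul Finset.univ fun i => ‖f i • v i‖ₑ
      _ ≤ _ := by
          refine mul_le_mul_right ?_ _
          rw [Finset.mul_sum]
          refine Finset.sum_le_sum fun i _ => ?_
          rw [enorm_smul, mul_pow]
          gcongr
          exact enorm_apply_le f i

theorem stronglyMeasurable_fin_three {Z V : Type*} [MeasurableSpace Z] [TopologicalSpace V]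
    {γ : Fin 3 → Z → V} (h : ∀ i, StronglyMeasurable (γ i)) :
    StronglyMeasurable fun z i => γ i z := by
  have hc : Continuous fun q : V × V × V => (![q.1, q.2.1, q.2.2] : Fin 3 → V) :=
    continuous_pi fun i => by fin_cases i <;> simp <;> fun_prop
  convert hc.comp_stronglyMeasurable ((h 0).prodMk ((h 1).prodMk (h 2))) using 1
  funext z i
  fin_cases i <;> rfl

/-- The spatial, temporal and `L²` estimates are added. In the last one the factor `T` meets the
weight `2 + T^{-l}`, which yields `T` and `T^{1-l}` again. -/
theorem ConeDomain.exists_lSq_product_le {V W : Type*} [NormedAddCommGroup V] [NormedSpace ℝ V]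
    [CompleteSpace V] [NormedAddCommGroup W] [NormedSpace ℝ W] {Ω : Set (E 3)} {c : E 3} {ρ : ℝ}
    (hΩ : ConeDomain Ω c ρ) {l : ℝ} (hl : 1 / 2 < l) (hl' : l < 1) :
    ∃ K : ℝ, 0 < K ∧ ∀ (B : V → (Fin 3 → V) → W), IsBoundedProduct B → ∀ (T : ℝ), 0 < T →
      ∀ (F G : ℝ × E 3 → V) (DG : Fin 3 → ℝ × E 3 → V), MemH l Ω T F → MemH l Ω T G →
      IsWeakGrad Ω T G DG → lSq l Ω T (fun z => B (F z) fun i => DG i z) ≤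
        ENNReal.ofReal (K * (T + T ^ (1 - l))) * (hSq l Ω T F * hSq l Ω T G) := by
  obtain ⟨C, hC, H⟩ := hΩ.exists_hData (V := V) hl hl'
  have hρ := hΩ.pos
  have hm := hΩ.measurableSet
  have h1l : 0 < 1 - l := by linarith
  have hn : ∫⁻ w, nearKernel l (ρ / 2) w < ⊤ :=
    lintegral_rpow_neg_ball_lt_top (by nlinarith)
  have hf : ∫⁻ w, farKernel l (ρ / 2) w < ⊤ :=
    lintegral_rpow_neg_compl_ball_lt_top (by linarith) (by linarith)
  set N : ℝ := (∫⁻ w, nearKernel l (ρ / 2) w).toReal + (∫⁻ w, farKernel l (ρ / 2) w).toReal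
  have hN : 0 ≤ N := by positivity
  have hNn : ∫⁻ w, nearKernel l (ρ / 2) w ≤ ENNReal.ofReal N := by
    rw [← ENNReal.ofReal_toReal hn.ne]
    exact ENNReal.ofReal_le_ofReal (le_add_of_nonneg_right ENNReal.toReal_nonneg)
  have hNf : ∫⁻ w, farKernel l (ρ / 2) w ≤ ENNReal.ofReal N := by
    rw [← ENNReal.ofReal_toReal hf.ne]
    exact ENNReal.ofReal_le_ofReal (le_add_of_nonneg_left ENNReal.toReal_nonneg)
  set K₁ : ℝ := 18 * C * ((1 + C) * N) + 18 * C * (1 + 4 * N) with hK₁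
  set K₂ : ℝ := 2 / (1 - l) * (18 * C ^ 2 * (1 + 2 * C) + 18 * C) with hK₂
  have hK₁0 : 0 ≤ K₁ := by positivity
  have hK₂0 : 0 ≤ K₂ := by positivity
  refine ⟨K₁ + K₂ + 36 * C, by positivity, fun B hB T hT F G DG hF hG hDG => ?_⟩
  set M : ℝ := (K₁ + K₂ + 36 * C) * (T + T ^ (1 - l)) with hM
  have hM0 : 0 < M := by positivity
  have hMe : ENNReal.ofReal M ≠ 0 := by simpa using hM0
  -- The estimate is proved for strict upper bounds of the two squared norms, because those are
  -- infima that need not be attained. The constant is moved to the left so that the right side is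
  -- exactly `P * Q`.
  have key : ∀ P > hSq l Ω T F, ∀ Q > hSq l Ω T G,
      (ENNReal.ofReal M)⁻¹ * lSq l Ω T (fun z => B (F z) fun i => DG i z) ≤ P * Q := by
    intro P hP Q hQ
    rcases eq_or_ne P ⊤ with rfl | hPt
    · rw [ENNReal.top_mul (zero_le.trans_lt hQ).ne']; exact le_top
    rcases eq_or_ne Q ⊤ with rfl | hQt
    · rw [ENNReal.mul_top (zero_le.trans_lt hP).ne']; exact le_top
    obtain ⟨F', g, b, hFF, -, dF⟩ := H T F P hPt hP
    obtain ⟨G', γ, d, hGG, hγ, dG⟩ := H T G Q hQt hQ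
    -- The given gradient and the one in the data are weak gradients of almost everywhere equal
    -- functions, so they agree almost everywhere.
    have hDγ : ∀ i, DG i =ᵐ[volume.restrict (cyl Ω T)] γ i := fun i =>
      (hDG i).ae_unique (isOpen_cyl hΩ.isOpen) ((hγ i).congr hGG.symm EventuallyEq.rfl)
    set p : ℝ × E 3 → W := fun z => B (F' z) fun i => γ i z with hp
    have hpb : IsProductBounded F' γ p := hB.isProductBounded F' γ
    have hpm : StronglyMeasurable p := by
      refine hB.continuous.comp_stronglyMeasurable (dF.meas.prodMk ?_)
      exact stronglyMeasurable_fin_three dG.meas_grad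
    have hqp : (fun z => B (F z) fun i => DG i z) =ᵐ[volume.restrict (cyl Ω T)] p := by
      filter_upwards [hFF, ae_all_iff.2 hDγ] with z h1 h2
      simp only [hp, h1, h2]
    have i1 := dF.lintegral_slobodetskii_space_le dG hpb hl hl' hT hC hPt hQt hN hNn hNf
    have i2 := dF.lintegral_slobodetskii_time_le dG hpm hpb hl' hT hC hPt hQt
    have i3 := dF.lintegral_sq_le dG hpb hPt
    rw [mul_comm, ← div_eq_mul_inv]
    refine ENNReal.div_le_of_le_mul' ?_
    refine (lSq_le_of_ae_eq (by linarith) hl' hpm hqp).trans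
      ((add_le_add (add_le_add i1 i2) (mul_le_mul_right i3 _)).trans ?_)
    have h2e : (2 : ℝ≥0∞) + ENNReal.ofReal (T ^ (-l)) = ENNReal.ofReal (2 + T ^ (-l)) := by
      rw [ENNReal.ofReal_add (by norm_num) (by positivity), ENNReal.ofReal_ofNat]
    generalize P * Q = R
    rw [h2e, ← mul_assoc, ← add_mul, ← ENNReal.ofReal_mul (by positivity), ← add_mul,
      ← ENNReal.ofReal_add (by positivity) (by positivity),
      ← ENNReal.ofReal_add (by positivity) (by positivity)]
    refine mul_le_mul_left (ENNReal.ofReal_le_ofReal ?_) _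
    have hTT : T ^ (-l) * T = T ^ (1 - l) := by
      rw [mul_comm, sub_eq_add_neg, Real.rpow_add hT, Real.rpow_one]
    have hX : 0 < T ^ (1 - l) := by positivity
    set X := T ^ (1 - l)
    have e : (2 + T ^ (-l)) * (18 * C * T) = 36 * C * T + 18 * C * X := by
      rw [← hTT]; ring
    rw [e, hM, hK₁, hK₂]
    have a1 : 0 ≤ 18 * C * ((1 + C) * N) * T := by positivity
    have a2 : 0 ≤ 18 * C * (1 + 4 * N) * X := by positivity
    have a3 : 0 ≤ K₂ * T := by positivity
    have a4 : 0 ≤ C * X := by positivity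
    rw [hK₂] at a3
    nlinarith
  have hFt : hSq l Ω T F ≠ ⊤ := fun h => by
    have := hF; simp [MemH, hNorm, h] at this
  have hGt : hSq l Ω T G ≠ ⊤ := fun h => by
    have := hG; simp [MemH, hNorm, h] at this
  -- Here `P` and `Q` decrease to the squared norms; finiteness of both excludes the indeterminate
  -- product `0 · ∞`.
  have h := ENNReal.le_mul_of_forall_lt (Or.inr hGt) (Or.inl hFt) key
  rwa [mul_comm, ← div_eq_mul_inv, ENNReal.div_le_iff' hMe ENNReal.ofReal_ne_top] at h

/-- With `x = T^{1/2}` and `y = T^{(1-l)/2}`, the factor under the root is `x² + y² ≤ (T + x + y)²`.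
-/
theorem lNorm_le_of_lSq_le {V W : Type*} [NormedAddCommGroup V] [NormedSpace ℝ V]
    [NormedAddCommGroup W] [NormedSpace ℝ W] {Ω : Set (E 3)} {l T K : ℝ} (hT : 0 < T)
    (hK : 0 ≤ K) {q : ℝ × E 3 → W} {F G : ℝ × E 3 → V}
    (h : lSq l Ω T q ≤ ENNReal.ofReal (K * (T + T ^ (1 - l))) * (hSq l Ω T F * hSq l Ω T G)) :
    lNorm l Ω T q ≤ ENNReal.ofReal (√K * (T + T ^ ((1 - l) / 2) + T ^ (1 / 2 : ℝ))) *
      hNorm l Ω T F * hNorm l Ω T G := by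
  unfold lNorm hNorm
  have h0 : (0 : ℝ) ≤ 1 / 2 := by norm_num
  refine (ENNReal.rpow_le_rpow h h0).trans ?_
  rw [ENNReal.mul_rpow_of_nonneg _ _ h0, ENNReal.mul_rpow_of_nonneg _ _ h0, ← mul_assoc]
  refine mul_le_mul_left (mul_le_mul_left ?_ _) _
  rw [ENNReal.ofReal_rpow_of_nonneg (by positivity) h0]
  refine ENNReal.ofReal_le_ofReal ?_
  rw [← Real.sqrt_eq_rpow, Real.sqrt_mul hK]
  refine mul_le_mul_of_nonneg_left ?_ (Real.sqrt_nonneg _)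
  refine Real.sqrt_le_iff.2 ⟨by positivity, ?_⟩
  have e1 : T = (T ^ (1 / 2 : ℝ)) ^ 2 := by
    rw [← Real.rpow_natCast, ← Real.rpow_mul hT.le]; norm_num
  have e2 : T ^ (1 - l) = (T ^ ((1 - l) / 2)) ^ 2 := by
    rw [← Real.rpow_natCast, ← Real.rpow_mul hT.le]; congr 1; push_cast; ring
  have h1 : 0 < T ^ (1 / 2 : ℝ) := by positivity
  have h2 : 0 < T ^ ((1 - l) / 2) := by positivity
  rw [e2]
  set x := T ^ (1 / 2 : ℝ)
  set y := T ^ ((1 - l) / 2)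
  have h3 : T + y ^ 2 = x ^ 2 + y ^ 2 := by rw [← e1]
  rw [h3]
  nlinarith [mul_pos h1 h2, mul_pos hT h1, mul_pos hT h2]

theorem tendsto_add_rpow_add_rpow {l : ℝ} (hl' : l < 1) :
    Tendsto (fun T : ℝ => T + T ^ ((1 - l) / 2) + T ^ (1 / 2 : ℝ)) (𝓝[>] 0) (𝓝 0) := by
  have h1 : 0 < (1 - l) / 2 := by linarith
  have hc : Continuous fun T : ℝ => T + T ^ ((1 - l) / 2) + T ^ (1 / 2 : ℝ) :=
    (continuous_id.add (Real.continuous_rpow_const h1.le)).add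
      (Real.continuous_rpow_const (by norm_num))
  have := hc.tendsto 0
  rw [Real.zero_rpow h1.ne', Real.zero_rpow (by norm_num)] at this
  simp only [add_zero] at this
  exact this.mono_left nhdsWithin_le_nhds

end MHD

end

theorem proposition4p2 (l : ℝ) (hl : 1 / 2 < l) (hl' : l < 1) (h : MHD.E 2 → ℝ)
    (hh : MHD.IsSobolevSurface (l + 3 / 2) h) :
    (∃ C : ℝ, 0 < C ∧ ∀ (T : ℝ), 0 < T → ∀ (F G : ℝ × MHD.E 3 → MHD.E 3)
      (DG : Fin 3 → ℝ × MHD.E 3 → MHD.E 3),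
      MHD.MemH l (MHD.fluidDomain h) T F → MHD.MemH l (MHD.fluidDomain h) T G →
      MHD.IsWeakGrad (MHD.fluidDomain h) T G DG →
      (∀ a i : Fin 3,
        MHD.lNorm l (MHD.fluidDomain h) T (fun z => F z a • DG i z) ≤
          ENNReal.ofReal (C * (T + T ^ ((1 - l) / 2) + T ^ (1 / 2 : ℝ))) *
            MHD.hNorm l (MHD.fluidDomain h) T F * MHD.hNorm l (MHD.fluidDomain h) T G) ∧
      MHD.lNorm l (MHD.fluidDomain h) T (fun z => ∑ i, F z i • DG i z) ≤
        ENNReal.ofReal (C * (T + T ^ ((1 - l) / 2) + T ^ (1 / 2 : ℝ))) *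
          MHD.hNorm l (MHD.fluidDomain h) T F * MHD.hNorm l (MHD.fluidDomain h) T G) ∧
    Filter.Tendsto (fun T : ℝ => T + T ^ ((1 - l) / 2) + T ^ (1 / 2 : ℝ))
      (nhdsWithin 0 (Set.Ioi 0)) (nhds 0) := by
  obtain ⟨L, hL, hLh⟩ := hh.exists_lipschitz hl hl'
  obtain ⟨c, ρ, hΩ⟩ := MHD.exists_coneDomain_fluidDomain hh.1 hL hLh
  obtain ⟨K, hK, H⟩ := hΩ.exists_lSq_product_le (V := MHD.E 3) (W := MHD.E 3) hl hl'
  refine ⟨⟨√K, Real.sqrt_pos.2 hK, fun T hT F G DG hF hG hDG => ⟨fun a i => ?_, ?_⟩⟩,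
    MHD.tendsto_add_rpow_add_rpow hl'⟩
  · exact MHD.lNorm_le_of_lSq_le hT hK.le
      (H _ (MHD.isBoundedProduct_smul a i) T hT F G DG hF hG hDG)
  · exact MHD.lNorm_le_of_lSq_le hT hK.le (H _ MHD.isBoundedProduct_sum T hT F G DG hF hG hDG)
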